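/- All graphs are finite and simple. For a graph $G$ let $n(G)$ and $e(G)$ be its numbers of vertices and edges, let $\Phi(G)$ be its number of perfect matchings, and let $c(G) = e(G) - \frac14 n(G)^2$ be its excess. A connected graph is \emph{1-extendable} if each of its edges lies in a perfect matching. For a 1-extendable graph $H$ put \[ \mathcal{E}(H) = \{ G \supseteq H : V(G) = V(H),\ \Phi(G) = \Phi(H) \}. \] An \emph{ear augmentation} of a graph $H$ adds to $H$ one or more ears that have pairwise no internal vertex and no edge in common; here an \emph{ear} is a path that joins two different vertices of $H$, all of whose edges and internal vertices are not in $H$, and whose number of internal vertices is even (possibly $0$, in which case the ear is a single new edge). A sequence $H = H^{(0)} \subset H^{(1)} \subset \cdots \subset H^{(k)} = H'$ is a \emph{graded ear decomposition} if every $H^{(i)}$ is 1-extendable and each $H^{(i+1)}$ is an ear augmentation of $H^{(i)}$; we then say that $H'$ is built from $H$ by a graded ear decomposition. \textbf{Lemma.} Let $H$ be a 1-extendable graph on $n$ vertices with $\Phi(H) = q$. Let $H'$ be a 1-extendable supergraph of $H$ built from $H$ by a graded ear decomposition, with $\Phi(H') = p > q$ and $n(H') = N$. Let $G \in \mathcal{E}(H)$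 and $G' \in \mathcal{E}(H')$ have the maximum number of edges in $\mathcal{E}(H)$ and in $\mathcal{E}(H')$, respectively. Then \[ c(G') \le c(G) + 2(p-q) - \tfrac14 (N-n)(n-2). \] -/

import Mathlib

namespace EarExcess

/-- A simple graph whose vertices form a subset of `U`. The order `≤` on these is the
subgraph relation and `⊔` is the union of graphs. -/
abbrev Gph (U : Type*) := (⊤ : SimpleGraph U).Subgraph

variable {U : Type*}

/-- The number of vertices `n(G)`. -/
noncomputable def numVerts (G : Gph U) : ℕ := G.verts.ncard

/-- The number of edges `e(G)`. -/
noncomputable def numEdges (G : Gph U) : ℕ := G.edgeSet.ncard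

/-- The excess `c(G) = e(G) - n(G)² / 4`. -/
noncomputable def excess (G : Gph U) : ℝ := (numEdges G : ℝ) - (numVerts G : ℝ) ^ 2 / 4

/-- `M` is a perfect matching of `G`: a subgraph with the vertex set of `G` in which every
vertex has exactly one neighbour. -/
def IsPerfectMatchingOf (M G : Gph U) : Prop :=
  M ≤ G ∧ M.verts = G.verts ∧ M.IsMatching

/-- `Φ(G)`, the number of perfect matchings of `G`. -/
noncomputable def numPM (G : Gph U) : ℕ := {M : Gph U | IsPerfectMatchingOf M G}.ncard

/-- The edge `e` is extendable in `G`: some perfect matching of `G` contains it. -/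
def IsExtendable (G : Gph U) (e : Sym2 U) : Prop :=
  ∃ M : Gph U, IsPerfectMatchingOf M G ∧ e ∈ M.edgeSet

/-- A connected graph is 1-extendable if each of its edges is extendable. -/
def OneExtendable (G : Gph U) : Prop :=
  G.Connected ∧ ∀ e ∈ G.edgeSet, IsExtendable G e

/-- `𝓔(H)`: the supergraphs of `H` with the same vertex set and the same number of perfect
matchings. -/
def elemSupergraphs (H : Gph U) : Set (Gph U) :=
  {G | H ≤ G ∧ G.verts = H.verts ∧ numPM G = numPM H}

/-- `G` is an element of `𝓔(H)` with the maximum number of edges. -/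
def IsEdgeMaximum (G H : Gph U) : Prop :=
  G ∈ elemSupergraphs H ∧ ∀ K ∈ elemSupergraphs H, numEdges K ≤ numEdges G

/-- The internal vertices of a path. -/
def internalVerts {a b : U} (P : (⊤ : SimpleGraph U).Walk a b) : Set U :=
  {x | x ∈ P.support ∧ x ≠ a ∧ x ≠ b}

/-- An ear of even order to be added to `H`: a path that joins two different vertices of `H`,
whose internal vertices are new and even in number, and whose edges are new. -/
structure Ear (H : Gph U) where
  fst : U
  snd : U
  path : (⊤ : SimpleGraph U).Walk fst snd
  isPath : path.IsPath
  ne : fst ≠ snd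
  fst_mem : fst ∈ H.verts
  snd_mem : snd ∈ H.verts
  internal_new : Disjoint (internalVerts path) H.verts
  edges_new : Disjoint path.toSubgraph.edgeSet H.edgeSet
  even_order : Even (internalVerts path).ncard

/-- `K` arises from `H` by adding one or more ears of even order, any two of which have no
internal vertex and no edge in common. -/
def IsEarAugmentation (H K : Gph U) : Prop :=
  ∃ (r : ℕ) (ε : Fin r → Ear H), 0 < r ∧
    (∀ i j, i ≠ j → Disjoint (internalVerts (ε i).path) (internalVerts (ε j).path) ∧
      Disjoint (ε i).path.toSubgraph.edgeSet (ε j).path.toSubgraph.edgeSet) ∧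
    K = H ⊔ ⨆ i, (ε i).path.toSubgraph

/-- `F 0 ⊂ F 1 ⊂ ⋯ ⊂ F k` is a graded ear decomposition: every graph in it is 1-extendable
and each one arises from the preceding one by an ear augmentation. -/
def IsGradedEarDecomposition (k : ℕ) (F : ℕ → Gph U) : Prop :=
  (∀ i ≤ k, OneExtendable (F i)) ∧ ∀ i < k, IsEarAugmentation (F i) (F (i + 1))

/-- `H'` is built from `H` by a graded ear decomposition. -/
def BuiltByGradedEars (H H' : Gph U) : Prop :=
  ∃ (k : ℕ) (F : ℕ → Gph U), F 0 = H ∧ F k = H' ∧ IsGradedEarDecomposition k F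

end EarExcess

/-! Let R be the set of the N - n vertices added to H, and call an edge of G' free if it is not in
H'. The edges of G' fall into three groups. (1) H together with the free edges inside V(H) is a
graph in 𝓔(H): any perfect matching of it, completed by a perfect matching of H' on R, is a perfect
matching of G' and so uses only edges of H'. Hence this group has at most e(G) edges. (2) The edges
in H' but not in H number at most (N - n) + 2(p - q). (3) The free edges meeting R number at most (N
- n)(N - 2)/4. For an edge uv of H' the free degrees of u and v sum to at most (N - 2)/2, and this
is summed over a perfect matching of R. Adding the three bounds gives the claim.

For (3), take a perfect matching of H' through uv and another edge xy of it. At most one free edge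
joins {u, v} to {x, y}. If ux and vy were both free, exchanging them for uv and xy would give a
perfect matching of G' with a free edge. If ux and uy were both free, then, since x and y are
adjacent, deleting {u, x} or {u, y} leaves a matchable graph (`Elementary.matchable_sdiff_or`),
again putting a free edge into a perfect matching.

For (2), each ear adds one more edge than vertices, so it suffices that r ears create at least r/2
new perfect matchings. A set of ears is used by some perfect matching exactly if its end pairs are
removable: disjoint, with H minus all their ends matchable. The heart is the two-ear theorem
`Elementary.exists_two_of_matchable`: a nonempty removable family contains one or two pairs that are
removable on their own. Pairs can then be adjoined as edges at most two at a time, keeping the graph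
elementary, and every stage yields a new removable family (`Elementary.card_le_two_mul_removable`).

The two-ear theorem is proved by contradiction inside a barrier with matchable punctured parts. Each
failure of two pairs to be removable together is a Hall violation, that is, a tight set with exactly
one neighbouring part more than elements. The function |N(S)| - |S| is submodular and at least 1 on
nonempty proper subsets, and extremal choices of tight sets then clash. -/

namespace EarExcess

/-! ### Matchable vertex sets and Tutte's condition -/

section Matching

variable {V : Type*}

/-- `σ` sends every vertex of `W` to its partner in a perfect matching of the subgraph of `L`
induced on `W`. -/
def PairsUp (L : SimpleGraph V) (W : Finset V) (σ : V → V) : Prop :=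
  ∀ w ∈ W, σ w ∈ W ∧ σ (σ w) = w ∧ L.Adj w (σ w)

/-- The subgraph of `L` induced on `W` has a perfect matching. -/
def Matchable (L : SimpleGraph V) (W : Finset V) : Prop := ∃ σ, PairsUp L W σ

theorem PairsUp.mono {L K : SimpleGraph V} {W : Finset V} {σ : V → V} (h : PairsUp L W σ)
    (hLK : ∀ x y, L.Adj x y → K.Adj x y) : PairsUp K W σ := fun w hw =>
  ⟨(h w hw).1, (h w hw).2.1, hLK _ _ (h w hw).2.2⟩

theorem Matchable.mono {L K : SimpleGraph V} {W : Finset V} (h : Matchable L W)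
    (hLK : ∀ x y, L.Adj x y → K.Adj x y) : Matchable K W :=
  h.imp fun _ hσ => hσ.mono hLK

/-- The partner map is a fixed-point-free involution of `W`, so the constant 1 sums to 0 modulo 2.
-/
theorem PairsUp.even {L : SimpleGraph V} {W : Finset V} {σ : V → V} (h : PairsUp L W σ) :
    Even W.card := by
  have h0 : ∑ _w ∈ W, (1 : ZMod 2) = 0 :=
    Finset.sum_involution (fun w _ => σ w) (fun _ _ => by decide)
      (fun w hw _ he => (h w hw).2.2.ne he.symm) (fun w hw => (h w hw).1)
      (fun w hw => (h w hw).2.1)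
  rw [Finset.sum_const, nsmul_eq_mul, mul_one] at h0
  exact (ZMod.natCast_eq_zero_iff_even).1 h0

theorem exists_glue {ι : Type*} (A : ι → Finset V) (σ : ι → V → V)
    (hA : ∀ i j x, x ∈ A i → x ∈ A j → i = j) :
    ∃ τ : V → V, ∀ i, ∀ x ∈ A i, τ x = σ i x := by
  classical
  refine ⟨fun x => if h : ∃ i, x ∈ A i then σ h.choose x else x, fun i x hx => ?_⟩
  have h : ∃ i, x ∈ A i := ⟨i, hx⟩
  have := hA _ _ x h.choose_spec hx
  simp only [dif_pos h, this]

theorem PairsUp.congr {L : SimpleGraph V} {W : Finset V} {σ τ : V → V} (h : PairsUp L W σ)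
    (hτ : ∀ x ∈ W, τ x = σ x) : PairsUp L W τ := fun w hw => by
  obtain ⟨h1, h2, h3⟩ := h w hw
  rw [hτ w hw, hτ _ h1]
  exact ⟨h1, h2, h3⟩

theorem PairsUp.biUnion [DecidableEq V] {L : SimpleGraph V} {ι : Type*} {s : Finset ι}
    {A : ι → Finset V} {τ : V → V} (h : ∀ i ∈ s, PairsUp L (A i) τ) :
    PairsUp L (s.biUnion A) τ := fun w hw => by
  obtain ⟨i, hi, hw⟩ := Finset.mem_biUnion.1 hw
  obtain ⟨h1, h2, h3⟩ := h i hi w hw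
  exact ⟨Finset.mem_biUnion.2 ⟨i, hi, h1⟩, h2, h3⟩

theorem Matchable.biUnion [DecidableEq V] {L : SimpleGraph V} {ι : Type*} {s : Finset ι}
    {A : ι → Finset V} (h : ∀ i ∈ s, Matchable L (A i))
    (hd : ∀ i ∈ s, ∀ j ∈ s, ∀ x, x ∈ A i → x ∈ A j → i = j) : Matchable L (s.biUnion A) := by
  classical
  have h' : ∀ i : s, Matchable L (A i) := fun i => h i i.2
  choose σ hσ using h'
  obtain ⟨τ, hτ⟩ := exists_glue (fun i : s => A i) σ
    (fun i j x hi hj => Subtype.ext (hd i i.2 j j.2 x hi hj))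
  exact ⟨τ, PairsUp.biUnion fun i hi => (hσ ⟨i, hi⟩).congr (hτ ⟨i, hi⟩)⟩

theorem Matchable.union [DecidableEq V] {L : SimpleGraph V} {A B : Finset V}
    (hA : Matchable L A) (hB : Matchable L B) (hd : Disjoint A B) : Matchable L (A ∪ B) := by
  have := Matchable.biUnion (L := L) (s := Finset.univ) (A := fun b : Bool => if b then A else B)
    (by rintro (_ | _) - <;> simpa) (by
      have := Finset.disjoint_left.1 hd
      rintro (_ | _) - (_ | _) - x h1 h2 <;> simp_all)
  convert this using 1
  ext x; simp

theorem Matchable.pair [DecidableEq V] {L : SimpleGraph V} {x y : V} (h : L.Adj x y) :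
    Matchable L {x, y} := by
  refine ⟨Equiv.swap x y, fun w hw => ?_⟩
  rcases Finset.mem_insert.1 hw with rfl | hw
  · simp [h]
  · rw [Finset.mem_singleton.1 hw]; simp [h.symm]

theorem Matchable.empty {L : SimpleGraph V} : Matchable L ∅ := ⟨id, by simp [PairsUp]⟩

theorem PairsUp.sdiff_pair [DecidableEq V] {L : SimpleGraph V} {W : Finset V} {σ : V → V}
    (h : PairsUp L W σ) {x : V} (hx : x ∈ W) : PairsUp L (W \ {x, σ x}) σ := fun w hw => by
  simp only [Finset.mem_sdiff, Finset.mem_insert, Finset.mem_singleton, not_or] at hw ⊢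
  obtain ⟨h1, h2, h3⟩ := h w hw.1
  refine ⟨⟨h1, fun h4 => hw.2.2 ?_, fun h4 => hw.2.1 ?_⟩, h2, h3⟩
  · rw [← h4, h2]
  · rw [← h2, h4, (h x hx).2.1]

/-- The vertices of `W` outside `A` are partitioned into the odd sets in `𝒞`, and no edge of `L`
joins two different ones of them. -/
structure OddSplit (L : SimpleGraph V) (W A : Finset V) (𝒞 : Finset (Finset V)) : Prop where
  subset : A ⊆ W
  odd : ∀ C ∈ 𝒞, Odd C.card
  disj : ∀ C ∈ 𝒞, ∀ D ∈ 𝒞, ∀ x, x ∈ C → x ∈ D → C = D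
  cover : ∀ x, (∃ C ∈ 𝒞, x ∈ C) ↔ x ∈ W ∧ x ∉ A
  closed : ∀ C ∈ 𝒞, ∀ x ∈ C, ∀ y ∈ W, y ∉ A → L.Adj x y → y ∈ C

theorem sum_odd_parity (𝒞 : Finset (Finset V)) (h : ∀ C ∈ 𝒞, Odd C.card) :
    (∑ C ∈ 𝒞, C.card) % 2 = 𝒞.card % 2 := by
  classical
  induction 𝒞 using Finset.induction_on with
  | empty => simp
  | insert C 𝒞 hC ih =>
    rw [Finset.sum_insert hC, Finset.card_insert_of_notMem hC]
    have h1 := ih fun D hD => h D (Finset.mem_insert_of_mem hD)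
    have h2 := Nat.odd_iff.1 (h C (Finset.mem_insert_self _ _))
    omega

/-- All parts are odd, so they cover a number of vertices congruent to `𝒞.card`. This parity turns a
surplus of one part over `A` into a surplus of two when `W` is even. -/
theorem OddSplit.card_mod [DecidableEq V] {L : SimpleGraph V} {W A : Finset V}
    {𝒞 : Finset (Finset V)} (h : OddSplit L W A 𝒞) : W.card % 2 = (A.card + 𝒞.card) % 2 := by
  have h1 : W \ A = 𝒞.biUnion id := by
    ext x
    rw [Finset.mem_sdiff, ← h.cover x]
    simp
  have h2 : (W \ A).card = ∑ C ∈ 𝒞, C.card := by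
    rw [h1, Finset.card_biUnion]
    · rfl
    · intro C hC D hD hne
      rw [Function.onFun, Finset.disjoint_left]
      exact fun x hx hx' => hne (h.disj C hC D hD x hx hx')
  have h3 := sum_odd_parity 𝒞 h.odd
  have h4 := Finset.card_sdiff_add_card_eq_card h.subset
  omega

/-- Tutte's theorem for the induced graph, with the odd components as parts. The even components
have to be accommodated as well, because the parts must cover everything outside `A`. -/
theorem exists_oddSplit_of_not_matchable [DecidableEq V] {L : SimpleGraph V} {W : Finset V}
    (h : ¬ Matchable L W) : ∃ A 𝒞, OddSplit L W A 𝒞 ∧ A.card < 𝒞.card := by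
  classical
  let G : SimpleGraph W := L.comap (fun w : W => (w : V))
  have h1 : ¬ ∃ M : G.Subgraph, M.IsPerfectMatching := by
    rintro ⟨M, hM⟩
    have hM' := SimpleGraph.Subgraph.isPerfectMatching_iff.1 hM
    choose f hf hf' using hM'
    refine h ⟨fun v => if hv : v ∈ W then f ⟨v, hv⟩ else v, fun w hw => ?_⟩
    have h2 : f (f ⟨w, hw⟩) = ⟨w, hw⟩ := (hf' _ _ (hf ⟨w, hw⟩).symm).symm
    have h3 : G.Adj ⟨w, hw⟩ (f ⟨w, hw⟩) := (hf ⟨w, hw⟩).adj_sub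
    simp only [dif_pos hw, (f ⟨w, hw⟩).2, dite_true, Subtype.coe_eta, h2]
    exact ⟨trivial, trivial, h3⟩
  rw [SimpleGraph.tutte] at h1
  push Not at h1
  obtain ⟨u, hu⟩ := h1
  unfold SimpleGraph.IsTutteViolator at hu
  set D := (⊤ : G.Subgraph).deleteVerts u with hD
  have hDv : ∀ w : W, w ∈ D.verts ↔ w ∉ u := fun w => by simp [hD]
  let φ : D.verts → V := fun x => x.1.1
  have hφ : Function.Injective φ := fun x y hxy => Subtype.ext (Subtype.ext hxy)
  let P : D.coe.ConnectedComponent → Finset V := fun c => (c.supp.toFinite.image φ).toFinset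
  have hP : ∀ c x, x ∈ P c ↔ ∃ y, D.coe.connectedComponentMk y = c ∧ φ y = x := fun c x => by
    simp [P]
  have hPd : ∀ c d x, x ∈ P c → x ∈ P d → c = d := fun c d x hc hd => by
    obtain ⟨y, hy, hyx⟩ := (hP c x).1 hc
    obtain ⟨z, hz, hzx⟩ := (hP d x).1 hd
    rw [← hy, ← hz, hφ (hyx.trans hzx.symm)]
  have hPne : ∀ c, (P c).Nonempty := fun c => by
    obtain ⟨y, hy⟩ := c.exists_rep
    exact ⟨φ y, (hP _ _).2 ⟨y, hy, rfl⟩⟩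
  have hPinj : Function.Injective P := fun c d hcd => by
    obtain ⟨x, hx⟩ := hPne c
    exact hPd c d x hx (hcd ▸ hx)
  have hPcard : ∀ c, (P c).card = c.supp.ncard := fun c => by
    rw [← Set.ncard_coe_finset]
    simp only [P, Set.Finite.coe_toFinset]
    exact Set.ncard_image_of_injective _ hφ
  let A : Finset V := (u.toFinite.image Subtype.val).toFinset
  have hA : ∀ x, x ∈ A ↔ ∃ hx : x ∈ W, (⟨x, hx⟩ : W) ∈ u := fun x => by simp [A]
  have hAcard : A.card = u.ncard := by
    rw [← Set.ncard_coe_finset]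
    simp only [A, Set.Finite.coe_toFinset]
    exact Set.ncard_image_of_injective _ Subtype.val_injective
  let 𝒪 : Finset (Finset V) := (D.coe.oddComponents.toFinite.image P).toFinset
  have h𝒪 : ∀ C, C ∈ 𝒪 ↔ ∃ c, Odd c.supp.ncard ∧ P c = C := fun C => by
    simp [𝒪]
  have h𝒪card : 𝒪.card = D.coe.oddComponents.ncard := by
    rw [← Set.ncard_coe_finset]
    simp only [𝒪, Set.Finite.coe_toFinset]
    exact Set.ncard_image_of_injective _ hPinj
  have hAW : A ⊆ W := fun x hx => ((hA x).1 hx).1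
  have hsub : ∀ C ∈ 𝒪, ∀ x ∈ C, x ∈ W ∧ x ∉ A := by
    intro C hC x hx
    obtain ⟨c, -, rfl⟩ := (h𝒪 C).1 hC
    obtain ⟨y, -, rfl⟩ := (hP c x).1 hx
    refine ⟨y.1.2, fun hyA => ?_⟩
    obtain ⟨_, hyu⟩ := (hA _).1 hyA
    exact (hDv y.1).1 y.2 hyu
  have hodd : ∀ C ∈ 𝒪, Odd C.card := by
    intro C hC
    obtain ⟨c, hc, rfl⟩ := (h𝒪 C).1 hC
    rwa [hPcard]
  have hdisj : ∀ C ∈ 𝒪, ∀ E ∈ 𝒪, ∀ x, x ∈ C → x ∈ E → C = E := by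
    intro C hC E hE x hx hx'
    obtain ⟨c, -, rfl⟩ := (h𝒪 C).1 hC
    obtain ⟨d, -, rfl⟩ := (h𝒪 E).1 hE
    rw [hPd c d x hx hx']
  have hclosed : ∀ C ∈ 𝒪, ∀ x ∈ C, ∀ y ∈ W, y ∉ A → L.Adj x y → y ∈ C := by
    intro C hC x hx y hy hyA hxy
    obtain ⟨c, -, rfl⟩ := (h𝒪 C).1 hC
    obtain ⟨z, rfl, rfl⟩ := (hP c x).1 hx
    have hyu : (⟨y, hy⟩ : W) ∉ u := fun hyu => hyA ((hA y).2 ⟨hy, hyu⟩)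
    refine (hP _ _).2 ⟨⟨⟨y, hy⟩, (hDv _).2 hyu⟩, ?_, rfl⟩
    refine (SimpleGraph.ConnectedComponent.connectedComponentMk_eq_of_adj ?_).symm
    exact SimpleGraph.Subgraph.deleteVerts_adj.2 ⟨trivial, (hDv z.1).1 z.2, trivial, hyu, hxy⟩
  have hlt : A.card < 𝒪.card := by rw [hAcard, h𝒪card]; exact hu
  -- `E` is what the odd components leave over. If its size is even, it is merged into one odd
  -- component; if odd, it becomes a part of its own, which only increases the number of parts.
  let E : Finset V := (W \ A) \ 𝒪.biUnion id
  have hE : ∀ x, x ∈ E ↔ (x ∈ W ∧ x ∉ A) ∧ ∀ C ∈ 𝒪, x ∉ C := fun x => by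
    simp [E]
  have hEclosed : ∀ x ∈ E, ∀ y ∈ W, y ∉ A → L.Adj x y → y ∈ E := by
    intro x hx y hy hyA hxy
    refine (hE y).2 ⟨⟨hy, hyA⟩, fun C hC hyC => ?_⟩
    exact ((hE x).1 hx).2 C hC
      (hclosed C hC y hyC x ((hE x).1 hx).1.1 ((hE x).1 hx).1.2 hxy.symm)
  rcases Nat.even_or_odd E.card with hev | hod
  · obtain ⟨C₀, hC₀⟩ : 𝒪.Nonempty := Finset.card_pos.1 (by omega)
    have hC₀E : Disjoint C₀ E := Finset.disjoint_left.2 fun x hx hx' => ((hE x).1 hx').2 C₀ hC₀ hx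
    have hnot : C₀ ∪ E ∉ 𝒪.erase C₀ := by
      intro hmem
      obtain ⟨hne, hmem⟩ := Finset.mem_erase.1 hmem
      obtain ⟨x, hx⟩ : C₀.Nonempty := Finset.card_pos.1 (hodd C₀ hC₀).pos
      exact hne (hdisj _ hmem _ hC₀ x (Finset.mem_union_left _ hx) hx)
    refine ⟨A, insert (C₀ ∪ E) (𝒪.erase C₀), ⟨hAW, ?_, ?_, ?_, ?_⟩, ?_⟩
    · intro C hC
      rcases Finset.mem_insert.1 hC with rfl | hC
      · rw [Finset.card_union_of_disjoint hC₀E]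
        exact (hodd C₀ hC₀).add_even hev
      · exact hodd C (Finset.mem_of_mem_erase hC)
    · have key : ∀ C ∈ 𝒪.erase C₀, ∀ x ∈ C, x ∉ C₀ ∪ E := by
        intro C hC x hx hx'
        obtain ⟨hne, hC⟩ := Finset.mem_erase.1 hC
        rcases Finset.mem_union.1 hx' with h1 | h1
        · exact hne (hdisj C hC C₀ hC₀ x hx h1)
        · exact ((hE x).1 h1).2 C hC hx
      intro C hC F hF x hx hx'
      rcases Finset.mem_insert.1 hC with rfl | hC <;> rcases Finset.mem_insert.1 hF with rfl | hF
      · rfl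
      · exact (key F hF x hx' hx).elim
      · exact (key C hC x hx hx').elim
      · exact hdisj C (Finset.mem_of_mem_erase hC) F (Finset.mem_of_mem_erase hF) x hx hx'
    · intro x
      constructor
      · rintro ⟨C, hC, hx⟩
        rcases Finset.mem_insert.1 hC with rfl | hC
        · rcases Finset.mem_union.1 hx with h1 | h1
          · exact hsub C₀ hC₀ x h1
          · exact ((hE x).1 h1).1
        · exact hsub C (Finset.mem_of_mem_erase hC) x hx
      · intro hx
        by_cases hex : ∃ C ∈ 𝒪, x ∈ C
        · obtain ⟨C, hC, hxC⟩ := hex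
          by_cases hCC : C = C₀
          · exact ⟨_, Finset.mem_insert_self _ _, Finset.mem_union_left _ (hCC ▸ hxC)⟩
          · exact ⟨C, Finset.mem_insert_of_mem (Finset.mem_erase.2 ⟨hCC, hC⟩), hxC⟩
        · push Not at hex
          exact ⟨_, Finset.mem_insert_self _ _, Finset.mem_union_right _ ((hE x).2 ⟨hx, hex⟩)⟩
    · intro C hC x hx y hy hyA hxy
      rcases Finset.mem_insert.1 hC with rfl | hC
      · rcases Finset.mem_union.1 hx with h1 | h1
        · exact Finset.mem_union_left _ (hclosed C₀ hC₀ x h1 y hy hyA hxy)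
        · exact Finset.mem_union_right _ (hEclosed x h1 y hy hyA hxy)
      · exact hclosed C (Finset.mem_of_mem_erase hC) x hx y hy hyA hxy
    · rw [Finset.card_insert_of_notMem hnot, Finset.card_erase_of_mem hC₀]
      omega
  · have hEne : E.Nonempty := Finset.card_pos.1 hod.pos
    have hnot : E ∉ 𝒪 := by
      intro hmem
      obtain ⟨x, hx⟩ := hEne
      exact ((hE x).1 hx).2 E hmem hx
    refine ⟨A, insert E 𝒪, ⟨hAW, ?_, ?_, ?_, ?_⟩, ?_⟩
    · intro C hC
      rcases Finset.mem_insert.1 hC with rfl | hC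
      · exact hod
      · exact hodd C hC
    · intro C hC F hF x hx hx'
      rcases Finset.mem_insert.1 hC with rfl | hC <;> rcases Finset.mem_insert.1 hF with rfl | hF
      · rfl
      · exact (((hE x).1 hx).2 F hF hx').elim
      · exact (((hE x).1 hx').2 C hC hx).elim
      · exact hdisj C hC F hF x hx hx'
    · intro x
      constructor
      · rintro ⟨C, hC, hx⟩
        rcases Finset.mem_insert.1 hC with rfl | hC
        · exact ((hE x).1 hx).1
        · exact hsub C hC x hx
      · intro hx
        by_cases hex : ∃ C ∈ 𝒪, x ∈ C
        · obtain ⟨C, hC, hxC⟩ := hex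
          exact ⟨C, Finset.mem_insert_of_mem hC, hxC⟩
        · push Not at hex
          exact ⟨_, Finset.mem_insert_self _ _, (hE x).2 ⟨hx, hex⟩⟩
    · intro C hC x hx y hy hyA hxy
      rcases Finset.mem_insert.1 hC with rfl | hC
      · exact hEclosed x hx y hy hyA hxy
      · exact hclosed C hC x hx y hy hyA hxy
    · rw [Finset.card_insert_of_notMem hnot]
      omega

/-- In a perfect matching of `L[W]`, every odd set without edges to the other vertices outside
`A` contains a vertex whose partner is in `A`. -/
theorem PairsUp.exists_mem_odd {L : SimpleGraph V} {W A C : Finset V} {σ : V → V}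
    (hσ : PairsUp L W σ) (hodd : Odd C.card) (hCW : C ⊆ W)
    (hclosed : ∀ x ∈ C, ∀ y ∈ W, y ∉ A → L.Adj x y → y ∈ C) : ∃ x ∈ C, σ x ∈ A := by
  by_contra! hno
  refine (Nat.not_even_iff_odd.2 hodd) (PairsUp.even (L := L) (σ := σ) fun w hw => ?_)
  obtain ⟨h1, h2, h3⟩ := hσ w (hCW hw)
  exact ⟨hclosed w hw _ h1 (hno w hw) h3, h2, h3⟩

/-- Each part sends a vertex into `A`, and different parts hit different vertices because `σ` is an
involution. The witnesses are kept for the equality case, where `A` is a barrier. -/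
theorem PairsUp.exists_injOn_odd [Nonempty V] {L : SimpleGraph V} {W A : Finset V} {σ : V → V}
    {𝒞 : Finset (Finset V)} (hσ : PairsUp L W σ) (hodd : ∀ C ∈ 𝒞, Odd C.card)
    (hCW : ∀ C ∈ 𝒞, C ⊆ W) (hdisj : ∀ C ∈ 𝒞, ∀ D ∈ 𝒞, ∀ x, x ∈ C → x ∈ D → C = D)
    (hclosed : ∀ C ∈ 𝒞, ∀ x ∈ C, ∀ y ∈ W, y ∉ A → L.Adj x y → y ∈ C) :
    ∃ f : Finset V → V, (∀ C ∈ 𝒞, f C ∈ C ∧ σ (f C) ∈ A) ∧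
      Set.InjOn (fun C => σ (f C)) (𝒞 : Set (Finset V)) := by
  have h : ∀ C ∈ 𝒞, ∃ x, x ∈ C ∧ σ x ∈ A := fun C hC =>
    hσ.exists_mem_odd (hodd C hC) (hCW C hC) (hclosed C hC)
  choose! f hf using h
  refine ⟨f, hf, fun C hC D hD hCD => ?_⟩
  have h1 := (hσ _ (hCW C hC (hf C hC).1)).2.1
  have h2 := (hσ _ (hCW D hD (hf D hD).1)).2.1
  have h3 : f C = f D := by rw [← h1, ← h2]; exact congrArg σ hCD
  exact hdisj C hC D hD (f C) (hf C hC).1 (h3 ▸ (hf D hD).1)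

theorem PairsUp.card_odd_le {L : SimpleGraph V} {W A : Finset V} {σ : V → V}
    {𝒞 : Finset (Finset V)} (hσ : PairsUp L W σ) (hodd : ∀ C ∈ 𝒞, Odd C.card)
    (hCW : ∀ C ∈ 𝒞, C ⊆ W) (hdisj : ∀ C ∈ 𝒞, ∀ D ∈ 𝒞, ∀ x, x ∈ C → x ∈ D → C = D)
    (hclosed : ∀ C ∈ 𝒞, ∀ x ∈ C, ∀ y ∈ W, y ∉ A → L.Adj x y → y ∈ C) : 𝒞.card ≤ A.card := by
  rcases 𝒞.eq_empty_or_nonempty with rfl | ⟨C, hC⟩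
  · simp
  obtain ⟨x, -⟩ := Finset.card_pos.1 (hodd C hC).pos
  have : Nonempty V := ⟨x⟩
  obtain ⟨f, hf, hinj⟩ := hσ.exists_injOn_odd hodd hCW hdisj hclosed
  exact Finset.card_le_card_of_injOn _ (fun C hC => (hf C hC).2) hinj

end Matching

/-! ### Barriers of elementary graphs -/

section Barriers

variable {V : Type*}

/-- `H` is a connected graph with vertex set `V₀` that has a perfect matching, and each of its
edges lies in a perfect matching. -/
structure Elementary (H : SimpleGraph V) (V₀ : Finset V) : Prop where
  mem : ∀ x y, H.Adj x y → x ∈ V₀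
  conn : ∀ S ⊆ V₀, S.Nonempty → (∀ x ∈ S, ∀ y, H.Adj x y → y ∈ S) → V₀ ⊆ S
  ext : ∀ x y, H.Adj x y → ∃ σ, PairsUp H V₀ σ ∧ σ x = y
  matchable : Matchable H V₀

/-- `Z` is a barrier of `L` whose deletion leaves the odd parts `𝒞`. -/
structure Barrier (L : SimpleGraph V) (V₀ Z : Finset V) (𝒞 : Finset (Finset V)) : Prop
    extends OddSplit L V₀ Z 𝒞 where
  card_eq : 𝒞.card = Z.card

theorem OddSplit.part_subset {L : SimpleGraph V} {W A : Finset V} {𝒞 : Finset (Finset V)}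
    (h : OddSplit L W A 𝒞) {C : Finset V} (hC : C ∈ 𝒞) : C ⊆ W := fun x hx =>
  ((h.cover x).1 ⟨C, hC, hx⟩).1

theorem OddSplit.notMem_of_mem_part {L : SimpleGraph V} {W A : Finset V} {𝒞 : Finset (Finset V)}
    (h : OddSplit L W A 𝒞) {C : Finset V} (hC : C ∈ 𝒞) {x : V} (hx : x ∈ C) : x ∉ A :=
  ((h.cover x).1 ⟨C, hC, hx⟩).2

theorem OddSplit.card_le {L : SimpleGraph V} {W A : Finset V} {𝒞 : Finset (Finset V)}
    (h : OddSplit L W A 𝒞) (hL : Matchable L W) : 𝒞.card ≤ A.card := by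
  obtain ⟨σ, hσ⟩ := hL
  exact hσ.card_odd_le h.odd (fun _ => h.part_subset) h.disj h.closed

/-- With as many parts as barrier vertices, the injection from parts to barrier vertices is a
bijection, so every perfect matching sends the barrier into distinct parts. -/
theorem Barrier.exists_part_of_mem {L : SimpleGraph V} {V₀ Z : Finset V}
    {𝒞 : Finset (Finset V)} (hB : Barrier L V₀ Z 𝒞) {σ : V → V} (hσ : PairsUp L V₀ σ) :
    (∀ z ∈ Z, ∃ C ∈ 𝒞, σ z ∈ C) ∧
      ∀ C ∈ 𝒞, ∀ z ∈ Z, ∀ z' ∈ Z, σ z ∈ C → σ z' ∈ C → z = z' := by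
  classical
  rcases Z.eq_empty_or_nonempty with rfl | ⟨z₀, hz₀⟩
  · simp
  have : Nonempty V := ⟨z₀⟩
  obtain ⟨f, hf, hinj⟩ := hσ.exists_injOn_odd hB.odd (fun _ => hB.part_subset) hB.disj hB.closed
  have himg : 𝒞.image (fun C => σ (f C)) = Z := by
    refine Finset.eq_of_subset_of_card_le (fun z hz => ?_) ?_
    · obtain ⟨C, hC, rfl⟩ := Finset.mem_image.1 hz
      exact (hf C hC).2
    · rw [Finset.card_image_of_injOn hinj, hB.card_eq]
  have key : ∀ z ∈ Z, ∃ C ∈ 𝒞, σ z = f C ∧ σ (f C) = z := fun z hz => by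
    rw [← himg] at hz
    obtain ⟨C, hC, rfl⟩ := Finset.mem_image.1 hz
    exact ⟨C, hC, (hσ _ (hB.part_subset hC (hf C hC).1)).2.1, rfl⟩
  refine ⟨fun z hz => ?_, fun C hC z hz z' hz' h1 h2 => ?_⟩
  · obtain ⟨C, hC, h1, -⟩ := key z hz
    exact ⟨C, hC, h1 ▸ (hf C hC).1⟩
  · obtain ⟨D, hD, h3, h4⟩ := key z hz
    obtain ⟨D', hD', h3', h4'⟩ := key z' hz'
    have e1 := hB.disj C hC D hD _ h1 (h3 ▸ (hf D hD).1)
    have e2 := hB.disj C hC D' hD' _ h2 (h3' ▸ (hf D' hD').1)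
    rw [← h4, ← h4', ← e1, ← e2]

/-- Tutte's condition fails for the graph without `u` and `v`; adjoining both to the violating set
gives a barrier. A largest barrier containing them works: a part that is not matchable after the
removal of a vertex would yield a larger one. -/
theorem exists_factorCritical_barrier [DecidableEq V] {H : SimpleGraph V} {V₀ : Finset V}
    (hM : Matchable H V₀) {u v : V} (hu : u ∈ V₀) (hv : v ∈ V₀) (huv : u ≠ v)
    (h : ¬ Matchable H (V₀ \ {u, v})) :
    ∃ Z 𝒞, Barrier H V₀ Z 𝒞 ∧ u ∈ Z ∧ v ∈ Z ∧
      ∀ C ∈ 𝒞, ∀ c ∈ C, Matchable H (C.erase c) := by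
  classical
  have hV₀ : V₀.card % 2 = 0 := by
    obtain ⟨σ, hσ⟩ := hM
    exact Nat.even_iff.1 hσ.even
  let 𝒵 := V₀.powerset.filter fun Z => u ∈ Z ∧ v ∈ Z ∧ ∃ 𝒞, Barrier H V₀ Z 𝒞
  have hne : 𝒵.Nonempty := by
    obtain ⟨A, 𝒞, hs, hlt⟩ := exists_oddSplit_of_not_matchable h
    have huvs : ({u, v} : Finset V) ⊆ V₀ := by
      intro x hx
      rcases Finset.mem_insert.1 hx with rfl | hx
      · exact hu
      · rw [Finset.mem_singleton.1 hx]; exact hv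
    have hpar := hs.card_mod
    have hc1 := Finset.card_sdiff_add_card_eq_card huvs
    rw [Finset.card_pair huv] at hc1
    have hdisjA : Disjoint A {u, v} := by
      rw [Finset.disjoint_left]
      exact fun x hx hx' => (Finset.mem_sdiff.1 (hs.subset hx)).2 hx'
    have hZc : (A ∪ {u, v}).card = A.card + 2 := by
      rw [Finset.card_union_of_disjoint hdisjA, Finset.card_pair huv]
    have hZ : OddSplit H V₀ (A ∪ {u, v}) 𝒞 := by
      refine ⟨Finset.union_subset (hs.subset.trans Finset.sdiff_subset) huvs, hs.odd, hs.disj,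
        fun x => ?_, fun C hC x hx y hy hyA => ?_⟩
      · rw [hs.cover x, Finset.mem_sdiff, Finset.mem_union, not_or]
        tauto
      · rw [Finset.mem_union, not_or] at hyA
        exact hs.closed C hC x hx y (Finset.mem_sdiff.2 ⟨hy, hyA.2⟩) hyA.1
    refine ⟨A ∪ {u, v}, Finset.mem_filter.2 ⟨Finset.mem_powerset.2 hZ.subset, by simp, by simp,
      𝒞, hZ, ?_⟩⟩
    -- By parity there are at least `A.card + 2` parts, and since `V₀` is matchable there are at
    -- most as many as elements of the enlarged set.
    have := hZ.card_le hM
    omega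
  obtain ⟨Z, hZmem, hmax⟩ := Finset.exists_max_image 𝒵 Finset.card hne
  obtain ⟨-, huZ, hvZ, 𝒞, hB⟩ := Finset.mem_filter.1 hZmem
  refine ⟨Z, 𝒞, hB, huZ, hvZ, fun C hC c hc => ?_⟩
  by_contra hno
  obtain ⟨A, 𝒟, hs, hlt⟩ := exists_oddSplit_of_not_matchable hno
  have hpar := hs.card_mod
  have hCodd := Nat.odd_iff.1 (hB.odd C hC)
  have hCpos := (hB.odd C hC).pos
  rw [Finset.card_erase_of_mem hc] at hpar
  have hAC : ∀ x ∈ A, x ≠ c ∧ x ∈ C := fun x hx => Finset.mem_erase.1 (hs.subset hx)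
  have hDC : ∀ D ∈ 𝒟, ∀ x ∈ D, x ∈ C := fun D hD x hx => Finset.mem_of_mem_erase (hs.part_subset hD hx)
  have hcA : c ∉ A := fun h => (hAC c h).1 rfl
  have hZA : Disjoint Z (insert c A) := by
    rw [Finset.disjoint_right]
    intro x hx
    rcases Finset.mem_insert.1 hx with rfl | hx
    · exact hB.notMem_of_mem_part hC hc
    · exact hB.notMem_of_mem_part hC (hAC x hx).2
  have hcard : (Z ∪ insert c A).card = Z.card + (A.card + 1) := by
    rw [Finset.card_union_of_disjoint hZA, Finset.card_insert_of_notMem hcA]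
  have hd𝒟 : Disjoint (𝒞.erase C) 𝒟 := by
    rw [Finset.disjoint_left]
    intro D hD hD'
    obtain ⟨hne, hD⟩ := Finset.mem_erase.1 hD
    obtain ⟨x, hx⟩ := Finset.card_pos.1 (hs.odd D hD').pos
    exact hne (hB.disj D hD C hC x hx (hDC D hD' x hx))
  -- Refine `C` by `c`, `A` and `𝒟`. The barrier grows by `A.card + 1`. One part is lost and, by
  -- parity, at least `A.card + 2` are gained, so there are again enough parts for a barrier.
  have hsplit : OddSplit H V₀ (Z ∪ insert c A) (𝒞.erase C ∪ 𝒟) := by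
    refine ⟨?_, ?_, ?_, ?_, ?_⟩
    · refine Finset.union_subset hB.subset (fun x hx => ?_)
      rcases Finset.mem_insert.1 hx with rfl | hx
      · exact hB.part_subset hC hc
      · exact hB.part_subset hC (hAC x hx).2
    · intro D hD
      rcases Finset.mem_union.1 hD with hD | hD
      · exact hB.odd D (Finset.mem_of_mem_erase hD)
      · exact hs.odd D hD
    · have key : ∀ D ∈ 𝒞.erase C, ∀ E ∈ 𝒟, ∀ x, x ∈ D → x ∈ E → False := by
        intro D hD E hE x hx hx'
        obtain ⟨hne, hD⟩ := Finset.mem_erase.1 hD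
        exact hne (hB.disj D hD C hC x hx (hDC E hE x hx'))
      intro D hD E hE x hx hx'
      rcases Finset.mem_union.1 hD with hD | hD <;> rcases Finset.mem_union.1 hE with hE | hE
      · exact hB.disj D (Finset.mem_of_mem_erase hD) E (Finset.mem_of_mem_erase hE) x hx hx'
      · exact (key D hD E hE x hx hx').elim
      · exact (key E hE D hD x hx' hx).elim
      · exact hs.disj D hD E hE x hx hx'
    · intro x
      rw [Finset.mem_union, Finset.mem_insert, not_or, not_or]
      constructor
      · rintro ⟨D, hD, hx⟩
        rcases Finset.mem_union.1 hD with hD | hD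
        · obtain ⟨hne, hD⟩ := Finset.mem_erase.1 hD
          have hxC : x ∉ C := fun hxC => hne (hB.disj D hD C hC x hx hxC)
          exact ⟨hB.part_subset hD hx, hB.notMem_of_mem_part hD hx,
            fun h => hxC (h ▸ hc), fun h => hxC (hAC x h).2⟩
        · have h1 := (hs.cover x).1 ⟨D, hD, hx⟩
          obtain ⟨h2, h3⟩ := Finset.mem_erase.1 h1.1
          exact ⟨hB.part_subset hC h3, hB.notMem_of_mem_part hC h3, h2, h1.2⟩
      · rintro ⟨hxV, hxZ, hxc, hxA⟩
        obtain ⟨D, hD, hxD⟩ := (hB.cover x).2 ⟨hxV, hxZ⟩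
        by_cases hDeq : D = C
        · obtain ⟨E, hE, hxE⟩ := (hs.cover x).2 ⟨Finset.mem_erase.2 ⟨hxc, hDeq ▸ hxD⟩, hxA⟩
          exact ⟨E, Finset.mem_union_right _ hE, hxE⟩
        · exact ⟨D, Finset.mem_union_left _ (Finset.mem_erase.2 ⟨hDeq, hD⟩), hxD⟩
    · intro D hD x hx y hy hyA hxy
      rw [Finset.mem_union, Finset.mem_insert, not_or, not_or] at hyA
      rcases Finset.mem_union.1 hD with hD | hD
      · exact hB.closed D (Finset.mem_of_mem_erase hD) x hx y hy hyA.1 hxy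
      · have hyC := hB.closed C hC x (hDC D hD x hx) y hy hyA.1 hxy
        exact hs.closed D hD x hx y (Finset.mem_erase.2 ⟨hyA.2.1, hyC⟩) hyA.2.2 hxy
  have hle := hsplit.card_le hM
  have hcard2 : (𝒞.erase C ∪ 𝒟).card = (𝒞.card - 1) + 𝒟.card := by
    rw [Finset.card_union_of_disjoint hd𝒟, Finset.card_erase_of_mem hC]
  have h𝒞pos := Finset.card_pos.2 ⟨C, hC⟩
  have hceq := hB.card_eq
  have hmem : Z ∪ insert c A ∈ 𝒵 := by
    refine Finset.mem_filter.2 ⟨Finset.mem_powerset.2 hsplit.subset, Finset.mem_union_left _ huZ,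
      Finset.mem_union_left _ hvZ, _, hsplit, ?_⟩
    omega
  have := hmax _ hmem
  omega

open Classical in
/-- The parts in `𝒞` that are joined to `S` by an edge of `H`. -/
noncomputable def nbrParts (H : SimpleGraph V) (𝒞 : Finset (Finset V)) (S : Finset V) :
    Finset (Finset V) :=
  𝒞.filter fun C => ∃ s ∈ S, ∃ c ∈ C, H.Adj s c

theorem mem_nbrParts {H : SimpleGraph V} {𝒞 : Finset (Finset V)} {S C : Finset V} :
    C ∈ nbrParts H 𝒞 S ↔ C ∈ 𝒞 ∧ ∃ s ∈ S, ∃ c ∈ C, H.Adj s c := by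
  classical
  simp [nbrParts]

theorem nbrParts_subset {H : SimpleGraph V} {𝒞 : Finset (Finset V)} {S : Finset V} :
    nbrParts H 𝒞 S ⊆ 𝒞 := fun _ hC => (mem_nbrParts.1 hC).1

theorem nbrParts_mono {H : SimpleGraph V} {𝒞 : Finset (Finset V)} {S T : Finset V}
    (h : S ⊆ T) : nbrParts H 𝒞 S ⊆ nbrParts H 𝒞 T := fun _ hC => by
  obtain ⟨h1, s, hs, h2⟩ := mem_nbrParts.1 hC
  exact mem_nbrParts.2 ⟨h1, s, h hs, h2⟩

/-- The edge lies in a perfect matching, and perfect matchings send barrier vertices into parts.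
Barriers are therefore independent sets. -/
theorem Elementary.notMem_barrier_of_adj {H : SimpleGraph V} {V₀ Z : Finset V}
    {𝒞 : Finset (Finset V)} (hH : Elementary H V₀) (hB : Barrier H V₀ Z 𝒞) {x y : V}
    (hxy : H.Adj x y) (hx : x ∈ Z) : y ∉ Z := by
  obtain ⟨σ, hσ, rfl⟩ := hH.ext x y hxy
  obtain ⟨C, hC, hx⟩ := (hB.exists_part_of_mem hσ).1 x hx
  exact hB.notMem_of_mem_part hC hx

/-- A nonempty proper subset of a barrier has more neighbouring parts than elements. -/
theorem Elementary.card_lt_nbrParts {H : SimpleGraph V} {V₀ Z : Finset V}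
    {𝒞 : Finset (Finset V)} (hH : Elementary H V₀) (hB : Barrier H V₀ Z 𝒞) {S : Finset V}
    (hS : S ⊆ Z) (hne : S.Nonempty) (hSZ : S ≠ Z) :
    S.card + 1 ≤ (nbrParts H 𝒞 S).card := by
  classical
  by_contra! hlt
  -- Without a surplus, every perfect matching maps `S` bijectively onto its neighbouring parts.
  have key : ∀ σ, PairsUp H V₀ σ → ∀ C ∈ nbrParts H 𝒞 S, ∃ s ∈ S, σ s ∈ C := by
    intro σ hσ
    obtain ⟨h1, h2⟩ := hB.exists_part_of_mem hσ
    choose! f hf using h1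
    have hinj : Set.InjOn f (S : Set V) := fun s hs t ht hst =>
      h2 (f s) (hf s (hS hs)).1 s (hS hs) t (hS ht) (hf s (hS hs)).2 (hst ▸ (hf t (hS ht)).2)
    have himg : S.image f = nbrParts H 𝒞 S := by
      refine Finset.eq_of_subset_of_card_le (fun C hC => ?_) ?_
      · obtain ⟨s, hs, rfl⟩ := Finset.mem_image.1 hC
        exact mem_nbrParts.2 ⟨(hf s (hS hs)).1, s, hs, σ s, (hf s (hS hs)).2,
          (hσ s (hB.subset (hS hs))).2.2⟩
      · rw [Finset.card_image_of_injOn hinj]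
        omega
    intro C hC
    rw [← himg] at hC
    obtain ⟨s, hs, rfl⟩ := Finset.mem_image.1 hC
    exact ⟨s, hs, (hf s (hS hs)).2⟩
  -- `S` with its neighbouring parts is closed under adjacency: every edge lies in a perfect
  -- matching, and the one barrier vertex matched into such a part belongs to `S`. Connectedness
  -- then leaves no room for the rest of `Z`.
  have hV : V₀ ⊆ S ∪ (nbrParts H 𝒞 S).biUnion id := by
    refine hH.conn _ ?_ (hne.mono Finset.subset_union_left) ?_
    · refine Finset.union_subset (hS.trans hB.subset) (Finset.biUnion_subset.2 fun C hC => ?_)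
      exact hB.part_subset (nbrParts_subset hC)
    · intro x hx y hxy
      obtain ⟨σ, hσ, rfl⟩ := hH.ext x y hxy
      have hxV := hH.mem _ _ hxy
      rcases Finset.mem_union.1 hx with hx | hx
      · obtain ⟨C, hC, hyC⟩ := (hB.exists_part_of_mem hσ).1 x (hS hx)
        refine Finset.mem_union_right _ (Finset.mem_biUnion.2 ⟨C, ?_, hyC⟩)
        exact mem_nbrParts.2 ⟨hC, x, hx, _, hyC, hxy⟩
      · obtain ⟨C, hC, hxC⟩ := Finset.mem_biUnion.1 hx
        by_cases hyZ : σ x ∈ Z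
        · obtain ⟨s, hs, hsC⟩ := key σ hσ C hC
          have hxx := (hσ x hxV).2.1
          have := (hB.exists_part_of_mem hσ).2 C (nbrParts_subset hC) _ hyZ s (hS hs)
            (by rw [hxx]; exact hxC) hsC
          exact Finset.mem_union_left _ (this ▸ hs)
        · exact Finset.mem_union_right _ (Finset.mem_biUnion.2 ⟨C, hC,
            hB.closed C (nbrParts_subset hC) x hxC _ (hσ x hxV).1 hyZ hxy⟩)
  refine hSZ (Finset.Subset.antisymm hS fun z hz => ?_)
  rcases Finset.mem_union.1 (hV (hB.subset hz)) with h | h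
  · exact h
  · obtain ⟨C, hC, hzC⟩ := Finset.mem_biUnion.1 h
    exact (hB.notMem_of_mem_part (nbrParts_subset hC) hzC hz).elim

/-- Hall's condition between `S` and equally many disjoint sets, with the sets matchable after
the removal of a vertex with a neighbour in `S`, yields a perfect matching. -/
theorem matchable_of_hall [DecidableEq V] {H : SimpleGraph V} {S : Finset V}
    {𝒟 : Finset (Finset V)} (hdisj : ∀ C ∈ 𝒟, ∀ D ∈ 𝒟, ∀ x, x ∈ C → x ∈ D → C = D)
    (hS : ∀ C ∈ 𝒟, ∀ x ∈ C, x ∉ S)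
    (hfc : ∀ C ∈ 𝒟, ∀ c ∈ C, ∀ s ∈ S, H.Adj s c → Matchable H (C.erase c))
    (hall : ∀ T ⊆ S, T.card ≤ (nbrParts H 𝒟 T).card) (hcard : 𝒟.card = S.card) :
    Matchable H (S ∪ 𝒟.biUnion id) := by
  classical
  -- Hall's theorem assigns to each `s` its own part `f s`. Then `s` is matched to a neighbour `g s`
  -- there, and the rest of the part is matched internally.
  obtain ⟨f, hfinj, hf⟩ := (Finset.all_card_le_biUnion_card_iff_exists_injective
    (fun s : S => nbrParts H 𝒟 {(s : V)})).1 (fun T => by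
      have h1 := hall (T.map (Function.Embedding.subtype _)) (fun x hx => by
        obtain ⟨y, -, rfl⟩ := Finset.mem_map.1 hx
        exact y.2)
      rw [Finset.card_map] at h1
      refine h1.trans (Finset.card_le_card fun C hC => ?_)
      obtain ⟨hC, s, hs, h2⟩ := mem_nbrParts.1 hC
      obtain ⟨t, ht, rfl⟩ := Finset.mem_map.1 hs
      exact Finset.mem_biUnion.2 ⟨t, ht, mem_nbrParts.2 ⟨hC, _, Finset.mem_singleton_self _, h2⟩⟩)
  have hf' : ∀ s : S, f s ∈ 𝒟 ∧ ∃ c ∈ f s, H.Adj s c := fun s => by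
    obtain ⟨h1, s', hs', h2⟩ := mem_nbrParts.1 (hf s)
    rw [Finset.mem_singleton.1 hs'] at h2
    exact ⟨h1, h2⟩
  choose hf𝒟 g hg hadj using hf'
  have himg : Finset.univ.image f = 𝒟 := by
    refine Finset.eq_of_subset_of_card_le (fun C hC => ?_) ?_
    · obtain ⟨s, -, rfl⟩ := Finset.mem_image.1 hC
      exact hf𝒟 s
    · rw [Finset.card_image_of_injective _ hfinj, Finset.card_univ, Fintype.card_coe, hcard]
  have hEq : S ∪ 𝒟.biUnion id = Finset.univ.biUnion fun s : S => {(s : V), g s} ∪ (f s).erase (g s) := by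
    ext x
    simp only [Finset.mem_union, Finset.mem_biUnion, id, Finset.mem_univ, true_and,
      Finset.mem_insert, Finset.mem_singleton, Finset.mem_erase]
    constructor
    · rintro (hx | ⟨C, hC, hx⟩)
      · exact ⟨⟨x, hx⟩, Or.inl (Or.inl rfl)⟩
      · rw [← himg] at hC
        obtain ⟨s, -, rfl⟩ := Finset.mem_image.1 hC
        refine ⟨s, ?_⟩
        tauto
    · rintro ⟨s, (rfl | rfl) | ⟨-, hx⟩⟩
      · exact Or.inl s.2
      · exact Or.inr ⟨f s, hf𝒟 s, hg s⟩
      · exact Or.inr ⟨f s, hf𝒟 s, hx⟩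
  rw [hEq]
  refine Matchable.biUnion (fun s _ => ?_) (fun s _ t _ x hx hx' => ?_)
  · refine (Matchable.pair (hadj s)).union (hfc _ (hf𝒟 s) _ (hg s) s s.2 (hadj s)) ?_
    rw [Finset.disjoint_left]
    intro x hx hx'
    obtain ⟨h1, h2⟩ := Finset.mem_erase.1 hx'
    rcases Finset.mem_insert.1 hx with rfl | hx
    · exact hS _ (hf𝒟 s) _ h2 s.2
    · exact h1 (Finset.mem_singleton.1 hx)
  · have hmem : ∀ r : S, x ∈ ({(r : V), g r} ∪ (f r).erase (g r) : Finset V) →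
        x = r ∨ x ∈ f r := fun r hr => by
      rcases Finset.mem_union.1 hr with hr | hr
      · rcases Finset.mem_insert.1 hr with hr | hr
        · exact Or.inl hr
        · exact Or.inr (Finset.mem_singleton.1 hr ▸ hg r)
      · exact Or.inr (Finset.mem_of_mem_erase hr)
    rcases hmem s hx with h1 | h1 <;> rcases hmem t hx' with h2 | h2
    · exact Subtype.ext (h1.symm.trans h2)
    · exact (hS _ (hf𝒟 t) x h2 (h1 ▸ s.2)).elim
    · exact (hS _ (hf𝒟 s) x h1 (h2 ▸ t.2)).elim
    · exact hfinj (hdisj _ (hf𝒟 s) _ (hf𝒟 t) x h1 h2)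

theorem nbrParts_erase_card [DecidableEq V] {H : SimpleGraph V} {𝒞 : Finset (Finset V)}
    {S D : Finset V} : (nbrParts H 𝒞 S).card ≤ (nbrParts H (𝒞.erase D) S).card + 1 := by
  classical
  have : nbrParts H 𝒞 S ⊆ insert D (nbrParts H (𝒞.erase D) S) := fun C hC => by
    by_cases hCD : C = D
    · exact hCD ▸ Finset.mem_insert_self _ _
    · obtain ⟨h1, h2⟩ := mem_nbrParts.1 hC
      exact Finset.mem_insert_of_mem (mem_nbrParts.2 ⟨Finset.mem_erase.2 ⟨hCD, h1⟩, h2⟩)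
  exact (Finset.card_le_card this).trans (Finset.card_insert_le _ _)

/-- A vertex of a barrier with factor-critical parts and a vertex of a part can be removed
without destroying the existence of a perfect matching. -/
theorem Elementary.matchable_sdiff_mixed [DecidableEq V] {H : SimpleGraph V} {V₀ Z : Finset V}
    {𝒞 : Finset (Finset V)} (hH : Elementary H V₀) (hB : Barrier H V₀ Z 𝒞)
    (hfc : ∀ C ∈ 𝒞, ∀ c ∈ C, Matchable H (C.erase c)) {z c : V} (hz : z ∈ Z) (hc : c ∈ V₀)
    (hcZ : c ∉ Z) : Matchable H (V₀ \ {z, c}) := by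
  classical
  obtain ⟨C, hC, hcC⟩ := (hB.cover c).2 ⟨hc, hcZ⟩
  have hZS : Matchable H (Z.erase z ∪ (𝒞.erase C).biUnion id) := by
    refine matchable_of_hall
      (fun D hD E hE => hB.disj D (Finset.mem_of_mem_erase hD) E (Finset.mem_of_mem_erase hE))
      (fun D hD x hx hxZ => hB.notMem_of_mem_part (Finset.mem_of_mem_erase hD) hx
        (Finset.mem_of_mem_erase hxZ))
      (fun D hD c hc _ _ _ => hfc D (Finset.mem_of_mem_erase hD) c hc) (fun T hT => ?_) ?_
    · rcases T.eq_empty_or_nonempty with rfl | hne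
      · simp
      · have h1 := hH.card_lt_nbrParts hB (hT.trans (Finset.erase_subset _ _)) hne
          (fun h => Finset.notMem_erase z Z (hT (h ▸ hz)))
        -- Deleting `C` costs one neighbouring part, which the surplus of a proper subset of `Z`
        -- pays for.
        have h2 := nbrParts_erase_card (H := H) (𝒞 := 𝒞) (S := T) (D := C)
        omega
    · rw [Finset.card_erase_of_mem hz, Finset.card_erase_of_mem hC, hB.card_eq]
  have hd : Disjoint (Z.erase z ∪ (𝒞.erase C).biUnion id) (C.erase c) := by
    rw [Finset.disjoint_left]
    intro x hx hx'
    have hxC := Finset.mem_of_mem_erase hx'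
    rcases Finset.mem_union.1 hx with hx | hx
    · exact hB.notMem_of_mem_part hC hxC (Finset.mem_of_mem_erase hx)
    · obtain ⟨D, hD, hxD⟩ := Finset.mem_biUnion.1 hx
      obtain ⟨hne, hD⟩ := Finset.mem_erase.1 hD
      exact hne (hB.disj D hD C hC x hxD hxC)
  convert hZS.union (hfc C hC c hcC) hd using 1
  ext x
  simp only [Finset.mem_sdiff, Finset.mem_insert, Finset.mem_singleton, not_or, Finset.mem_union,
    Finset.mem_erase, Finset.mem_biUnion, id]
  constructor
  · rintro ⟨hxV, hxz, hxc⟩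
    by_cases hxZ : x ∈ Z
    · exact Or.inl (Or.inl ⟨hxz, hxZ⟩)
    · obtain ⟨D, hD, hxD⟩ := (hB.cover x).2 ⟨hxV, hxZ⟩
      by_cases hDC : D = C
      · exact Or.inr ⟨hxc, hDC ▸ hxD⟩
      · exact Or.inl (Or.inr ⟨D, ⟨hDC, hD⟩, hxD⟩)
  · rintro ((⟨hxz, hxZ⟩ | ⟨D, ⟨hDC, hD⟩, hxD⟩) | ⟨hxc, hxC⟩)
    · exact ⟨hB.subset hxZ, hxz, fun h => hcZ (h ▸ hxZ)⟩
    · refine ⟨hB.part_subset hD hxD, fun h => hB.notMem_of_mem_part hD hxD (h ▸ hz), fun h => ?_⟩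
      exact hDC (hB.disj D hD C hC x hxD (h ▸ hcC))
    · exact ⟨hB.part_subset hC hxC, fun h => hB.notMem_of_mem_part hC hxC (h ▸ hz), hxc⟩

/-- The relation "the removal of both vertices destroys all perfect matchings" is transitive. -/
theorem Elementary.matchable_sdiff_or [DecidableEq V] {H : SimpleGraph V} {V₀ : Finset V}
    (hH : Elementary H V₀) {u x y : V} (hxy : H.Adj x y) (hu : u ∈ V₀) (hux : u ≠ x) :
    Matchable H (V₀ \ {u, x}) ∨ Matchable H (V₀ \ {u, y}) := by
  by_contra! hno
  have hx := hH.mem _ _ hxy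
  -- A barrier containing `u` and `x` excludes the neighbour `y` of `x`, so `u` and `y` are on
  -- different sides and can be removed.
  obtain ⟨Z, 𝒞, hB, huZ, hxZ, hfc⟩ := exists_factorCritical_barrier hH.matchable hu hx hux hno.1
  exact hno.2 (hH.matchable_sdiff_mixed hB hfc huZ (hH.mem _ _ hxy.symm)
    (hH.notMem_barrier_of_adj hB hxy hxZ))

end Barriers

/-! ### Tight sets of a barrier -/

section TwoEars

variable {V ι : Type*}

/-- The set of all ends of the pairs `{a i, b i}` with `i ∈ I`. -/
def ends [DecidableEq V] (a b : ι → V) (I : Finset ι) : Finset V := I.biUnion fun i => {a i, b i}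

theorem mem_ends [DecidableEq V] {a b : ι → V} {I : Finset ι} {x : V} :
    x ∈ ends a b I ↔ ∃ i ∈ I, x = a i ∨ x = b i := by
  simp [ends]

theorem nbrParts_union [DecidableEq V] {H : SimpleGraph V} {𝒞 : Finset (Finset V)}
    {S T : Finset V} : nbrParts H 𝒞 (S ∪ T) = nbrParts H 𝒞 S ∪ nbrParts H 𝒞 T := by
  ext C
  simp only [mem_nbrParts, Finset.mem_union]
  constructor
  · rintro ⟨h1, s, hs | hs, h2⟩
    · exact Or.inl ⟨h1, s, hs, h2⟩
    · exact Or.inr ⟨h1, s, hs, h2⟩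
  · rintro (⟨h1, s, hs, h2⟩ | ⟨h1, s, hs, h2⟩)
    · exact ⟨h1, s, Or.inl hs, h2⟩
    · exact ⟨h1, s, Or.inr hs, h2⟩

/-- Removing a set with exactly one neighbouring part more than elements from a barrier leaves
a barrier. -/
theorem Barrier.sdiff_tight [DecidableEq V] {H : SimpleGraph V} {V₀ X : Finset V}
    {𝒞 : Finset (Finset V)} (hB : Barrier H V₀ X 𝒞) {S : Finset V}
    (hS : S ⊆ X) (hcard : (nbrParts H 𝒞 S).card = S.card + 1) :
    Barrier H V₀ (X \ S)
      (insert (S ∪ (nbrParts H 𝒞 S).biUnion id) (𝒞 \ nbrParts H 𝒞 S)) := by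
  classical
  set N := nbrParts H 𝒞 S with hN
  have hN𝒞 : N ⊆ 𝒞 := nbrParts_subset
  have hmemK : ∀ x, x ∈ S ∪ N.biUnion id ↔ x ∈ S ∨ ∃ C ∈ N, x ∈ C := fun x => by simp
  have hKdisj : ∀ D ∈ 𝒞 \ N, ∀ x ∈ D, x ∉ S ∪ N.biUnion id := by
    intro D hD x hx hx'
    obtain ⟨hD, hDN⟩ := Finset.mem_sdiff.1 hD
    rcases (hmemK x).1 hx' with h | ⟨C, hC, hxC⟩
    · exact hB.notMem_of_mem_part hD hx (hS h)
    · exact hDN (hB.disj C (hN𝒞 hC) D hD x hxC hx ▸ hC)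
  -- The size is congruent to `S.card` plus the number `S.card + 1` of odd parts merged, hence odd.
  have hKcard : Odd (S ∪ N.biUnion id).card := by
    rw [Finset.card_union_of_disjoint, Finset.card_biUnion]
    · have := sum_odd_parity N fun C hC => hB.odd C (hN𝒞 hC)
      rw [Nat.odd_iff]
      simp only [id]
      omega
    · intro C hC D hD hne
      rw [Function.onFun, Finset.disjoint_left]
      exact fun x hx hx' => hne (hB.disj C (hN𝒞 hC) D (hN𝒞 hD) x hx hx')
    · rw [Finset.disjoint_left]
      intro x hx hx'
      obtain ⟨C, hC, hxC⟩ := Finset.mem_biUnion.1 hx'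
      exact hB.notMem_of_mem_part (hN𝒞 hC) hxC (hS hx)
  have hKnot : S ∪ N.biUnion id ∉ 𝒞 \ N := by
    intro h
    obtain ⟨x, hx⟩ := Finset.card_pos.1 hKcard.pos
    exact hKdisj _ h x hx hx
  refine ⟨⟨Finset.sdiff_subset.trans hB.subset, ?_, ?_, ?_, ?_⟩, ?_⟩
  · intro C hC
    rcases Finset.mem_insert.1 hC with rfl | hC
    · exact hKcard
    · exact hB.odd C (Finset.mem_sdiff.1 hC).1
  · intro C hC D hD x hx hx'
    rcases Finset.mem_insert.1 hC with rfl | hC <;> rcases Finset.mem_insert.1 hD with rfl | hD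
    · rfl
    · exact (hKdisj D hD x hx' hx).elim
    · exact (hKdisj C hC x hx hx').elim
    · exact hB.disj C (Finset.mem_sdiff.1 hC).1 D (Finset.mem_sdiff.1 hD).1 x hx hx'
  · intro x
    constructor
    · rintro ⟨C, hC, hx⟩
      rcases Finset.mem_insert.1 hC with rfl | hC
      · rcases (hmemK x).1 hx with h | ⟨C, hC, hxC⟩
        · exact ⟨hB.subset (hS h), fun h' => (Finset.mem_sdiff.1 h').2 h⟩
        · exact ⟨hB.part_subset (hN𝒞 hC) hxC,
            fun h' => hB.notMem_of_mem_part (hN𝒞 hC) hxC (Finset.mem_sdiff.1 h').1⟩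
      · have hC := (Finset.mem_sdiff.1 hC).1
        exact ⟨hB.part_subset hC hx,
            fun h' => hB.notMem_of_mem_part hC hx (Finset.mem_sdiff.1 h').1⟩
    · rintro ⟨hxV, hx⟩
      by_cases hxX : x ∈ X
      · have hxS : x ∈ S := by_contra fun h => hx (Finset.mem_sdiff.2 ⟨hxX, h⟩)
        exact ⟨_, Finset.mem_insert_self _ _, Finset.mem_union_left _ hxS⟩
      · obtain ⟨C, hC, hxC⟩ := (hB.cover x).2 ⟨hxV, hxX⟩
        by_cases hCN : C ∈ N
        · exact ⟨_, Finset.mem_insert_self _ _, (hmemK x).2 (Or.inr ⟨C, hCN, hxC⟩)⟩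
        · exact ⟨C, Finset.mem_insert_of_mem (Finset.mem_sdiff.2 ⟨hC, hCN⟩), hxC⟩
  · intro C hC x hx y hy hyX hxy
    have hyX' : y ∈ X → y ∈ S := fun h => by_contra fun h' => hyX (Finset.mem_sdiff.2 ⟨h, h'⟩)
    rcases Finset.mem_insert.1 hC with rfl | hC
    · rw [hmemK]
      by_cases hyS : y ∈ X
      · exact Or.inl (hyX' hyS)
      · rcases (hmemK x).1 hx with h | ⟨C, hC, hxC⟩
        · obtain ⟨C, hC, hyC⟩ := (hB.cover y).2 ⟨hy, hyS⟩
          exact Or.inr ⟨C, mem_nbrParts.2 ⟨hC, x, h, y, hyC, hxy⟩, hyC⟩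
        · exact Or.inr ⟨C, hC, hB.closed C (hN𝒞 hC) x hxC y hy hyS hxy⟩
    · obtain ⟨hC, hCN⟩ := Finset.mem_sdiff.1 hC
      by_cases hyS : y ∈ X
      · exact (hCN (mem_nbrParts.2 ⟨hC, y, hyX' hyS, x, hx, hxy.symm⟩)).elim
      · exact hB.closed C hC x hx y hy hyS hxy
  · rw [Finset.card_insert_of_notMem hKnot, Finset.card_sdiff_of_subset hN𝒞,
      Finset.card_sdiff_of_subset hS, hcard, hB.card_eq]
    have h1 := Finset.card_le_card hN𝒞
    have h2 := hB.card_eq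
    omega

/-- If the pairs in `F` do not join different parts in `𝒟`, then `H` minus the ends of the pairs
has at least as many barrier vertices as parts in `𝒟`. -/
theorem Barrier.card_le_of_matchable_sdiff [DecidableEq V] {H : SimpleGraph V} {V₀ X : Finset V}
    {𝒞 𝒟 : Finset (Finset V)} (hB : Barrier H V₀ X 𝒞) (h𝒟 : 𝒟 ⊆ 𝒞) {T : Finset V}
    (hT : ∀ C ∈ 𝒟, ∀ x ∈ C, ∀ t ∈ T, ¬ H.Adj t x) {a b : ι → V} {F : Finset ι}
    (hab : ∀ i ∈ F, a i ≠ b i)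
    (hd : ∀ i ∈ F, ∀ j ∈ F, ∀ x, (x = a i ∨ x = b i) → (x = a j ∨ x = b j) → i = j)
    (hF : ∀ i ∈ F, ∀ C ∈ 𝒟, a i ∈ C ↔ b i ∈ C) (hM : Matchable H (V₀ \ ends a b F)) :
    𝒟.card ≤ ((X \ T) \ ends a b F).card := by
  classical
  obtain ⟨σ, hσ⟩ := hM
  -- A part contains both ends of a pair or neither, so the deletion preserves its parity.
  have hodd : ∀ C ∈ 𝒟, Odd (C \ ends a b F).card := by
    intro C hC
    have h1 : C ∩ ends a b F = (F.filter fun i => a i ∈ C).biUnion fun i => {a i, b i} := by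
      ext x
      simp only [Finset.mem_inter, mem_ends, Finset.mem_biUnion, Finset.mem_filter,
        Finset.mem_insert, Finset.mem_singleton]
      constructor
      · rintro ⟨hx, i, hi, rfl | rfl⟩
        · exact ⟨i, ⟨hi, hx⟩, Or.inl rfl⟩
        · exact ⟨i, ⟨hi, (hF i hi C hC).2 hx⟩, Or.inr rfl⟩
      · rintro ⟨i, ⟨hi, hx⟩, rfl | rfl⟩
        · exact ⟨hx, i, hi, Or.inl rfl⟩
        · exact ⟨(hF i hi C hC).1 hx, i, hi, Or.inr rfl⟩
    have h2 : (C ∩ ends a b F).card = ∑ i ∈ F.filter (fun i => a i ∈ C), 2 := by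
      rw [h1, Finset.card_biUnion]
      · refine Finset.sum_congr rfl fun i hi => Finset.card_pair (hab i (Finset.mem_filter.1 hi).1)
      · intro i hi j hj hne
        rw [Function.onFun, Finset.disjoint_left]
        intro x hx hx'
        exact hne (hd i (Finset.mem_filter.1 hi).1 j (Finset.mem_filter.1 hj).1 x
          (by simpa using hx) (by simpa using hx'))
    have h3 := Finset.card_sdiff_add_card_inter C (ends a b F)
    have h4 := Nat.odd_iff.1 (hB.odd C (h𝒟 hC))
    rw [h2, Finset.sum_const, smul_eq_mul] at h3
    rw [Nat.odd_iff]
    omega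
  have hinj : Set.InjOn (fun C : Finset V => C \ ends a b F) (𝒟 : Set (Finset V)) := by
    intro C hC D hD hCD
    obtain ⟨x, hx⟩ := Finset.card_pos.1 (hodd C hC).pos
    have hx' : x ∈ D \ ends a b F := (show C \ ends a b F = D \ ends a b F from hCD) ▸ hx
    exact hB.disj C (h𝒟 hC) D (h𝒟 hD) x (Finset.mem_sdiff.1 hx).1 (Finset.mem_sdiff.1 hx').1
  rw [← Finset.card_image_of_injOn hinj]
  refine hσ.card_odd_le ?_ ?_ ?_ ?_
  · intro C hC
    obtain ⟨D, hD, rfl⟩ := Finset.mem_image.1 hC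
    exact hodd D hD
  · intro C hC
    obtain ⟨D, hD, rfl⟩ := Finset.mem_image.1 hC
    exact Finset.sdiff_subset_sdiff (hB.part_subset (h𝒟 hD)) le_rfl
  · intro C hC D hD x hx hx'
    obtain ⟨C', hC', rfl⟩ := Finset.mem_image.1 hC
    obtain ⟨D', hD', rfl⟩ := Finset.mem_image.1 hD
    rw [hB.disj C' (h𝒟 hC') D' (h𝒟 hD') x (Finset.mem_sdiff.1 hx).1 (Finset.mem_sdiff.1 hx').1]
  · intro C hC x hx y hy hyA hxy
    obtain ⟨D, hD, rfl⟩ := Finset.mem_image.1 hC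
    obtain ⟨hyV, hyE⟩ := Finset.mem_sdiff.1 hy
    refine Finset.mem_sdiff.2 ⟨?_, hyE⟩
    have hxD := (Finset.mem_sdiff.1 hx).1
    refine hB.closed D (h𝒟 hD) x hxD y hyV (fun hyX => ?_) hxy
    by_cases hyT : y ∈ T
    · exact hT D hD x hxD y hyT hxy.symm
    · exact hyA (Finset.mem_sdiff.2 ⟨Finset.mem_sdiff.2 ⟨hyX, hyT⟩, hyE⟩)

/-- Either a pair in the barrier and a pair joining two parts can be removed together, or some
tight set of the barrier prevents this. -/
theorem Elementary.exists_tight [DecidableEq V] {H : SimpleGraph V} {V₀ X Z : Finset V}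
    {𝒞 : Finset (Finset V)} (hH : Elementary H V₀) (hB : Barrier H V₀ X 𝒞)
    (hfc : ∀ C ∈ 𝒞, ∀ c ∈ C, c ∉ Z → Matchable H (C.erase c))
    (hZ : ∀ x ∈ X, ∀ y, H.Adj x y → y ∉ Z) {u v c d : V} (hu : u ∈ X) (hv : v ∈ X)
    (huv : u ≠ v) {C D : Finset V} (hC : C ∈ 𝒞) (hD : D ∈ 𝒞) (hCD : C ≠ D) (hc : c ∈ C)
    (hd : d ∈ D) (hcZ : c ∉ Z) (hdZ : d ∉ Z) (hM : ¬ Matchable H (V₀ \ {u, v, c, d})) :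
    ∃ S ⊆ X, S.Nonempty ∧ u ∉ S ∧ v ∉ S ∧ (nbrParts H 𝒞 S).card = S.card + 1 ∧
      C ∈ nbrParts H 𝒞 S ∧ D ∈ nbrParts H 𝒞 S := by
  classical
  by_contra! hno
  apply hM
  set 𝒟 := (𝒞.erase C).erase D with h𝒟
  have h𝒟mem : ∀ E, E ∈ 𝒟 ↔ E ≠ D ∧ E ≠ C ∧ E ∈ 𝒞 := fun E => by simp [h𝒟]
  -- The vertices `c`, `d` are taken out of their parts, whose remainders are matchable. What
  -- remains is a Hall problem between `X` without `u`, `v` and the parts other than `C`, `D`.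
  have h1 : Matchable H ((X \ {u, v}) ∪ 𝒟.biUnion id) := by
    refine matchable_of_hall
      (fun E hE E' hE' => hB.disj E ((h𝒟mem E).1 hE).2.2 E' ((h𝒟mem E').1 hE').2.2)
      (fun E hE x hx hxX => hB.notMem_of_mem_part ((h𝒟mem E).1 hE).2.2 hx
        (Finset.mem_sdiff.1 hxX).1)
      (fun E hE x hx s hs hsx => hfc E ((h𝒟mem E).1 hE).2.2 x hx
        (hZ s (Finset.mem_sdiff.1 hs).1 x hsx)) (fun T hT => ?_) ?_
    · rcases T.eq_empty_or_nonempty with rfl | hne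
      · simp
      -- A violator `T` has surplus at least one among all parts, and dropping `C` and `D` costs at
      -- most two. So the surplus is exactly one and both `C` and `D` are neighbours: `T` is the
      -- tight set sought.
      by_contra! hlt
      have hTX : T ⊆ X := hT.trans Finset.sdiff_subset
      have huT : u ∉ T := fun h => (Finset.mem_sdiff.1 (hT h)).2 (by simp)
      have hvT : v ∉ T := fun h => (Finset.mem_sdiff.1 (hT h)).2 (by simp)
      have h2 := hH.card_lt_nbrParts hB hTX hne (fun h => huT (h ▸ hu))
      have hsub : ∀ E ∈ nbrParts H 𝒞 T, E ≠ C → E ≠ D → E ∈ nbrParts H 𝒟 T := by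
        intro E hE hEC hED
        obtain ⟨h3, h4⟩ := mem_nbrParts.1 hE
        exact mem_nbrParts.2 ⟨(h𝒟mem E).2 ⟨hED, hEC, h3⟩, h4⟩
      have hCN : C ∈ nbrParts H 𝒞 T := by
        by_contra hCN
        have : nbrParts H 𝒞 T ⊆ insert D (nbrParts H 𝒟 T) := fun E hE => by
          by_cases hED : E = D
          · exact hED ▸ Finset.mem_insert_self _ _
          · exact Finset.mem_insert_of_mem (hsub E hE (fun h => hCN (h ▸ hE)) hED)
        have := (Finset.card_le_card this).trans (Finset.card_insert_le _ _)
        omega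
      have hDN : D ∈ nbrParts H 𝒞 T := by
        by_contra hDN
        have : nbrParts H 𝒞 T ⊆ insert C (nbrParts H 𝒟 T) := fun E hE => by
          by_cases hEC : E = C
          · exact hEC ▸ Finset.mem_insert_self _ _
          · exact Finset.mem_insert_of_mem (hsub E hE hEC (fun h => hDN (h ▸ hE)))
        have := (Finset.card_le_card this).trans (Finset.card_insert_le _ _)
        omega
      have hle : (nbrParts H 𝒞 T).card ≤ (nbrParts H 𝒟 T).card + 2 := by
        have : nbrParts H 𝒞 T ⊆ insert C (insert D (nbrParts H 𝒟 T)) := fun E hE => by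
          by_cases hEC : E = C
          · exact hEC ▸ Finset.mem_insert_self _ _
          by_cases hED : E = D
          · exact Finset.mem_insert_of_mem (hED ▸ Finset.mem_insert_self _ _)
          · exact Finset.mem_insert_of_mem (Finset.mem_insert_of_mem (hsub E hE hEC hED))
        have h5 := Finset.card_insert_le C (insert D (nbrParts H 𝒟 T))
        have h6 := Finset.card_insert_le D (nbrParts H 𝒟 T)
        have := Finset.card_le_card this
        omega
      exact hno T hTX hne huT hvT (by omega) hCN hDN
    · have huvX : ({u, v} : Finset V) ⊆ X := by
        intro x hx
        rcases Finset.mem_insert.1 hx with rfl | hx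
        · exact hu
        · exact Finset.mem_singleton.1 hx ▸ hv
      rw [Finset.card_sdiff_of_subset huvX, Finset.card_pair huv, h𝒟, Finset.card_erase_of_mem
        (Finset.mem_erase.2 ⟨hCD.symm, hD⟩), Finset.card_erase_of_mem hC, hB.card_eq]
      omega
  have h2 : Matchable H (C.erase c ∪ D.erase d) := by
    refine (hfc C hC c hc hcZ).union (hfc D hD d hd hdZ) ?_
    rw [Finset.disjoint_left]
    exact fun x hx hx' => hCD (hB.disj C hC D hD x (Finset.mem_of_mem_erase hx)
      (Finset.mem_of_mem_erase hx'))
  have hdj : Disjoint ((X \ {u, v}) ∪ 𝒟.biUnion id) (C.erase c ∪ D.erase d) := by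
    rw [Finset.disjoint_left]
    intro x hx hx'
    have hx' : x ∈ C ∨ x ∈ D := by
      rcases Finset.mem_union.1 hx' with h | h
      · exact Or.inl (Finset.mem_of_mem_erase h)
      · exact Or.inr (Finset.mem_of_mem_erase h)
    rcases Finset.mem_union.1 hx with hx | hx
    · have hxX := (Finset.mem_sdiff.1 hx).1
      rcases hx' with h | h
      · exact hB.notMem_of_mem_part hC h hxX
      · exact hB.notMem_of_mem_part hD h hxX
    · obtain ⟨E, hE, hxE⟩ := Finset.mem_biUnion.1 hx
      obtain ⟨h3, h4, h5⟩ := (h𝒟mem E).1 hE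
      rcases hx' with h | h
      · exact h4 (hB.disj E h5 C hC x hxE h)
      · exact h3 (hB.disj E h5 D hD x hxE h)
  have hcX := hB.notMem_of_mem_part hC hc
  have hdX := hB.notMem_of_mem_part hD hd
  convert h1.union h2 hdj using 1
  ext x
  simp only [Finset.mem_sdiff, Finset.mem_insert, Finset.mem_singleton, not_or, Finset.mem_union,
    Finset.mem_erase, Finset.mem_biUnion, id, h𝒟mem]
  constructor
  · rintro ⟨hxV, hxu, hxv, hxc, hxd⟩
    by_cases hxX : x ∈ X
    · exact Or.inl (Or.inl ⟨hxX, hxu, hxv⟩)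
    · obtain ⟨E, hE, hxE⟩ := (hB.cover x).2 ⟨hxV, hxX⟩
      by_cases hEC : E = C
      · exact Or.inr (Or.inl ⟨hxc, hEC ▸ hxE⟩)
      by_cases hED : E = D
      · exact Or.inr (Or.inr ⟨hxd, hED ▸ hxE⟩)
      · exact Or.inl (Or.inr ⟨E, ⟨hED, hEC, hE⟩, hxE⟩)
  · rintro ((⟨hxX, hxu, hxv⟩ | ⟨E, ⟨hED, hEC, hE⟩, hxE⟩) | (⟨hxc, hxC⟩ | ⟨hxd, hxD⟩))
    · exact ⟨hB.subset hxX, hxu, hxv, fun h => hcX (h ▸ hxX), fun h => hdX (h ▸ hxX)⟩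
    · have hxX := hB.notMem_of_mem_part hE hxE
      exact ⟨hB.part_subset hE hxE, fun h => hxX (h ▸ hu), fun h => hxX (h ▸ hv),
        fun h => hEC (hB.disj E hE C hC x hxE (h ▸ hc)),
        fun h => hED (hB.disj E hE D hD x hxE (h ▸ hd))⟩
    · have hxX := hB.notMem_of_mem_part hC hxC
      exact ⟨hB.part_subset hC hxC, fun h => hxX (h ▸ hu), fun h => hxX (h ▸ hv), hxc,
        fun h => hCD (hB.disj C hC D hD x hxC (h ▸ hd))⟩
    · have hxX := hB.notMem_of_mem_part hD hxD
      exact ⟨hB.part_subset hD hxD, fun h => hxX (h ▸ hu), fun h => hxX (h ▸ hv),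
        fun h => hCD (hB.disj C hC D hD x (h ▸ hc) hxD), hxd⟩

/-- The enlarged part of a shrunk barrier stays matchable after the removal of any vertex outside
the removed set. -/
theorem Elementary.matchable_tight_erase [DecidableEq V] {H : SimpleGraph V} {V₀ X Z : Finset V}
    {𝒞 : Finset (Finset V)} (hH : Elementary H V₀) (hB : Barrier H V₀ X 𝒞)
    (hfc : ∀ C ∈ 𝒞, ∀ c ∈ C, c ∉ Z → Matchable H (C.erase c))
    (hZ : ∀ x ∈ X, ∀ y, H.Adj x y → y ∉ Z) {S : Finset V} (hS : S ⊆ X) (hSX : S ≠ X)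
    (hcard : (nbrParts H 𝒞 S).card = S.card + 1) {w : V}
    (hw : w ∈ (nbrParts H 𝒞 S).biUnion id) (hwZ : w ∉ Z) :
    Matchable H ((S ∪ (nbrParts H 𝒞 S).biUnion id).erase w) := by
  classical
  set N := nbrParts H 𝒞 S with hN
  have hN𝒞 : N ⊆ 𝒞 := nbrParts_subset
  obtain ⟨C, hC, hwC⟩ := Finset.mem_biUnion.1 hw
  simp only [id] at hwC
  have h1 : Matchable H (S ∪ (N.erase C).biUnion id) := by
    refine matchable_of_hall
      (fun E hE E' hE' => hB.disj E (hN𝒞 (Finset.mem_of_mem_erase hE)) E'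
        (hN𝒞 (Finset.mem_of_mem_erase hE')))
      (fun E hE x hx hxS => hB.notMem_of_mem_part (hN𝒞 (Finset.mem_of_mem_erase hE)) hx (hS hxS))
      (fun E hE x hx s hs hsx => hfc E (hN𝒞 (Finset.mem_of_mem_erase hE)) x hx (hZ s (hS hs) x hsx))
      (fun T hT => ?_) ?_
    · rcases T.eq_empty_or_nonempty with rfl | hne
      · simp
      have h2 := hH.card_lt_nbrParts hB (hT.trans hS) hne
        (fun h => hSX (Finset.Subset.antisymm hS (h ▸ hT)))
      -- The parts neighbouring a subset of `S` all lie in `N`, so the surplus survives the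
      -- restriction to `N` and pays for the loss of `C`.
      have h3 : nbrParts H 𝒞 T ⊆ nbrParts H N T := fun E hE =>
        mem_nbrParts.2 ⟨nbrParts_mono hT hE, (mem_nbrParts.1 hE).2⟩
      have h4 := Finset.card_le_card h3
      have h5 := nbrParts_erase_card (H := H) (𝒞 := N) (S := T) (D := C)
      omega
    · rw [Finset.card_erase_of_mem hC]
      omega
  convert h1.union (hfc C (hN𝒞 hC) w hwC hwZ) ?_ using 1
  · ext x
    simp only [Finset.mem_union, Finset.mem_erase, Finset.mem_biUnion, id]
    constructor
    · rintro ⟨hxw, hx | ⟨E, hE, hxE⟩⟩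
      · exact Or.inl (Or.inl hx)
      · by_cases hEC : E = C
        · exact Or.inr ⟨hxw, hEC ▸ hxE⟩
        · exact Or.inl (Or.inr ⟨E, ⟨hEC, hE⟩, hxE⟩)
    · rintro ((hx | ⟨E, ⟨hEC, hE⟩, hxE⟩) | ⟨hxw, hx⟩)
      · exact ⟨fun h => hB.notMem_of_mem_part (hN𝒞 hC) hwC (hS (h ▸ hx)), Or.inl hx⟩
      · exact ⟨fun h => hEC (hB.disj E (hN𝒞 hE) C (hN𝒞 hC) w (h ▸ hxE) hwC),
          Or.inr ⟨E, hE, hxE⟩⟩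
      · exact ⟨hxw, Or.inr ⟨C, hC, hx⟩⟩
  · rw [Finset.disjoint_left]
    intro x hx hx'
    have hxC := Finset.mem_of_mem_erase hx'
    rcases Finset.mem_union.1 hx with hx | hx
    · exact hB.notMem_of_mem_part (hN𝒞 hC) hxC (hS hx)
    · obtain ⟨E, hE, hxE⟩ := Finset.mem_biUnion.1 hx
      obtain ⟨hne, hE⟩ := Finset.mem_erase.1 hE
      exact hne (hB.disj E (hN𝒞 hE) C (hN𝒞 hC) x hxE hxC)

end TwoEars

/-! ### The two-ear theorem -/

section TwoEars

variable {V ι : Type*}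

/-- If all pairs of a nonempty family can be removed together from an elementary graph, then so
can at most two of them. -/
theorem Elementary.exists_two_of_matchable [DecidableEq V] [DecidableEq ι] {H : SimpleGraph V}
    {V₀ : Finset V} (hH : Elementary H V₀) {a b : ι → V} {F : Finset ι}
    (haV : ∀ i ∈ F, a i ∈ V₀) (hbV : ∀ i ∈ F, b i ∈ V₀) (hab : ∀ i ∈ F, a i ≠ b i)
    (hd : ∀ i ∈ F, ∀ j ∈ F, ∀ x, (x = a i ∨ x = b i) → (x = a j ∨ x = b j) → i = j)
    (hF : F.Nonempty) (hM : Matchable H (V₀ \ ends a b F)) :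
    ∃ i ∈ F, ∃ j ∈ F, Matchable H (V₀ \ ends a b {i, j}) := by
  classical
  by_contra! hno
  have hsingle : ∀ i ∈ F, ¬ Matchable H (V₀ \ {a i, b i}) := fun i hi => by
    simpa [ends] using hno i hi i hi
  have hpair : ∀ i ∈ F, ∀ j ∈ F, ¬ Matchable H (V₀ \ {a i, b i, a j, b j}) := fun i hi j hj => by
    convert hno i hi j hj using 3
    ext x
    simp only [ends, Finset.mem_insert, Finset.mem_singleton, Finset.mem_biUnion]
    constructor
    · rintro (h | h | h | h)
      exacts [⟨i, by simp [h]⟩, ⟨i, by simp [h]⟩, ⟨j, by simp [h]⟩, ⟨j, by simp [h]⟩]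
    · rintro ⟨k, rfl | rfl, h | h⟩ <;> simp [h]
  obtain ⟨e, he⟩ := hF
  obtain ⟨Z, 𝒞₀, hB₀, haZ, hbZ, hfc₀⟩ :=
    exists_factorCritical_barrier hH.matchable (haV e he) (hbV e he) (hab e he) (hsingle e he)
  -- A pair with exactly one end in the barrier would be removable on its own.
  have hside : ∀ i ∈ F, a i ∈ Z ↔ b i ∈ Z := fun i hi => by
    constructor
    · intro h1
      by_contra h2
      exact hsingle i hi (hH.matchable_sdiff_mixed hB₀ hfc₀ h1 (hbV i hi) h2)
    · intro h1
      by_contra h2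
      refine hsingle i hi ?_
      rw [Finset.pair_comm]
      exact hH.matchable_sdiff_mixed hB₀ hfc₀ h1 (haV i hi) h2
  -- `X` will be a smallest barrier inside `Z` that still contains the pairs lying in `Z`. Its
  -- merged parts may contain vertices of `Z`, whose removal is not controlled; the condition `c ∉
  -- Z` suffices because vertices of `X` have no neighbours in `Z`.
  let 𝒳 := Z.powerset.filter fun X => (∀ i ∈ F, a i ∈ Z → a i ∈ X ∧ b i ∈ X) ∧
    ∃ 𝒞, Barrier H V₀ X 𝒞 ∧ ∀ C ∈ 𝒞, ∀ c ∈ C, c ∉ Z → Matchable H (C.erase c)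
  have hne : 𝒳.Nonempty := ⟨Z, Finset.mem_filter.2 ⟨Finset.mem_powerset_self _,
    fun i hi h => ⟨h, (hside i hi).1 h⟩, 𝒞₀, hB₀, fun C hC c hc _ => hfc₀ C hC c hc⟩⟩
  obtain ⟨X, hX, hXmin⟩ := Finset.exists_min_image 𝒳 Finset.card hne
  obtain ⟨hXZ, hXF, 𝒞, hB, hfc⟩ := Finset.mem_filter.1 hX
  rw [Finset.mem_powerset] at hXZ
  have hZadj : ∀ x ∈ X, ∀ y, H.Adj x y → y ∉ Z := fun x hx y hxy =>
    hH.notMem_barrier_of_adj hB₀ hxy (hXZ hx)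
  let N := nbrParts H 𝒞
  have hN𝒞 : ∀ S, N S ⊆ 𝒞 := fun S => nbrParts_subset
  have hpart : ∀ C ∈ 𝒞, ∀ S, ∀ x ∈ C, x ∈ (N S).biUnion id → C ∈ N S := by
    intro C hC S x hx hx'
    obtain ⟨D, hD, hxD⟩ := Finset.mem_biUnion.1 hx'
    exact hB.disj D (hN𝒞 S hD) C hC x hxD hx ▸ hD
  -- Crossing pairs join two different parts of `X`. A set covers such a pair if both its ends lie
  -- in neighbouring parts of the set.
  let Cr : ι → Prop := fun j => j ∈ F ∧ a j ∉ Z ∧ ∃ C ∈ 𝒞, ∃ D ∈ 𝒞, a j ∈ C ∧ b j ∈ D ∧ C ≠ D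
  let Cov : Finset V → ι → Prop := fun S j => a j ∈ (N S).biUnion id ∧ b j ∈ (N S).biUnion id
  let P : Finset V → ι → ι → Prop := fun S i j => S ⊆ X ∧ S.Nonempty ∧ a i ∉ S ∧ b i ∉ S ∧
    (N S).card = S.card + 1 ∧ Cov S j
  have htight : ∀ i ∈ F, a i ∈ Z → ∀ j, Cr j → ∃ S, P S i j := by
    rintro i hi hiZ j ⟨hj, hjZ, C, hC, D, hD, hjC, hjD, hCD⟩
    obtain ⟨S, h1, h2, h3, h4, h5, h6, h7⟩ := hH.exists_tight hB hfc hZadj (hXF i hi hiZ).1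
      (hXF i hi hiZ).2 (hab i hi) hC hD hCD hjC hjD hjZ (fun h => hjZ ((hside j hj).2 h))
      (hpair i hi j hj)
    exact ⟨S, h1, h2, h3, h4, h5, Finset.mem_biUnion.2 ⟨C, h6, hjC⟩,
      Finset.mem_biUnion.2 ⟨D, h7, hjD⟩⟩
  -- If `T` covered all crossing pairs, the parts not adjacent to `T` would stay odd after deleting
  -- all pairs. They number at least `(X \ T).card - 1`, but their only outlets are the vertices of
  -- `X \ T`, of which the pair `k` has removed two.
  have hcount : ∀ T ⊆ X, (T = ∅ ∨ (N T).card = T.card + 1) → ∀ k ∈ F, a k ∈ Z → a k ∉ T →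
      b k ∉ T → ∃ l, Cr l ∧ ¬ Cov T l := by
    intro T hT htT k hk hkZ hakT hbkT
    by_contra! hall
    have h1 : (𝒞 \ N T).card ≤ ((X \ T) \ ends a b F).card := by
      refine hB.card_le_of_matchable_sdiff Finset.sdiff_subset (T := T) ?_ hab hd ?_ hM
      · intro C hC x hx t ht htx
        obtain ⟨hC, hCN⟩ := Finset.mem_sdiff.1 hC
        exact hCN (mem_nbrParts.2 ⟨hC, t, ht, x, hx, htx⟩)
      · intro i hi C hC
        obtain ⟨hC, hCN⟩ := Finset.mem_sdiff.1 hC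
        by_cases hiZ : a i ∈ Z
        · have h2 := hXF i hi hiZ
          exact ⟨fun h => (hB.notMem_of_mem_part hC h h2.1).elim,
            fun h => (hB.notMem_of_mem_part hC h h2.2).elim⟩
        · have hiX : a i ∉ X := fun h => hiZ (hXZ h)
          have hiX' : b i ∉ X := fun h => hiZ ((hside i hi).2 (hXZ h))
          obtain ⟨D, hD, haD⟩ := (hB.cover _).2 ⟨haV i hi, hiX⟩
          obtain ⟨E, hE, hbE⟩ := (hB.cover _).2 ⟨hbV i hi, hiX'⟩
          by_cases hDE : D = E
          · subst hDE
            constructor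
            · intro h; exact hB.disj D hD C hC _ haD h ▸ hbE
            · intro h; exact hB.disj D hD C hC _ hbE h ▸ haD
          · have hcov := hall i ⟨hi, hiZ, D, hD, E, hE, haD, hbE, hDE⟩
            exact ⟨fun h => (hCN (hpart C hC T _ h hcov.1)).elim,
              fun h => (hCN (hpart C hC T _ h hcov.2)).elim⟩
    have h2 : ((X \ T) \ ends a b F).card + 2 ≤ (X \ T).card := by
      have h3 : ({a k, b k} : Finset V) ⊆ (X \ T) ∩ ends a b F := by
        intro x hx
        have hx : x = a k ∨ x = b k := by simpa using hx
        refine Finset.mem_inter.2 ⟨Finset.mem_sdiff.2 ?_, mem_ends.2 ⟨k, hk, hx⟩⟩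
        rcases hx with rfl | rfl
        · exact ⟨(hXF k hk hkZ).1, hakT⟩
        · exact ⟨(hXF k hk hkZ).2, hbkT⟩
      have h4 := Finset.card_le_card h3
      rw [Finset.card_pair (hab k hk)] at h4
      have h5 := Finset.card_sdiff_add_card_inter (X \ T) (ends a b F)
      omega
    rw [Finset.card_sdiff_of_subset (hN𝒞 T), hB.card_eq] at h1
    rw [Finset.card_sdiff_of_subset hT] at h2
    have h6 := Finset.card_le_card hT
    rcases htT with rfl | htT
    · have : N ∅ = ∅ := Finset.eq_empty_of_forall_notMem fun C hC => by
        obtain ⟨-, s, hs, -⟩ := mem_nbrParts.1 hC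
        exact Finset.notMem_empty s hs
      rw [this, Finset.card_empty] at h1
      omega
    · omega
  -- Otherwise merging `S` with its neighbouring parts would give a smaller barrier, against the
  -- choice of `X`.
  have hmeet : ∀ S ⊆ X, S.Nonempty → (N S).card = S.card + 1 →
      ∃ k ∈ F, a k ∈ Z ∧ (a k ∈ S ∨ b k ∈ S) := by
    intro S hSX hSne hSt
    by_contra! hall
    have hSneX : S ≠ X := fun h => (hall e he haZ).1 (h ▸ (hXF e he haZ).1)
    have h1 : X \ S ∈ 𝒳 := by
      refine Finset.mem_filter.2 ⟨Finset.mem_powerset.2 (Finset.sdiff_subset.trans hXZ),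
        fun i hi hiZ => ⟨Finset.mem_sdiff.2 ⟨(hXF i hi hiZ).1, (hall i hi hiZ).1⟩,
          Finset.mem_sdiff.2 ⟨(hXF i hi hiZ).2, (hall i hi hiZ).2⟩⟩, _,
        hB.sdiff_tight hSX hSt, fun C hC c hc hcZ => ?_⟩
      rcases Finset.mem_insert.1 hC with rfl | hC
      · rcases Finset.mem_union.1 hc with hc | hc
        · exact (hcZ (hXZ (hSX hc))).elim
        · exact hH.matchable_tight_erase hB hfc hZadj hSX hSneX hSt hc hcZ
      · exact hfc C (Finset.mem_sdiff.1 hC).1 c hc hcZ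
    have h2 := hXmin _ h1
    rw [Finset.card_sdiff_of_subset hSX] at h2
    have h3 := Finset.card_pos.2 hSne
    have h4 := Finset.card_le_card hSX
    omega
  have hNU : ∀ S T, N (S ∪ T) = N S ∪ N T := fun S T => nbrParts_union
  have hNI : ∀ S T, N (S ∩ T) ⊆ N S ∩ N T := fun S T => Finset.subset_inter
    (nbrParts_mono Finset.inter_subset_left) (nbrParts_mono Finset.inter_subset_right)
  have hcovU : ∀ S T j, Cov S j → Cov (S ∪ T) j := fun S T j hj => by
    have h1 : N S ⊆ N (S ∪ T) := nbrParts_mono Finset.subset_union_left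
    exact ⟨Finset.biUnion_subset_biUnion_of_subset_left _ h1 hj.1,
      Finset.biUnion_subset_biUnion_of_subset_left _ h1 hj.2⟩
  obtain ⟨j₀, hj₀, -⟩ := hcount ∅ (Finset.empty_subset _) (Or.inl rfl) e he haZ
    (Finset.notMem_empty _) (Finset.notMem_empty _)
  obtain ⟨S₀, hS₀⟩ := htight e he haZ j₀ hj₀
  -- `S` is smallest among the tight sets that avoid some pair of the barrier and cover some
  -- crossing pair. Some barrier pair `k` meets `S`, and `T` is then a largest tight set that avoids
  -- `k` and covers the same crossing pair `j`.
  let 𝒮 := X.powerset.filter fun S => ∃ i ∈ F, a i ∈ Z ∧ ∃ j, Cr j ∧ P S i j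
  obtain ⟨S, hS, hSmin⟩ := Finset.exists_min_image 𝒮 Finset.card
    ⟨S₀, Finset.mem_filter.2 ⟨Finset.mem_powerset.2 hS₀.1, e, he, haZ, j₀, hj₀, hS₀⟩⟩
  obtain ⟨-, i, hi, hiZ, j, hj, hSX, hSne, haiS, hbiS, hSt, hSj⟩ := Finset.mem_filter.1 hS
  obtain ⟨k, hk, hkZ, hkS⟩ := hmeet S hSX hSne hSt
  obtain ⟨T₀, hT₀⟩ := htight k hk hkZ j hj
  let 𝒯 := X.powerset.filter fun T => P T k j
  obtain ⟨T, hT, hTmax⟩ := Finset.exists_max_image 𝒯 Finset.card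
    ⟨T₀, Finset.mem_filter.2 ⟨Finset.mem_powerset.2 hT₀.1, hT₀⟩⟩
  obtain ⟨-, hTX, hTne, hakT, hbkT, hTt, hTj⟩ := Finset.mem_filter.1 hT
  obtain ⟨hjF, hjZ, C, hC, D, hD, hjC, hjD, hCD⟩ := hj
  have hCI : C ∈ N S ∩ N T := Finset.mem_inter.2
    ⟨hpart C hC S _ hjC hSj.1, hpart C hC T _ hjC hTj.1⟩
  have hDI : D ∈ N S ∩ N T := Finset.mem_inter.2
    ⟨hpart D hD S _ hjD hSj.2, hpart D hD T _ hjD hTj.2⟩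
  -- Otherwise submodularity makes `S ∩ T` tight, and it still covers `j` because both parts of `j`
  -- are common neighbours. Minimality gives `S ⊆ T`, but `k` meets `S` and not `T`.
  have hST : S ∪ T = X := by
    by_contra hneX
    have h1 := hH.card_lt_nbrParts hB (Finset.union_subset hSX hTX)
      (hSne.mono Finset.subset_union_left) hneX
    have h1 : (S ∪ T).card + 1 ≤ (N S ∪ N T).card := by rw [← hNU]; exact h1
    have h2 := Finset.card_union_add_card_inter S T
    have h3 := Finset.card_union_add_card_inter (N S) (N T)
    have h4 : 2 ≤ (N S ∩ N T).card := by
      rw [← Finset.card_pair hCD]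
      refine Finset.card_le_card fun E hE => ?_
      rcases Finset.mem_insert.1 hE with rfl | hE
      · exact hCI
      · exact Finset.mem_singleton.1 hE ▸ hDI
    have hIne : (S ∩ T).Nonempty := Finset.card_pos.1 (by omega)
    have hIX : S ∩ T ≠ X := fun h =>
      haiS (Finset.inter_subset_left (h ▸ (hXF i hi hiZ).1 : a i ∈ S ∩ T))
    have h5 := hH.card_lt_nbrParts hB (Finset.inter_subset_left.trans hSX) hIne hIX
    have h5 : (S ∩ T).card + 1 ≤ (N (S ∩ T)).card := h5
    have h6 : N (S ∩ T) = N S ∩ N T :=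
      Finset.eq_of_subset_of_card_le (hNI S T) (by omega)
    have h7 : S ∩ T ∈ 𝒮 := by
      refine Finset.mem_filter.2 ⟨Finset.mem_powerset.2 (Finset.inter_subset_left.trans hSX),
        i, hi, hiZ, j, ⟨hjF, hjZ, C, hC, D, hD, hjC, hjD, hCD⟩,
        Finset.inter_subset_left.trans hSX, hIne, fun h => haiS (Finset.inter_subset_left h),
        fun h => hbiS (Finset.inter_subset_left h), by
          have h6c := congrArg Finset.card h6
          omega, ?_⟩
      simp only [Cov, h6]
      exact ⟨Finset.mem_biUnion.2 ⟨C, hCI, hjC⟩, Finset.mem_biUnion.2 ⟨D, hDI, hjD⟩⟩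
    have h8 := hSmin _ h7
    have h9 : S ∩ T = S := Finset.eq_of_subset_of_card_le Finset.inter_subset_left h8
    rcases hkS with h | h
    · exact hakT (Finset.inter_subset_right (h9.symm ▸ h))
    · exact hbkT (Finset.inter_subset_right (h9.symm ▸ h))
  -- A crossing pair `l` missed by `T` yields a tight set `R` avoiding `k` and covering `l`.
  obtain ⟨l, hl, hlT⟩ := hcount T hTX (Or.inr hTt) k hk hkZ hakT hbkT
  obtain ⟨R, hRX, hRne, hakR, hbkR, hRt, hRl⟩ := htight k hk hkZ l hl
  have hRTX : R ∪ T ≠ X := fun h => by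
    have : a k ∈ R ∪ T := h ▸ (hXF k hk hkZ).1
    rcases Finset.mem_union.1 this with h | h
    · exact hakR h
    · exact hakT h
  have h1 := hH.card_lt_nbrParts hB (Finset.union_subset hRX hTX)
    (hRne.mono Finset.subset_union_left) hRTX
  have h1 : (R ∪ T).card + 1 ≤ (N R ∪ N T).card := by rw [← hNU]; exact h1
  have h2 := Finset.card_union_add_card_inter R T
  have h3 := Finset.card_union_add_card_inter (N R) (N T)
  -- A tight union would cover both `j` and `l`, contradicting the maximality of `T`.
  have hnot : ¬ (N R ∪ N T).card ≤ (R ∪ T).card + 1 := by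
    intro hle
    have h4 : R ∪ T ∈ 𝒯 := by
      refine Finset.mem_filter.2 ⟨Finset.mem_powerset.2 (Finset.union_subset hRX hTX),
        Finset.union_subset hRX hTX, hRne.mono Finset.subset_union_left, ?_, ?_, ?_, ?_⟩
      · simp [hakR, hakT]
      · simp [hbkR, hbkT]
      · rw [hNU]; omega
      · rw [Finset.union_comm]
        exact hcovU T R j hTj
    have h5 := hTmax _ h4
    have h6 : T = R ∪ T := Finset.eq_of_subset_of_card_le Finset.subset_union_right h5
    exact hlT (h6 ▸ hcovU R T l hRl)
  -- The union has surplus at least two, which exhausts the combined surplus of `R` and `T`. So the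
  -- intersection has none, and both `R ∩ T` and the set of common neighbouring parts are empty.
  have hI0 : (R ∩ T) = ∅ := by
    by_contra hI
    have hI := Finset.nonempty_iff_ne_empty.2 hI
    have h5 : (R ∩ T).card + 1 ≤ (N (R ∩ T)).card :=
      hH.card_lt_nbrParts hB (Finset.inter_subset_left.trans hRX) hI (fun h =>
        hakR (Finset.inter_subset_left (h ▸ (hXF k hk hkZ).1 : a k ∈ R ∩ T)))
    have h6 := Finset.card_le_card (hNI R T)
    omega
  have hNI0 : N R ∩ N T = ∅ := by
    by_contra hI
    have hI := Finset.card_pos.2 (Finset.nonempty_iff_ne_empty.2 hI)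
    rw [hI0, Finset.card_empty] at h2
    omega
  have hRS : R ⊆ S := fun x hx => by
    have : x ∈ S ∪ T := hST ▸ hRX hx
    rcases Finset.mem_union.1 this with h | h
    · exact h
    · exact (Finset.notMem_empty x (hI0 ▸ Finset.mem_inter.2 ⟨hx, h⟩)).elim
  have hR𝒮 : R ∈ 𝒮 := Finset.mem_filter.2 ⟨Finset.mem_powerset.2 hRX, k, hk, hkZ, l, hl, hRX,
    hRne, hakR, hbkR, hRt, hRl⟩
  -- Being disjoint from `T`, the set `R` lies in `S` and equals it by minimality. But `S` and `T`
  -- share the neighbouring part `C`.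
  have hReq : R = S := Finset.eq_of_subset_of_card_le hRS (hSmin _ hR𝒮)
  rw [hReq] at hNI0
  exact Finset.notMem_empty C (hNI0 ▸ hCI)

end TwoEars

/-! ### Counting removable families of pairs -/

section PairFamilies

variable {V ι : Type*}

/-- The pairs `{a i, b i}` with `i ∈ I` are disjoint and can be removed together from `H`. -/
def Removable [DecidableEq V] (H : SimpleGraph V) (V₀ : Finset V) (a b : ι → V)
    (I : Finset ι) : Prop :=
  (∀ i ∈ I, ∀ j ∈ I, ∀ x, (x = a i ∨ x = b i) → (x = a j ∨ x = b j) → i = j) ∧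
    Matchable H (V₀ \ ends a b I)

/-- The graph `H` with the edges `{a i, b i}` for `i ∈ J` added. -/
def addPairs (H : SimpleGraph V) (a b : ι → V) (J : Finset ι) : SimpleGraph V where
  Adj x y := H.Adj x y ∨ x ≠ y ∧ ∃ i ∈ J, (x = a i ∧ y = b i) ∨ (x = b i ∧ y = a i)
  symm := ⟨by
    rintro x y (h | ⟨h, i, hi, h'⟩)
    · exact Or.inl h.symm
    · exact Or.inr ⟨h.symm, i, hi, by tauto⟩⟩
  loopless := ⟨by
    rintro x (h | ⟨h, -⟩)
    · exact h.ne rfl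
    · exact h rfl⟩

theorem addPairs_adj_pair {H : SimpleGraph V} {a b : ι → V} {J : Finset ι} {i : ι} (hi : i ∈ J)
    (hab : a i ≠ b i) : (addPairs H a b J).Adj (a i) (b i) :=
  Or.inr ⟨hab, i, hi, Or.inl ⟨rfl, rfl⟩⟩

/-- `I` collects added pairs that the matching uses: they are peeled off one at a time, and what
remains is matched in `H`. -/
theorem exists_removable_of_matchable_addPairs [DecidableEq V] [DecidableEq ι]
    {H : SimpleGraph V} {a b : ι → V} (J : Finset ι) :
    ∀ W, Matchable (addPairs H a b J) W →
      ∃ I ⊆ J, Removable H W a b I ∧ ∀ i ∈ I, a i ∈ W ∧ b i ∈ W := by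
  induction J using Finset.induction_on with
  | empty =>
    intro W hW
    refine ⟨∅, le_rfl, ⟨by simp, ?_⟩, by simp⟩
    have : ends a b ∅ = ∅ := rfl
    rw [this, Finset.sdiff_empty]
    refine hW.mono fun x y hxy => ?_
    rcases hxy with h | ⟨-, i, hi, -⟩
    · exact h
    · exact (Finset.notMem_empty i hi).elim
  | insert i J hiJ ih =>
    rintro W ⟨σ, hσ⟩
    by_cases h : a i ∈ W ∧ σ (a i) = b i
    · have hbW : b i ∈ W := h.2 ▸ (hσ _ h.1).1
      have h1 : PairsUp (addPairs H a b J) (W \ {a i, b i}) σ := by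
        have h2 := hσ.sdiff_pair h.1
        rw [h.2] at h2
        intro w hw
        obtain ⟨h3, h4, h5⟩ := h2 w hw
        refine ⟨h3, h4, ?_⟩
        rcases h5 with h5 | ⟨hne, j, hj, h6⟩
        · exact Or.inl h5
        · rcases Finset.mem_insert.1 hj with rfl | hj
          · have hw' := (Finset.mem_sdiff.1 hw).2
            simp only [Finset.mem_insert, Finset.mem_singleton] at hw'
            tauto
          · exact Or.inr ⟨hne, j, hj, h6⟩
      obtain ⟨I, hIJ, ⟨hd, hI⟩, hIW⟩ := ih _ ⟨σ, h1⟩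
      have hIW' : ∀ j ∈ I, ∀ x, (x = a j ∨ x = b j) → x ∈ W ∧ x ≠ a i ∧ x ≠ b i := by
        intro j hj x hx
        have : x ∈ W \ {a i, b i} := by
          rcases hx with rfl | rfl
          · exact (hIW j hj).1
          · exact (hIW j hj).2
        simpa using this
      refine ⟨insert i I, Finset.insert_subset_insert i hIJ, ⟨?_, ?_⟩, ?_⟩
      · intro j hj k hk x hxj hxk
        rcases Finset.mem_insert.1 hj with hj' | hj' <;>
          rcases Finset.mem_insert.1 hk with hk' | hk'
        · rw [hj', hk']
        · have := hIW' k hk' x hxk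
          rw [hj'] at hxj
          tauto
        · have := hIW' j hj' x hxj
          rw [hk'] at hxk
          tauto
        · exact hd j hj' k hk' x hxj hxk
      · convert hI using 1
        ext x
        simp only [Finset.mem_sdiff, mem_ends, Finset.mem_insert, Finset.mem_singleton]
        constructor
        · rintro ⟨hx, hx'⟩
          exact ⟨⟨hx, fun h => hx' ⟨i, Or.inl rfl, h⟩⟩, fun ⟨j, hj, h⟩ => hx' ⟨j, Or.inr hj, h⟩⟩
        · rintro ⟨⟨hx, hx1⟩, hx2⟩
          refine ⟨hx, ?_⟩
          rintro ⟨j, hj | hj, hxj⟩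
          · exact hx1 (hj ▸ hxj)
          · exact hx2 ⟨j, hj, hxj⟩
      · intro j hj
        rcases Finset.mem_insert.1 hj with rfl | hj
        · exact ⟨h.1, hbW⟩
        · exact ⟨(hIW' j hj _ (Or.inl rfl)).1, (hIW' j hj _ (Or.inr rfl)).1⟩
    · have h1 : PairsUp (addPairs H a b J) W σ := by
        intro w hw
        obtain ⟨h3, h4, h5⟩ := hσ w hw
        refine ⟨h3, h4, ?_⟩
        rcases h5 with h5 | ⟨hne, j, hj, h6⟩
        · exact Or.inl h5
        · rcases Finset.mem_insert.1 hj with rfl | hj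
          · rcases h6 with ⟨h6, h7⟩ | ⟨h6, h7⟩
            · exact (h ⟨h6 ▸ hw, h6 ▸ h7⟩).elim
            · exact (h ⟨h7 ▸ h3, by rw [← h7, h4, h6]⟩).elim
          · exact Or.inr ⟨hne, j, hj, h6⟩
      obtain ⟨I, hIJ, hI⟩ := ih _ ⟨σ, h1⟩
      exact ⟨I, hIJ.trans (Finset.subset_insert _ _), hI⟩

theorem Matchable.exists_pairsUp [DecidableEq V] {L : SimpleGraph V} {W : Finset V} {x y : V}
    (h : Matchable L (W \ {x, y})) (hxy : L.Adj x y) (hx : x ∈ W) (hy : y ∈ W) :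
    ∃ σ, PairsUp L W σ ∧ σ x = y := by
  obtain ⟨σ, hσ⟩ := h
  refine ⟨fun w => if w = x then y else if w = y then x else σ w, fun w hw => ?_, by simp⟩
  by_cases hwx : w = x
  · subst hwx
    simp [hxy, hy, hxy.ne.symm]
  by_cases hwy : w = y
  · subst hwy
    simp [hxy.symm, hx, hxy.ne.symm]
  · have := hσ w (by simp [hw, hwx, hwy])
    have h1 := this.1
    simp only [Finset.mem_sdiff, Finset.mem_insert, Finset.mem_singleton, not_or] at h1
    simp only [hwx, hwy, if_false, h1.2.1, h1.2.2]
    exact ⟨h1.1, this.2⟩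

theorem matchable_ends [DecidableEq V] {L : SimpleGraph V} {a b : ι → V} {I : Finset ι}
    (hd : ∀ i ∈ I, ∀ j ∈ I, ∀ x, (x = a i ∨ x = b i) → (x = a j ∨ x = b j) → i = j)
    (hL : ∀ i ∈ I, L.Adj (a i) (b i)) : Matchable L (ends a b I) :=
  Matchable.biUnion (fun i hi => Matchable.pair (hL i hi)) fun i hi j hj x hx hx' =>
    hd i hi j hj x (by simpa using hx) (by simpa using hx')

/-- The ends of the pairs of `I` outside `K` are matched by those pairs themselves, which are edges
of the enlarged graph. -/
theorem Removable.matchable_addPairs [DecidableEq V] [DecidableEq ι] {H : SimpleGraph V}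
    {V₀ : Finset V} {a b : ι → V} {I J K : Finset ι} (hI : Removable H V₀ a b I)
    (hV : ∀ i, a i ∈ V₀ ∧ b i ∈ V₀) (hab : ∀ i, a i ≠ b i) (hK : K ⊆ I) (hJ : I \ K ⊆ J) :
    Matchable (addPairs H a b J) (V₀ \ ends a b K) := by
  have h1 : Matchable (addPairs H a b J) (V₀ \ ends a b I) := hI.2.mono fun _ _ h => Or.inl h
  have h2 : Matchable (addPairs H a b J) (ends a b (I \ K)) :=
    matchable_ends (fun i hi j hj => hI.1 i (Finset.mem_sdiff.1 hi).1 j (Finset.mem_sdiff.1 hj).1)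
      fun i hi => addPairs_adj_pair (hJ hi) (hab i)
  convert h1.union h2 ?_ using 1
  · ext x
    simp only [Finset.mem_sdiff, Finset.mem_union, mem_ends]
    constructor
    · rintro ⟨hx, hxK⟩
      by_cases h : ∃ i ∈ I, x = a i ∨ x = b i
      · obtain ⟨i, hi, h⟩ := h
        exact Or.inr ⟨i, ⟨hi, fun hiK => hxK ⟨i, hiK, h⟩⟩, h⟩
      · exact Or.inl ⟨hx, h⟩
    · rintro (⟨hx, h⟩ | ⟨i, ⟨hi, hiK⟩, h⟩)
      · exact ⟨hx, fun ⟨i, hi, h'⟩ => h ⟨i, hK hi, h'⟩⟩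
      · refine ⟨?_, fun ⟨j, hj, h'⟩ => hiK (hI.1 i hi j (hK hj) x h h' ▸ hj)⟩
        rcases h with rfl | rfl
        exacts [(hV i).1, (hV i).2]
  · rw [Finset.disjoint_left]
    intro x hx hx'
    obtain ⟨i, hi, h⟩ := mem_ends.1 hx'
    exact (Finset.mem_sdiff.1 hx).2 (mem_ends.2 ⟨i, (Finset.mem_sdiff.1 hi).1, h⟩)

/-- A new edge is completed to a perfect matching by the other pairs of its removable family and a
matching in `H` of the remaining vertices. -/
theorem Elementary.addPairs [DecidableEq V] [DecidableEq ι] {H : SimpleGraph V} {V₀ : Finset V}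
    (hH : Elementary H V₀) {a b : ι → V} (hV : ∀ i, a i ∈ V₀ ∧ b i ∈ V₀) (hab : ∀ i, a i ≠ b i)
    {J : Finset ι} (hJ : ∀ i ∈ J, ∃ I ⊆ J, i ∈ I ∧ Removable H V₀ a b I) :
    Elementary (addPairs H a b J) V₀ := by
  have hmem : ∀ x y, (EarExcess.addPairs H a b J).Adj x y → x ∈ V₀ := by
    rintro x y (h | ⟨-, i, -, ⟨rfl, -⟩ | ⟨rfl, -⟩⟩)
    exacts [hH.mem _ _ h, (hV i).1, (hV i).2]
  refine ⟨hmem, fun S hS hne hcl => hH.conn S hS hne fun x hx y hxy => hcl x hx y (Or.inl hxy),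
    ?_, hH.matchable.mono fun _ _ h => Or.inl h⟩
  intro x y hxy
  rcases id hxy with h | ⟨hne, i, hi, h⟩
  · obtain ⟨σ, hσ, h1⟩ := hH.ext x y h
    exact ⟨σ, hσ.mono fun _ _ h => Or.inl h, h1⟩
  · obtain ⟨I, hIJ, hiI, hI⟩ := hJ i hi
    have h1 := hI.matchable_addPairs (J := J) (K := {i}) hV hab (by simpa using hiI)
      (Finset.sdiff_subset.trans hIJ)
    refine Matchable.exists_pairsUp ?_ hxy (hmem _ _ hxy) (hmem _ _ hxy.symm)
    rcases h with ⟨rfl, rfl⟩ | ⟨rfl, rfl⟩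
    · simpa [ends] using h1
    · rw [Finset.pair_comm]
      simpa [ends] using h1

open Classical in
/-- If each of the pairs belongs to a removable family, then the number of pairs is at most twice
the number of nonempty removable families. -/
theorem Elementary.card_le_two_mul_removable [Fintype ι] {H : SimpleGraph V}
    {V₀ : Finset V} (hH : Elementary H V₀) {a b : ι → V} (hV : ∀ i, a i ∈ V₀ ∧ b i ∈ V₀)
    (hab : ∀ i, a i ≠ b i) (hcov : ∀ i, ∃ I : Finset ι, i ∈ I ∧ Removable H V₀ a b I) :
    Fintype.card ι ≤
      2 * (Finset.univ.filter fun I : Finset ι => I.Nonempty ∧ Removable H V₀ a b I).card := by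
  let 𝓕 : Finset ι → Finset (Finset ι) := fun J =>
    Finset.univ.filter fun I => I ⊆ J ∧ I.Nonempty ∧ Removable H V₀ a b I
  -- The sets of pairs that are covered by removable families of their own and satisfy the bound. A
  -- largest one will turn out to be everything.
  let 𝒥 : Finset (Finset ι) := Finset.univ.filter fun J =>
    (∀ i ∈ J, ∃ I ⊆ J, i ∈ I ∧ Removable H V₀ a b I) ∧ J.card ≤ 2 * (𝓕 J).card
  obtain ⟨J, hJ, hmax⟩ := Finset.exists_max_image 𝒥 Finset.card ⟨∅, by simp [𝒥]⟩
  obtain ⟨-, hJcov, hJcard⟩ := Finset.mem_filter.1 hJ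
  have hJuniv : J = Finset.univ := by
    by_contra hne
    obtain ⟨i, hi⟩ : ∃ i, i ∉ J := by
      by_contra! h
      exact hne (Finset.eq_univ_of_forall h)
    obtain ⟨I, hiI, hI⟩ := hcov i
    have hH' := hH.addPairs hV hab hJcov
    have hM := hI.matchable_addPairs (J := J) (K := I \ J) hV hab Finset.sdiff_subset
      (fun k hk => by simp only [Finset.mem_sdiff] at hk; tauto)
    have hIm : ∀ k ∈ I \ J, k ∈ I := fun k hk => (Finset.mem_sdiff.1 hk).1
    -- The two-ear theorem is applied to `H` with the pairs of `J` as edges, which is still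
    -- elementary. The pairs `j` and `k` may coincide.
    obtain ⟨j, hj, k, hk, hjk⟩ := hH'.exists_two_of_matchable (F := I \ J)
      (fun k _ => (hV k).1) (fun k _ => (hV k).2) (fun k _ => hab k)
      (fun j hj k hk => hI.1 j (hIm j hj) k (hIm k hk)) ⟨i, by simp [hiI, hi]⟩ hM
    obtain ⟨I₁, hI₁J, ⟨hd₁, hM₁⟩, hI₁V⟩ := exists_removable_of_matchable_addPairs J _ hjk
    have hjkI : ∀ l ∈ ({j, k} : Finset ι), l ∈ I ∧ l ∉ J := by
      intro l hl
      rcases Finset.mem_insert.1 hl with rfl | hl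
      · exact Finset.mem_sdiff.1 hj
      · exact Finset.mem_singleton.1 hl ▸ Finset.mem_sdiff.1 hk
    have hI₁' : ∀ l ∈ I₁, ∀ m ∈ ({j, k} : Finset ι), ∀ x, (x = a l ∨ x = b l) →
        (x = a m ∨ x = b m) → False := by
      intro l hl m hm x hxl hxm
      have : x ∈ V₀ \ ends a b {j, k} := by
        rcases hxl with rfl | rfl
        exacts [(hI₁V l hl).1, (hI₁V l hl).2]
      exact (Finset.mem_sdiff.1 this).2 (mem_ends.2 ⟨m, hm, hxm⟩)
    have hR : Removable H V₀ a b (I₁ ∪ {j, k}) := by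
      refine ⟨fun l hl m hm x hxl hxm => ?_, ?_⟩
      · rcases Finset.mem_union.1 hl with hl | hl <;> rcases Finset.mem_union.1 hm with hm | hm
        · exact hd₁ l hl m hm x hxl hxm
        · exact (hI₁' l hl m hm x hxl hxm).elim
        · exact (hI₁' m hm l hl x hxm hxl).elim
        · exact hI.1 l (hjkI l hl).1 m (hjkI m hm).1 x hxl hxm
      · convert hM₁ using 1
        ext x
        simp only [Finset.mem_sdiff, mem_ends, Finset.mem_union]
        constructor
        · rintro ⟨hx, h⟩
          exact ⟨⟨hx, fun ⟨l, hl, h'⟩ => h ⟨l, Or.inr hl, h'⟩⟩,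
            fun ⟨l, hl, h'⟩ => h ⟨l, Or.inl hl, h'⟩⟩
        · rintro ⟨⟨hx, h1⟩, h2⟩
          refine ⟨hx, ?_⟩
          rintro ⟨l, hl | hl, h'⟩
          exacts [h2 ⟨l, hl, h'⟩, h1 ⟨l, hl, h'⟩]
    have hJ' : J ∪ {j, k} ∈ 𝒥 := by
      refine Finset.mem_filter.2 ⟨Finset.mem_univ _, fun l hl => ?_, ?_⟩
      · rcases Finset.mem_union.1 hl with hl | hl
        · obtain ⟨I', h1, h2⟩ := hJcov l hl
          exact ⟨I', h1.trans Finset.subset_union_left, h2⟩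
        · exact ⟨_, Finset.union_subset_union_left hI₁J, Finset.mem_union_right _ hl, hR⟩
      · have h1 : insert (I₁ ∪ {j, k}) (𝓕 J) ⊆ 𝓕 (J ∪ {j, k}) := by
          intro I' hI'
          rcases Finset.mem_insert.1 hI' with rfl | hI'
          · exact Finset.mem_filter.2 ⟨Finset.mem_univ _, Finset.union_subset_union_left hI₁J,
              ⟨j, by simp⟩, hR⟩
          · obtain ⟨-, h2, h3⟩ := Finset.mem_filter.1 hI'
            exact Finset.mem_filter.2 ⟨Finset.mem_univ _, h2.trans Finset.subset_union_left, h3⟩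
        -- The new family contains `j`, which is not in `J`. So at most two new pairs are paid for
        -- by one new family.
        have h2 : I₁ ∪ {j, k} ∉ 𝓕 J := fun h =>
          (hjkI j (by simp)).2 ((Finset.mem_filter.1 h).2.1 (by simp))
        have h3 := Finset.card_le_card h1
        rw [Finset.card_insert_of_notMem h2] at h3
        have h4 := Finset.card_union_le J {j, k}
        have h5 : ({j, k} : Finset ι).card ≤ 2 := Finset.card_le_two
        omega
    have h1 := hmax _ hJ'
    have h2 : J = J ∪ {j, k} := Finset.eq_of_subset_of_card_le Finset.subset_union_left h1
    exact (hjkI j (by simp)).2 (h2 ▸ by simp)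
  subst hJuniv
  simpa [𝓕] using hJcard

end PairFamilies

/-! ### Perfect matchings of subgraphs as partner maps -/

section Subgraphs

variable {U : Type*}

theorem IsPerfectMatchingOf.mono {M G K : Gph U} (h : IsPerfectMatchingOf M G) (hGK : G ≤ K)
    (hv : G.verts = K.verts) : IsPerfectMatchingOf M K :=
  ⟨h.1.trans hGK, h.2.1.trans hv, h.2.2⟩

variable [Finite U]

/-- The vertex set of `G` as a finset. -/
noncomputable def vertFinset (G : Gph U) : Finset U := G.verts.toFinite.toFinset

theorem mem_vertFinset {G : Gph U} {x : U} : x ∈ vertFinset G ↔ x ∈ G.verts := by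
  simp [vertFinset]

theorem card_vertFinset (G : Gph U) : (vertFinset G).card = numVerts G := by
  rw [numVerts, vertFinset, Set.ncard_eq_toFinset_card]

theorem IsPerfectMatchingOf.exists_pairsUp {M G : Gph U} (h : IsPerfectMatchingOf M G) :
    ∃ σ, PairsUp M.spanningCoe (vertFinset G) σ ∧
      ∀ x y, M.Adj x y ↔ x ∈ G.verts ∧ σ x = y := by
  obtain ⟨-, hv, hM⟩ := h
  have h1 : ∀ x, ∃ y, x ∈ G.verts → M.Adj x y := fun x => by
    by_cases hx : x ∈ G.verts
    · obtain ⟨y, hy, -⟩ := hM (hv ▸ hx)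
      exact ⟨y, fun _ => hy⟩
    · exact ⟨x, fun h => (hx h).elim⟩
  choose σ hσ using h1
  have h2 : ∀ x ∈ G.verts, σ x ∈ G.verts := fun x hx => hv ▸ M.edge_vert (hσ x hx).symm
  have h3 : ∀ x y, M.Adj x y → x ∈ G.verts := fun x y hxy => hv ▸ M.edge_vert hxy
  refine ⟨σ, fun x hx => ?_, fun x y => ⟨fun hxy => ⟨h3 x y hxy, ?_⟩, ?_⟩⟩
  · rw [mem_vertFinset] at hx ⊢
    exact ⟨h2 x hx, hM.eq_of_adj_left (hσ _ (h2 x hx)) (hσ x hx).symm, hσ x hx⟩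
  · exact hM.eq_of_adj_left (hσ x (h3 x y hxy)) hxy
  · rintro ⟨hx, rfl⟩
    exact hσ x hx

theorem PairsUp.exists_isPerfectMatchingOf {G : Gph U} {σ : U → U}
    (h : PairsUp G.spanningCoe (vertFinset G) σ) :
    ∃ M, IsPerfectMatchingOf M G ∧ ∀ x y, M.Adj x y ↔ x ∈ G.verts ∧ σ x = y := by
  have h' : ∀ x ∈ G.verts, σ x ∈ G.verts ∧ σ (σ x) = x ∧ G.Adj x (σ x) := fun x hx => by
    have := h x (mem_vertFinset.2 hx)
    rwa [mem_vertFinset] at this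
  let M : Gph U :=
    { verts := G.verts
      Adj := fun x y => x ∈ G.verts ∧ σ x = y
      adj_sub := by
        rintro x _ ⟨hx, rfl⟩
        exact (h' x hx).2.2.adj_sub
      edge_vert := fun h => h.1
      symm := ⟨by
        rintro x _ ⟨hx, rfl⟩
        exact ⟨(h' x hx).1, (h' x hx).2.1⟩⟩ }
  refine ⟨M, ⟨⟨le_rfl, ?_⟩, rfl, ?_⟩, fun x y => Iff.rfl⟩
  · rintro x _ ⟨hx, rfl⟩
    exact (h' x hx).2.2
  · intro x hx
    exact ⟨σ x, ⟨hx, rfl⟩, fun y hy => hy.2.symm⟩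

/-- Two different vertices are needed: a single vertex is vacuously 1-extendable but has no perfect
matching. With two, connectedness gives an edge, and that edge lies in a perfect matching. -/
theorem OneExtendable.elementary {G : Gph U} (hG : OneExtendable G) {x y : U} (hx : x ∈ G.verts)
    (hy : y ∈ G.verts) (hxy : x ≠ y) : Elementary G.spanningCoe (vertFinset G) := by
  classical
  have hconn : ∀ S ⊆ vertFinset G, S.Nonempty →
      (∀ x ∈ S, ∀ y, G.spanningCoe.Adj x y → y ∈ S) → vertFinset G ⊆ S := by
    rintro S hS ⟨s, hs⟩ hcl t ht
    have hsG := mem_vertFinset.1 (hS hs)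
    have hreach := (hG.1.coe.preconnected ⟨s, hsG⟩ ⟨t, mem_vertFinset.1 ht⟩)
    rw [SimpleGraph.reachable_iff_reflTransGen] at hreach
    have : ∀ z : G.verts, Relation.ReflTransGen G.coe.Adj ⟨s, hsG⟩ z → (z : U) ∈ S := by
      intro z hz
      induction hz with
      | refl => exact hs
      | tail _ hbc ih => exact hcl _ ih _ hbc
    exact this _ hreach
  have hext : ∀ x y, G.spanningCoe.Adj x y →
      ∃ σ, PairsUp G.spanningCoe (vertFinset G) σ ∧ σ x = y := by
    intro x y hxy
    obtain ⟨M, hM, he⟩ := hG.2 s(x, y) hxy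
    obtain ⟨σ, hσ, hσ'⟩ := hM.exists_pairsUp
    exact ⟨σ, hσ.mono fun _ _ h => hM.1.2 h, ((hσ' x y).1 he).2⟩
  refine ⟨fun x y hxy => mem_vertFinset.2 (G.edge_vert hxy), hconn, hext, ?_⟩
  obtain ⟨z, hz⟩ : ∃ z, G.spanningCoe.Adj x z := by
    by_contra! hno
    have := hconn {x} (by simpa [mem_vertFinset] using hx) ⟨x, by simp⟩
      (fun w hw z hwz => (hno z (Finset.mem_singleton.1 hw ▸ hwz)).elim)
    exact hxy (Finset.mem_singleton.1 (this (mem_vertFinset.2 hy))).symm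
  obtain ⟨σ, hσ, -⟩ := hext x z hz
  exact ⟨σ, hσ⟩

end Subgraphs

/-! ### Ears as paths of odd length -/

section Ears

variable {U : Type*}

/-- A path on vertices `g s, …, g (s + 2m - 1)` has a perfect matching. -/
theorem exists_pairsUp_path [DecidableEq U] {L : SimpleGraph U} {g : ℕ → U} {s m : ℕ}
    (hinj : Set.InjOn g (Set.Ico s (s + 2 * m)))
    (hadj : ∀ j, s ≤ j → j + 1 < s + 2 * m → L.Adj (g j) (g (j + 1))) :
    ∃ σ, PairsUp L ((Finset.Ico s (s + 2 * m)).image g) σ ∧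
      ∀ j < m, σ (g (s + 2 * j)) = g (s + 2 * j + 1) := by
  classical
  obtain ⟨τ, hτ⟩ := exists_glue (fun j : Fin m => ({g (s + 2 * j), g (s + 2 * j + 1)} : Finset U))
    (fun j => Equiv.swap (g (s + 2 * j)) (g (s + 2 * j + 1))) (by
      intro i j x hi hj
      simp only [Finset.mem_insert, Finset.mem_singleton] at hi hj
      have hi2 := i.2
      have hj2 := j.2
      have key : ∀ k l, k ∈ Set.Ico s (s + 2 * m) → l ∈ Set.Ico s (s + 2 * m) → x = g k →
          x = g l → k = l := fun k l hk hl h1 h2 => hinj hk hl (h1.symm.trans h2)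
      simp only [Set.mem_Ico] at key
      apply Fin.ext
      rcases hi with hi | hi <;> rcases hj with hj | hj <;>
        · have := key _ _ (by omega) (by omega) hi hj
          omega)
  have himg : (Finset.Ico s (s + 2 * m)).image g =
      Finset.univ.biUnion fun j : Fin m => {g (s + 2 * j), g (s + 2 * j + 1)} := by
    ext x
    simp only [Finset.mem_image, Finset.mem_Ico, Finset.mem_biUnion, Finset.mem_univ, true_and,
      Finset.mem_insert, Finset.mem_singleton]
    constructor
    · rintro ⟨k, hk, rfl⟩
      refine ⟨⟨(k - s) / 2, by omega⟩, ?_⟩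
      rcases Nat.mod_two_eq_zero_or_one (k - s) with h | h
      · left; congr 1; simp only; omega
      · right; congr 1; simp only; omega
    · rintro ⟨j, rfl | rfl⟩
      · exact ⟨_, by have := j.2; omega, rfl⟩
      · exact ⟨_, by have := j.2; omega, rfl⟩
  refine ⟨τ, ?_, fun j hj => ?_⟩
  · rw [himg]
    refine PairsUp.biUnion fun j _ => PairsUp.congr ?_ (hτ j)
    have h1 := hadj (s + 2 * j) (by omega) (by have := j.2; omega)
    intro w hw
    simp only [Finset.mem_insert, Finset.mem_singleton] at hw ⊢
    rcases hw with rfl | rfl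
    · simp [h1]
    · simp [h1.symm]
  · rw [hτ ⟨j, hj⟩ _ (by simp)]
    simp

namespace Ear

variable {H : Gph U} (ε : Ear H)

theorem one_le_length : 1 ≤ ε.path.length := by
  by_contra h
  exact ε.ne (SimpleGraph.Walk.eq_of_length_eq_zero (p := ε.path) (by omega))

theorem getVert_inj {i j : ℕ} (hi : i ≤ ε.path.length) (hj : j ≤ ε.path.length)
    (h : ε.path.getVert i = ε.path.getVert j) : i = j :=
  ε.isPath.getVert_injOn hi hj h

theorem mem_internalVerts {x : U} : x ∈ internalVerts ε.path ↔
    ∃ j, 0 < j ∧ j < ε.path.length ∧ ε.path.getVert j = x := by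
  simp only [internalVerts, Set.mem_ofPred_eq, SimpleGraph.Walk.mem_support_iff_exists_getVert]
  constructor
  · rintro ⟨⟨j, rfl, hj⟩, h1, h2⟩
    refine ⟨j, Nat.pos_of_ne_zero ?_, lt_of_le_of_ne hj ?_, rfl⟩
    · rintro rfl; exact h1 (by simp)
    · rintro rfl; exact h2 (by simp)
  · rintro ⟨j, h0, hl, rfl⟩
    refine ⟨⟨j, rfl, hl.le⟩, fun h => ?_, fun h => ?_⟩
    · have := ε.getVert_inj hl.le (Nat.zero_le _) (by simpa using h)
      omega
    · have := ε.getVert_inj hl.le le_rfl (by simpa using h)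
      omega

theorem ncard_internalVerts : (internalVerts ε.path).ncard + 1 = ε.path.length := by
  have h1 : internalVerts ε.path = ε.path.getVert '' (Set.Ioo 0 ε.path.length) := by
    ext x
    rw [mem_internalVerts]
    simp [and_assoc]
  have h2 := ε.one_le_length
  rw [h1, Set.InjOn.ncard_image, Set.ncard_eq_toFinset_card', Set.toFinset_Ioo, Nat.card_Ioo]
  · omega
  · intro i hi j hj h
    exact ε.getVert_inj hi.2.le hj.2.le h

theorem odd_length : Odd ε.path.length := by
  rw [← ε.ncard_internalVerts]
  exact ε.even_order.add_one

theorem adj_iff {x y : U} : ε.path.toSubgraph.Adj x y ↔ ∃ j < ε.path.length,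
    (x = ε.path.getVert j ∧ y = ε.path.getVert (j + 1)) ∨
      (x = ε.path.getVert (j + 1) ∧ y = ε.path.getVert j) := by
  rw [SimpleGraph.Walk.toSubgraph_adj_iff]
  constructor
  · rintro ⟨j, h, hj⟩
    refine ⟨j, hj, ?_⟩
    simp only [Sym2.eq_iff] at h
    tauto
  · rintro ⟨j, hj, h⟩
    refine ⟨j, ?_, hj⟩
    simp only [Sym2.eq_iff]
    tauto

theorem getVert_notMem {j : ℕ} (h0 : 0 < j) (hj : j < ε.path.length) :
    ε.path.getVert j ∉ H.verts := fun h =>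
  Set.disjoint_left.1 ε.internal_new (ε.mem_internalVerts.2 ⟨j, h0, hj, rfl⟩) h

theorem not_adj_of_adj {x y : U} (h : ε.path.toSubgraph.Adj x y) : ¬ H.Adj x y := fun h' =>
  Set.disjoint_left.1 ε.edges_new (show s(x, y) ∈ ε.path.toSubgraph.edgeSet from h) h'

end Ear

end Ears

/-! ### Perfect matchings of an ear augmentation -/

section EarAugmentation

variable {U : Type*} {H K : Gph U} {r : ℕ} {ε : Fin r → Ear H}

theorem adj_augmentation (hK : K = H ⊔ ⨆ i, (ε i).path.toSubgraph) {x y : U} :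
    K.Adj x y ↔ H.Adj x y ∨ ∃ i, (ε i).path.toSubgraph.Adj x y := by
  rw [hK, SimpleGraph.Subgraph.sup_adj, SimpleGraph.Subgraph.iSup_adj]

theorem mem_verts_augmentation (hK : K = H ⊔ ⨆ i, (ε i).path.toSubgraph) {x : U} :
    x ∈ K.verts ↔ x ∈ H.verts ∨ ∃ i, x ∈ internalVerts (ε i).path := by
  rw [hK, SimpleGraph.Subgraph.verts_sup, SimpleGraph.Subgraph.verts_iSup, Set.mem_union,
    Set.mem_iUnion]
  simp only [SimpleGraph.Walk.mem_verts_toSubgraph]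
  constructor
  · rintro (h | ⟨i, hi⟩)
    · exact Or.inl h
    · by_cases h1 : x = (ε i).fst
      · exact Or.inl (h1 ▸ (ε i).fst_mem)
      by_cases h2 : x = (ε i).snd
      · exact Or.inl (h2 ▸ (ε i).snd_mem)
      · exact Or.inr ⟨i, hi, h1, h2⟩
  · rintro (h | ⟨i, hi⟩)
    · exact Or.inl h
    · exact Or.inr ⟨i, hi.1⟩

theorem getVert_mem_augmentation (hK : K = H ⊔ ⨆ i, (ε i).path.toSubgraph) (i : Fin r) (j : ℕ) :
    (ε i).path.getVert j ∈ K.verts := by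
  rw [hK, SimpleGraph.Subgraph.verts_sup, SimpleGraph.Subgraph.verts_iSup]
  exact Or.inr (Set.mem_iUnion.2 ⟨i, (SimpleGraph.Walk.mem_verts_toSubgraph _).2
    (SimpleGraph.Walk.getVert_mem_support _ _)⟩)

/-- An internal vertex of an ear has no neighbours outside its ear. -/
theorem eq_getVert_of_adj (hK : K = H ⊔ ⨆ i, (ε i).path.toSubgraph)
    (hd : ∀ i j, i ≠ j → Disjoint (internalVerts (ε i).path) (internalVerts (ε j).path))
    {i : Fin r} {j : ℕ} (h0 : 0 < j) (hj : j < (ε i).path.length) {y : U}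
    (hy : K.Adj ((ε i).path.getVert j) y) :
    y = (ε i).path.getVert (j - 1) ∨ y = (ε i).path.getVert (j + 1) := by
  have hnot := (ε i).getVert_notMem h0 hj
  rcases (adj_augmentation hK).1 hy with h | ⟨k, hk⟩
  · exact (hnot (H.edge_vert h)).elim
  · have hki : k = i := by
      by_contra hne
      refine Set.disjoint_left.1 (hd k i hne) ⟨?_, ?_, ?_⟩
        ((ε i).mem_internalVerts.2 ⟨j, h0, hj, rfl⟩)
      · exact (SimpleGraph.Walk.mem_verts_toSubgraph _).1 (SimpleGraph.Subgraph.edge_vert _ hk)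
      · exact fun h => hnot (h ▸ (ε k).fst_mem)
      · exact fun h => hnot (h ▸ (ε k).snd_mem)
    subst hki
    obtain ⟨l, hl, ⟨h1, rfl⟩ | ⟨h1, rfl⟩⟩ := (ε k).adj_iff.1 hk
    · rw [(ε k).getVert_inj hj.le hl.le h1]
      exact Or.inr rfl
    · rw [(ε k).getVert_inj hj.le hl h1]
      exact Or.inl rfl

variable [Finite U]

/-- Internal vertices have no neighbours off their ear, so matching edges alternate along it. As the
length is odd, the first edge is used exactly when the last one is. -/
theorem PairsUp.ear_iff (hK : K = H ⊔ ⨆ i, (ε i).path.toSubgraph)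
    (hd : ∀ i j, i ≠ j → Disjoint (internalVerts (ε i).path) (internalVerts (ε j).path))
    {σ : U → U} (hσ : PairsUp K.spanningCoe (vertFinset K) σ) (i : Fin r) :
    σ (ε i).fst = (ε i).path.getVert 1 ↔
      σ (ε i).snd = (ε i).path.getVert ((ε i).path.length - 1) := by
  set g := (ε i).path.getVert with hg
  obtain ⟨m, hm⟩ := (ε i).odd_length
  have hinj : ∀ j k, j ≤ 2 * m + 1 → k ≤ 2 * m + 1 → g j = g k → j = k :=
    fun j k hj hk h => (ε i).getVert_inj (by omega) (by omega) h
  have hσσ : ∀ j, σ (σ (g j)) = g j := fun j =>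
    (hσ _ (mem_vertFinset.2 (getVert_mem_augmentation hK i j))).2.1
  have hnbr : ∀ j, 0 < j → j < 2 * m + 1 → σ (g j) = g (j - 1) ∨ σ (g j) = g (j + 1) :=
    fun j h0 hj => eq_getVert_of_adj hK hd h0 (by omega)
      (hσ _ (mem_vertFinset.2 (getVert_mem_augmentation hK i j))).2.2
  have h0 : g 0 = (ε i).fst := by simp [hg]
  have hl : g (2 * m + 1) = (ε i).snd := by rw [hg, ← hm]; simp
  rw [hm, ← h0, ← hl, Nat.add_sub_cancel]
  constructor
  · intro h
    have key : ∀ j, j ≤ m → σ (g (2 * j)) = g (2 * j + 1) := by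
      intro j
      induction j with
      | zero => intro _; exact h
      | succ j ih =>
        intro hj
        have ih := ih (by omega)
        rcases hnbr (2 * (j + 1)) (by omega) (by omega) with h1 | h1
        · have h2 := hσσ (2 * j)
          have h3 := hσσ (2 * (j + 1))
          rw [ih] at h2
          rw [h1, show 2 * (j + 1) - 1 = 2 * j + 1 by omega, h2] at h3
          have := hinj _ _ (by omega) (by omega) h3
          omega
        · exact h1
    rw [← key m le_rfl, hσσ]
  · intro h
    have key : ∀ t, t ≤ m → σ (g (2 * (m - t))) = g (2 * (m - t) + 1) := by
      intro t
      induction t with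
      | zero =>
        intro _
        rw [Nat.sub_zero, ← h, hσσ]
      | succ t ih =>
        intro ht
        have ih := ih (by omega)
        obtain ⟨k, hk⟩ : ∃ k, m - t = k + 1 := ⟨m - t - 1, by omega⟩
        rw [show m - (t + 1) = k by omega]
        rw [hk] at ih
        rcases hnbr (2 * k + 1) (by omega) (by omega) with h1 | h1
        · rw [show 2 * k + 1 - 1 = 2 * k by omega] at h1
          rw [← h1, hσσ]
        · have h3 := hσσ (2 * k + 1)
          rw [h1, show 2 * k + 1 + 1 = 2 * (k + 1) by omega, ih] at h3
          have := hinj _ _ (by omega) (by omega) h3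
          omega
    simpa using key m le_rfl

open Classical in
/-- The ears that are used by a perfect matching of the augmented graph form a removable
family. -/
theorem PairsUp.removable (hK : K = H ⊔ ⨆ i, (ε i).path.toSubgraph)
    (hd : ∀ i j, i ≠ j → Disjoint (internalVerts (ε i).path) (internalVerts (ε j).path) ∧
      Disjoint (ε i).path.toSubgraph.edgeSet (ε j).path.toSubgraph.edgeSet)
    {σ : U → U} (hσ : PairsUp K.spanningCoe (vertFinset K) σ) :
    Removable H.spanningCoe (vertFinset H) (fun i => (ε i).fst) (fun i => (ε i).snd)
      (Finset.univ.filter fun i => σ (ε i).fst = (ε i).path.getVert 1) := by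
  set I := Finset.univ.filter fun i => σ (ε i).fst = (ε i).path.getVert 1 with hI
  have hmemI : ∀ i, i ∈ I ↔ σ (ε i).fst = (ε i).path.getVert 1 := fun i => by simp [hI]
  have hmemI' : ∀ i, i ∈ I ↔ σ (ε i).snd = (ε i).path.getVert ((ε i).path.length - 1) :=
    fun i => (hmemI i).trans (hσ.ear_iff hK (fun i j h => (hd i j h).1) i)
  have hear : ∀ i ∈ I, ∀ x, (x = (ε i).fst ∨ x = (ε i).snd) →
      (ε i).path.toSubgraph.Adj x (σ x) := by
    intro i hi x hx
    have hlen := (ε i).one_le_length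
    rw [(ε i).adj_iff]
    rcases hx with rfl | rfl
    · exact ⟨0, by omega, Or.inl ⟨by simp, (hmemI i).1 hi⟩⟩
    · refine ⟨(ε i).path.length - 1, by omega, Or.inr ⟨?_, (hmemI' i).1 hi⟩⟩
      rw [Nat.sub_add_cancel hlen]
      simp
  refine ⟨fun i hi j hj x hxi hxj => ?_, σ, fun x hx => ?_⟩
  -- At a common end of two used ears the matching edge would belong to both, but ears share no
  -- edge.
  · by_contra hne
    exact Set.disjoint_left.1 (hd i j hne).2
      (show s(x, σ x) ∈ (ε i).path.toSubgraph.edgeSet from hear i hi x hxi)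
      (show s(x, σ x) ∈ (ε j).path.toSubgraph.edgeSet from hear j hj x hxj)
  · obtain ⟨hxH, hxE⟩ := Finset.mem_sdiff.1 hx
    rw [mem_vertFinset] at hxH
    have hxK : x ∈ vertFinset K := mem_vertFinset.2 ((mem_verts_augmentation hK).2 (Or.inl hxH))
    obtain ⟨h1, h2, h3⟩ := hσ x hxK
    have hnot : ∀ i, ¬ (ε i).path.toSubgraph.Adj x (σ x) := by
      intro i hi
      have hxI : i ∈ I → x ≠ (ε i).fst ∧ x ≠ (ε i).snd := fun hi =>
        ⟨fun h => hxE (mem_ends.2 ⟨i, hi, Or.inl h⟩), fun h => hxE (mem_ends.2 ⟨i, hi, Or.inr h⟩)⟩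
      obtain ⟨j, hj, ⟨h4, h5⟩ | ⟨h4, h5⟩⟩ := (ε i).adj_iff.1 hi
      · rcases Nat.eq_zero_or_pos j with rfl | h0
        · have h4 : x = (ε i).fst := by simpa using h4
          exact (hxI ((hmemI i).2 (h4 ▸ h5))).1 h4
        · exact (ε i).getVert_notMem h0 hj (h4 ▸ hxH)
      · rcases Nat.lt_or_ge (j + 1) (ε i).path.length with hlt | hge
        · exact (ε i).getVert_notMem (Nat.succ_pos j) hlt (h4 ▸ hxH)
        · have hj' : j + 1 = (ε i).path.length := by omega
          have h4 : x = (ε i).snd := by rw [h4, hj']; simp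
          refine (hxI ((hmemI' i).2 ?_)).2 h4
          exact (congrArg σ h4).symm.trans (h5.trans (by rw [← hj', Nat.add_sub_cancel]))
    have hHadj : H.Adj x (σ x) := by
      rcases (adj_augmentation hK).1 h3 with h | ⟨i, hi⟩
      · exact h
      · exact (hnot i hi).elim
    refine ⟨Finset.mem_sdiff.2 ⟨mem_vertFinset.2 (H.edge_vert hHadj.symm), fun hE => ?_⟩, h2,
      hHadj⟩
    obtain ⟨i, hi, hσx⟩ := mem_ends.1 hE
    have := hear i hi (σ x) hσx
    rw [h2] at this
    exact hnot i this.symm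

/-- Every removable family of ears comes from a perfect matching of the augmented graph. -/
theorem exists_pairsUp_augmentation [DecidableEq U] (hK : K = H ⊔ ⨆ i, (ε i).path.toSubgraph)
    (hd : ∀ i j, i ≠ j → Disjoint (internalVerts (ε i).path) (internalVerts (ε j).path) ∧
      Disjoint (ε i).path.toSubgraph.edgeSet (ε j).path.toSubgraph.edgeSet)
    {I : Finset (Fin r)}
    (hI : ∀ i ∈ I, ∀ j ∈ I, ∀ x, (x = (ε i).fst ∨ x = (ε i).snd) →
      (x = (ε j).fst ∨ x = (ε j).snd) → i = j) {σ : U → U}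
    (hσ : PairsUp H.spanningCoe
      (vertFinset H \ ends (fun i => (ε i).fst) (fun i => (ε i).snd) I) σ) :
    ∃ τ, PairsUp K.spanningCoe (vertFinset K) τ ∧
      (∀ i, τ (ε i).fst = (ε i).path.getVert 1 ↔ i ∈ I) ∧
      ∀ x ∈ vertFinset H \ ends (fun i => (ε i).fst) (fun i => (ε i).snd) I, τ x = σ x := by
  classical
  -- On an ear in `I` all vertices are matched along the path, otherwise only the internal ones.
  -- Both sets have even size.
  have hear : ∀ i : Fin r, ∃ (A : Finset U) (ρ : U → U),
      PairsUp (ε i).path.toSubgraph.spanningCoe A ρ ∧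
      (∀ x, x ∈ A ↔ x ∈ internalVerts (ε i).path ∨ i ∈ I ∧ (x = (ε i).fst ∨ x = (ε i).snd)) ∧
      (i ∈ I → ρ (ε i).fst = (ε i).path.getVert 1) := by
    intro i
    obtain ⟨m, hm⟩ := (ε i).odd_length
    have hadj : ∀ j, j + 1 ≤ 2 * m + 1 → (ε i).path.toSubgraph.spanningCoe.Adj
        ((ε i).path.getVert j) ((ε i).path.getVert (j + 1)) := fun j hj =>
      (ε i).adj_iff.2 ⟨j, by omega, Or.inl ⟨rfl, rfl⟩⟩
    have h0 : (ε i).path.getVert 0 = (ε i).fst := by simp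
    have hl : (ε i).path.getVert (2 * m + 1) = (ε i).snd := by rw [← hm]; simp
    by_cases hi : i ∈ I
    · obtain ⟨ρ, h1, h2⟩ := exists_pairsUp_path (L := (ε i).path.toSubgraph.spanningCoe)
        (g := (ε i).path.getVert) (s := 0) (m := m + 1)
        (fun j hj k hk h => (ε i).getVert_inj (by have := hj.2; omega) (by have := hk.2; omega) h)
        (fun j _ hj => hadj j (by omega))
      refine ⟨_, ρ, h1, fun x => ?_, fun _ => ?_⟩
      · rw [(ε i).mem_internalVerts]
        simp only [Finset.mem_image, Finset.mem_Ico, hi, true_and]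
        constructor
        · rintro ⟨j, hj, rfl⟩
          by_cases hj0 : j = 0
          · exact Or.inr (Or.inl (by rw [hj0, h0]))
          by_cases hjl : j = 2 * m + 1
          · exact Or.inr (Or.inr (by rw [hjl, hl]))
          · exact Or.inl ⟨j, by omega, by omega, rfl⟩
        · rintro (⟨j, hj0, hjl, rfl⟩ | rfl | rfl)
          · exact ⟨j, by omega, rfl⟩
          · exact ⟨0, by omega, h0⟩
          · exact ⟨2 * m + 1, by omega, hl⟩
      · have := h2 0 (by omega)
        rwa [Nat.mul_zero, Nat.add_zero, h0] at this
    · obtain ⟨ρ, h1, -⟩ := exists_pairsUp_path (L := (ε i).path.toSubgraph.spanningCoe)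
        (g := (ε i).path.getVert) (s := 1) (m := m)
        (fun j hj k hk h => (ε i).getVert_inj (by have := hj.2; omega) (by have := hk.2; omega) h)
        (fun j _ hj => hadj j (by omega))
      refine ⟨_, ρ, h1, fun x => ?_, fun h => (hi h).elim⟩
      rw [(ε i).mem_internalVerts]
      simp only [Finset.mem_image, Finset.mem_Ico, hi, false_and, or_false]
      constructor
      · rintro ⟨j, hj, rfl⟩
        exact ⟨j, by omega, by omega, rfl⟩
      · rintro ⟨j, hj0, hjl, rfl⟩
        exact ⟨j, by omega, rfl⟩
  choose A ρ hρ hA hρI using hear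
  have hAH : ∀ i x, x ∈ A i → x ∈ H.verts → i ∈ I ∧ (x = (ε i).fst ∨ x = (ε i).snd) := by
    intro i x hx hxH
    rcases (hA i x).1 hx with h | h
    · exact (Set.disjoint_left.1 (ε i).internal_new h hxH).elim
    · exact h
  set W := vertFinset H \ ends (fun i => (ε i).fst) (fun i => (ε i).snd) I with hW
  let B : Option (Fin r) → Finset U := fun o => o.elim W A
  let φ : Option (Fin r) → U → U := fun o => o.elim σ ρ
  have hWA : ∀ i x, x ∈ W → x ∈ A i → False := by
    intro i x hx hx'
    obtain ⟨h1, h2⟩ := Finset.mem_sdiff.1 hx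
    obtain ⟨h3, h4⟩ := hAH i x hx' (mem_vertFinset.1 h1)
    exact h2 (mem_ends.2 ⟨i, h3, h4⟩)
  have hB : ∀ o o' x, x ∈ B o → x ∈ B o' → o = o' := by
    rintro (_ | i) (_ | j) x hx hx'
    · rfl
    · exact (hWA j x hx hx').elim
    · exact (hWA i x hx' hx).elim
    · congr 1
      by_cases hxH : x ∈ H.verts
      · obtain ⟨h1, h2⟩ := hAH i x hx hxH
        obtain ⟨h3, h4⟩ := hAH j x hx' hxH
        exact hI i h1 j h3 x h2 h4
      · have key : ∀ k, x ∈ A k → x ∈ internalVerts (ε k).path := by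
          intro k hk
          rcases (hA k x).1 hk with h | ⟨-, rfl | rfl⟩
          · exact h
          · exact (hxH (ε k).fst_mem).elim
          · exact (hxH (ε k).snd_mem).elim
        by_contra hne
        exact Set.disjoint_left.1 (hd i j hne).1 (key i hx) (key j hx')
  obtain ⟨τ, hτ⟩ := exists_glue B φ hB
  have hτW : ∀ x ∈ W, τ x = σ x := hτ none
  have hτA : ∀ i, ∀ x ∈ A i, τ x = ρ i x := fun i => hτ (some i)
  have hcover : vertFinset K = Finset.univ.biUnion B := by
    ext x
    simp only [Finset.mem_biUnion, Finset.mem_univ, true_and, mem_vertFinset,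
      mem_verts_augmentation hK]
    constructor
    · rintro (h | ⟨i, hi⟩)
      · by_cases hx : x ∈ W
        · exact ⟨none, hx⟩
        · have : x ∈ ends (fun i => (ε i).fst) (fun i => (ε i).snd) I := by
            by_contra hx'
            exact hx (Finset.mem_sdiff.2 ⟨mem_vertFinset.2 h, hx'⟩)
          obtain ⟨i, hi, h'⟩ := mem_ends.1 this
          exact ⟨some i, (hA i x).2 (Or.inr ⟨hi, h'⟩)⟩
      · exact ⟨some i, (hA i x).2 (Or.inl hi)⟩
    · rintro ⟨_ | i, hx⟩
      · exact Or.inl (mem_vertFinset.1 (Finset.mem_sdiff.1 hx).1)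
      · rcases (hA i x).1 hx with h | ⟨-, rfl | rfl⟩
        · exact Or.inr ⟨i, h⟩
        · exact Or.inl (ε i).fst_mem
        · exact Or.inl (ε i).snd_mem
  refine ⟨τ, ?_, fun i => ⟨fun h => ?_, fun hi => ?_⟩, hτW⟩
  · rw [hcover]
    refine PairsUp.biUnion fun o _ => ?_
    rcases o with _ | i
    · exact (hσ.congr hτW).mono fun x y h => (adj_augmentation hK).2 (Or.inl h)
    · exact ((hρ i).congr (hτA i)).mono fun x y h => (adj_augmentation hK).2 (Or.inr ⟨i, h⟩)
  · by_contra hi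
    have hadj : (ε i).path.toSubgraph.Adj (ε i).fst ((ε i).path.getVert 1) :=
      (ε i).adj_iff.2 ⟨0, (ε i).one_le_length, Or.inl ⟨by simp, rfl⟩⟩
    -- For `i` outside `I` the end of the ear is matched inside `H` or along another ear, and
    -- neither contains the first edge of ear `i`.
    by_cases hx : (ε i).fst ∈ W
    · have := (hσ _ hx).2.2
      rw [← hτW _ hx, h] at this
      exact (ε i).not_adj_of_adj hadj this
    · have : (ε i).fst ∈ ends (fun i => (ε i).fst) (fun i => (ε i).snd) I := by
        by_contra hx'
        exact hx (Finset.mem_sdiff.2 ⟨mem_vertFinset.2 (ε i).fst_mem, hx'⟩)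
      obtain ⟨k, hk, h'⟩ := mem_ends.1 this
      have hxA : (ε i).fst ∈ A k := (hA k _).2 (Or.inr ⟨hk, h'⟩)
      have h1 := (hρ k _ hxA).2.2
      rw [← hτA k _ hxA, h] at h1
      refine Set.disjoint_left.1 (hd i k (fun h => hi (h ▸ hk))).2
        (show s((ε i).fst, (ε i).path.getVert 1) ∈ _ from hadj) h1
  · rw [hτA i _ ((hA i _).2 (Or.inr ⟨hi, Or.inl rfl⟩)), hρI i hi]

end EarAugmentation

/-! ### Edges and perfect matchings gained by ears -/

section Counting

variable {U : Type*}

theorem Ear.ncard_edgeSet_le {H : Gph U} (ε : Ear H) :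
    ε.path.toSubgraph.edgeSet.ncard ≤ ε.path.length := by
  classical
  have h1 : ε.path.toSubgraph.edgeSet = (ε.path.edges.toFinset : Set (Sym2 U)) := by
    ext e
    simp
  rw [h1, Set.ncard_coe_finset, ← SimpleGraph.Walk.length_edges]
  exact List.toFinset_card_le _

variable [Finite U] {H K : Gph U} {r : ℕ} {ε : Fin r → Ear H}

/-- An ear has one more edge than internal vertices, so it raises edges minus vertices by at most
one. -/
theorem numEdges_augmentation (hK : K = H ⊔ ⨆ i, (ε i).path.toSubgraph)
    (hd : ∀ i j, i ≠ j → Disjoint (internalVerts (ε i).path) (internalVerts (ε j).path)) :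
    numEdges K + numVerts H ≤ numEdges H + numVerts K + r := by
  classical
  have hfin : ∀ s : Set (Sym2 U), s.Finite := fun s => Set.toFinite s
  have h1 : K.edgeSet ⊆ H.edgeSet ∪ ⋃ i, (ε i).path.toSubgraph.edgeSet := by
    intro e he
    induction e with
    | h x y =>
      rcases (adj_augmentation hK).1 he with h | ⟨i, hi⟩
      · exact Or.inl h
      · exact Or.inr (Set.mem_iUnion.2 ⟨i, hi⟩)
  have h2 : numEdges K ≤ numEdges H + ∑ i, (ε i).path.length := by
    refine (Set.ncard_le_ncard h1 (hfin _)).trans ((Set.ncard_union_le _ _).trans ?_)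
    refine Nat.add_le_add_left ?_ _
    have h3 : (⋃ i, (ε i).path.toSubgraph.edgeSet).ncard ≤
        ∑ i, (ε i).path.toSubgraph.edgeSet.ncard := by
      have := Finset.card_biUnion_le (s := (Finset.univ : Finset (Fin r)))
        (t := fun i => (hfin (ε i).path.toSubgraph.edgeSet).toFinset)
      simp only [← Set.ncard_eq_toFinset_card] at this
      refine le_trans (le_of_eq ?_) this
      rw [← Set.ncard_coe_finset]
      congr 1
      ext e
      simp
    exact h3.trans (Finset.sum_le_sum fun i _ => (ε i).ncard_edgeSet_le)
  have h4 : numVerts H + ∑ i, (internalVerts (ε i).path).ncard ≤ numVerts K := by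
    have hA : Disjoint (vertFinset H)
        (Finset.univ.biUnion fun i => (internalVerts (ε i).path).toFinite.toFinset) := by
      rw [Finset.disjoint_left]
      intro x hx hx'
      obtain ⟨i, -, hi⟩ := Finset.mem_biUnion.1 hx'
      exact Set.disjoint_left.1 (ε i).internal_new (by simpa using hi) (mem_vertFinset.1 hx)
    have hB : (Finset.univ.biUnion fun i => (internalVerts (ε i).path).toFinite.toFinset).card =
        ∑ i, (internalVerts (ε i).path).ncard := by
      rw [Finset.card_biUnion]
      · exact Finset.sum_congr rfl fun i _ => (Set.ncard_eq_toFinset_card _ _).symm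
      · intro i _ j _ hij
        rw [Function.onFun, Finset.disjoint_left]
        intro x hx hx'
        exact Set.disjoint_left.1 (hd i j hij) (by simpa using hx) (by simpa using hx')
    rw [← hB, ← card_vertFinset, ← card_vertFinset, ← Finset.card_union_of_disjoint hA]
    refine Finset.card_le_card fun x hx => ?_
    rw [mem_vertFinset, mem_verts_augmentation hK]
    rcases Finset.mem_union.1 hx with h | h
    · exact Or.inl (mem_vertFinset.1 h)
    · obtain ⟨i, -, hi⟩ := Finset.mem_biUnion.1 h
      exact Or.inr ⟨i, by simpa using hi⟩
  have h5 : ∑ i, (ε i).path.length = ∑ i, (internalVerts (ε i).path).ncard + r := by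
    rw [Finset.sum_congr rfl fun i _ => (ε i).ncard_internalVerts.symm, Finset.sum_add_distrib]
    simp
  omega

-- Perfect matchings of `H` extend without using ears and are recovered by restriction to `H`. A
-- nonempty removable family extends to a matching using exactly its ears and is recovered as the
-- set of used ears. The two kinds are disjoint.
open Classical in
theorem numPM_augmentation (hK : K = H ⊔ ⨆ i, (ε i).path.toSubgraph)
    (hd : ∀ i j, i ≠ j → Disjoint (internalVerts (ε i).path) (internalVerts (ε j).path) ∧
      Disjoint (ε i).path.toSubgraph.edgeSet (ε j).path.toSubgraph.edgeSet) :
    numPM H + (Finset.univ.filter fun I : Finset (Fin r) => I.Nonempty ∧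
      Removable H.spanningCoe (vertFinset H) (fun i => (ε i).fst) (fun i => (ε i).snd) I).card ≤
        numPM K := by
  have hfin : ∀ s : Set (Gph U), s.Finite := fun s => Set.toFinite s
  have h1 : ∀ M : Gph U, ∃ M' : Gph U, IsPerfectMatchingOf M H → IsPerfectMatchingOf M' K ∧
      (∀ i, ¬ M'.Adj (ε i).fst ((ε i).path.getVert 1)) ∧
      ∀ x ∈ H.verts, ∀ y, M'.Adj x y ↔ M.Adj x y := by
    intro M
    by_cases hM : IsPerfectMatchingOf M H
    · obtain ⟨σ, hσ, hσ'⟩ := hM.exists_pairsUp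
      have he : ends (fun i => (ε i).fst) (fun i => (ε i).snd) (∅ : Finset (Fin r)) = ∅ := rfl
      obtain ⟨τ, hτ, hτ1, hτ2⟩ := exists_pairsUp_augmentation hK hd (I := ∅) (σ := σ) (by simp)
        (by rw [he, Finset.sdiff_empty]; exact hσ.mono fun _ _ h => hM.1.2 h)
      rw [he, Finset.sdiff_empty] at hτ2
      obtain ⟨M', hM', hM'adj⟩ := hτ.exists_isPerfectMatchingOf
      refine ⟨M', fun _ => ⟨hM', fun i hi => ?_, fun x hx y => ?_⟩⟩
      · exact Finset.notMem_empty i ((hτ1 i).1 ((hM'adj _ _).1 hi).2)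
      · rw [hM'adj, hσ', hτ2 x (mem_vertFinset.2 hx)]
        have : x ∈ K.verts := (mem_verts_augmentation hK).2 (Or.inl hx)
        tauto
    · exact ⟨M, fun h => (hM h).elim⟩
  choose f hf using h1
  have h2 : ∀ I : Finset (Fin r), ∃ M' : Gph U, Removable H.spanningCoe (vertFinset H)
      (fun i => (ε i).fst) (fun i => (ε i).snd) I → IsPerfectMatchingOf M' K ∧
      ∀ i, M'.Adj (ε i).fst ((ε i).path.getVert 1) ↔ i ∈ I := by
    intro I
    by_cases hI : Removable H.spanningCoe (vertFinset H)
      (fun i => (ε i).fst) (fun i => (ε i).snd) I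
    · obtain ⟨hI1, σ, hσ⟩ := id hI
      obtain ⟨τ, hτ, hτ1, -⟩ := exists_pairsUp_augmentation hK hd hI1 hσ
      obtain ⟨M', hM', hM'adj⟩ := hτ.exists_isPerfectMatchingOf
      refine ⟨M', fun _ => ⟨hM', fun i => ?_⟩⟩
      rw [hM'adj, ← hτ1]
      have : (ε i).fst ∈ K.verts := (mem_verts_augmentation hK).2 (Or.inl (ε i).fst_mem)
      tauto
    · exact ⟨H, fun h => (hI h).elim⟩
  choose g hg using h2
  set 𝓕 := Finset.univ.filter fun I : Finset (Fin r) => I.Nonempty ∧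
      Removable H.spanningCoe (vertFinset H) (fun i => (ε i).fst) (fun i => (ε i).snd) I with h𝓕
  have h𝓕' : ∀ I ∈ 𝓕, I.Nonempty ∧ Removable H.spanningCoe (vertFinset H)
      (fun i => (ε i).fst) (fun i => (ε i).snd) I := fun I hI => (Finset.mem_filter.1 hI).2
  have hfinj : Set.InjOn f {M | IsPerfectMatchingOf M H} := by
    intro M hM M' hM' hMM'
    have hadj : ∀ x y, M.Adj x y ↔ M'.Adj x y := by
      intro x y
      by_cases hx : x ∈ H.verts
      · rw [← (hf M hM).2.2 x hx y, hMM', (hf M' hM').2.2 x hx y]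
      · exact ⟨fun h => (hx (hM.2.1 ▸ M.edge_vert h)).elim,
          fun h => (hx (hM'.2.1 ▸ M'.edge_vert h)).elim⟩
    exact SimpleGraph.Subgraph.ext (hM.2.1.trans hM'.2.1.symm)
      (funext fun x => funext fun y => propext (hadj x y))
  have hginj : Set.InjOn g (𝓕 : Set (Finset (Fin r))) := by
    intro I hI J hJ hIJ
    ext i
    rw [← (hg I (h𝓕' I hI).2).2 i, hIJ, (hg J (h𝓕' J hJ).2).2 i]
  have hdisj : Disjoint (f '' {M | IsPerfectMatchingOf M H}) (g '' (𝓕 : Set (Finset (Fin r)))) := by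
    rw [Set.disjoint_left]
    rintro _ ⟨M, hM, rfl⟩ ⟨I, hI, hIM⟩
    obtain ⟨⟨i, hi⟩, hIR⟩ := h𝓕' I hI
    refine (hf M hM).2.1 i ?_
    rw [← hIM]
    exact ((hg I hIR).2 i).2 hi
  rw [numPM, numPM, ← hfinj.ncard_image, ← Set.ncard_coe_finset 𝓕, ← hginj.ncard_image,
    ← Set.ncard_union_eq hdisj (hfin _) (hfin _)]
  refine Set.ncard_le_ncard ?_ (hfin _)
  rintro _ (⟨M, hM, rfl⟩ | ⟨I, hI, rfl⟩)
  · exact (hf M hM).1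
  · exact (hg I (h𝓕' I hI).2).1

/-- An ear augmentation adds at most twice as many ears as perfect matchings. -/
theorem IsEarAugmentation.bounds (hH : OneExtendable H) (hK' : OneExtendable K)
    (h : IsEarAugmentation H K) :
    H ≤ K ∧ numPM H ≤ numPM K ∧
      numEdges K + numVerts H + 2 * numPM H ≤ numEdges H + numVerts K + 2 * numPM K ∧
      ∃ τ, PairsUp K.spanningCoe (vertFinset K) τ ∧
        PairsUp H.spanningCoe (vertFinset H) τ := by
  classical
  obtain ⟨r, ε, hr, hd, hK⟩ := h
  have hH' := hH.elementary (ε ⟨0, hr⟩).fst_mem (ε ⟨0, hr⟩).snd_mem (ε ⟨0, hr⟩).ne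
  have h1 := numEdges_augmentation hK fun i j hij => (hd i j hij).1
  have h2 := numPM_augmentation hK hd
  have h3 := hH'.card_le_two_mul_removable (ι := Fin r) (a := fun i => (ε i).fst)
    (b := fun i => (ε i).snd)
    (fun i => ⟨mem_vertFinset.2 (ε i).fst_mem, mem_vertFinset.2 (ε i).snd_mem⟩)
    -- Since `K` is 1-extendable, the first edge of ear `i` lies in a perfect matching, and the ears
    -- used by it form a removable family containing `i`.
    (fun i => (ε i).ne) (fun i => by
      have hadj : (ε i).path.toSubgraph.Adj (ε i).fst ((ε i).path.getVert 1) :=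
        (ε i).adj_iff.2 ⟨0, (ε i).one_le_length, Or.inl ⟨by simp, rfl⟩⟩
      obtain ⟨M, hM, he⟩ := hK'.2 s((ε i).fst, (ε i).path.getVert 1)
        ((adj_augmentation hK).2 (Or.inr ⟨i, hadj⟩))
      obtain ⟨σ, hσ, hσ'⟩ := hM.exists_pairsUp
      exact ⟨_, by simpa using ((hσ' _ _).1 he).2,
        (hσ.mono fun _ _ h => hM.1.2 h).removable hK hd⟩)
  rw [Fintype.card_fin] at h3
  refine ⟨hK ▸ le_sup_left, by omega, ?_, ?_⟩
  · have h4 := h2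
    have h5 := h3
    omega
  · obtain ⟨σ, hσ⟩ := hH'.matchable
    have he : ends (fun i => (ε i).fst) (fun i => (ε i).snd) (∅ : Finset (Fin r)) = ∅ := rfl
    obtain ⟨τ, hτ, -, hτ2⟩ := exists_pairsUp_augmentation hK hd (I := ∅) (σ := σ) (by simp)
      (by rw [he, Finset.sdiff_empty]; exact hσ)
    rw [he, Finset.sdiff_empty] at hτ2
    exact ⟨τ, hτ, hσ.congr hτ2⟩

/-- A matching that pairs up both `A` and `B` also pairs up their difference. This is how the added
vertices get a perfect matching of their own. -/
theorem PairsUp.sdiff {V : Type*} [DecidableEq V] {L K : SimpleGraph V} {A B : Finset V}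
    {τ : V → V} (hB : PairsUp K B τ) (hA : PairsUp L A τ) :
    PairsUp K (B \ A) τ := by
  intro x hx
  obtain ⟨hxB, hxA⟩ := Finset.mem_sdiff.1 hx
  obtain ⟨h1, h2, h3⟩ := hB x hxB
  refine ⟨Finset.mem_sdiff.2 ⟨h1, fun h => hxA ?_⟩, h2, h3⟩
  rw [← h2]
  exact (hA _ h).1

theorem vertFinset_mono {G K : Gph U} (h : G ≤ K) : vertFinset G ⊆ vertFinset K := fun _ hx =>
  mem_vertFinset.2 (h.1 (mem_vertFinset.1 hx))

/-- The numerical effect of a graded ear decomposition, and a perfect matching of the added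
vertices. -/
theorem BuiltByGradedEars.bounds [DecidableEq U] (h : BuiltByGradedEars H K) :
    H ≤ K ∧ numPM H ≤ numPM K ∧
      numEdges K + numVerts H + 2 * numPM H ≤ numEdges H + numVerts K + 2 * numPM K ∧
      Matchable K.spanningCoe (vertFinset K \ vertFinset H) := by
  obtain ⟨k, F, rfl, rfl, hF, hstep⟩ := h
  have key : ∀ i ≤ k, F 0 ≤ F i ∧ numPM (F 0) ≤ numPM (F i) ∧
      numEdges (F i) + numVerts (F 0) + 2 * numPM (F 0) ≤
        numEdges (F 0) + numVerts (F i) + 2 * numPM (F i) ∧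
      Matchable (F i).spanningCoe (vertFinset (F i) \ vertFinset (F 0)) := by
    intro i
    induction i with
    | zero =>
      intro _
      refine ⟨le_rfl, le_rfl, le_rfl, ?_⟩
      rw [Finset.sdiff_self]
      exact Matchable.empty
    | succ i ih =>
      intro hi
      obtain ⟨h1, h2, h3, h4⟩ := ih (by omega)
      obtain ⟨g1, g2, g3, τ, hτ, hτ'⟩ :=
        (hstep i (by omega)).bounds (hF i (by omega)) (hF (i + 1) hi)
      refine ⟨h1.trans g1, by omega, by omega, ?_⟩
      have h5 : Matchable (F (i + 1)).spanningCoe (vertFinset (F (i + 1)) \ vertFinset (F i)) :=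
        ⟨τ, hτ.sdiff hτ'⟩
      have h6 := h5.union (h4.mono fun x y h => g1.2 h) (by
        rw [Finset.disjoint_left]
        exact fun x hx hx' => (Finset.mem_sdiff.1 hx).2 (Finset.mem_sdiff.1 hx').1)
      convert h6 using 1
      ext x
      have h7 := @vertFinset_mono _ _ _ _ h1 x
      have h8 := @vertFinset_mono _ _ _ _ g1 x
      simp only [Finset.mem_sdiff, Finset.mem_union]
      tauto
  exact key k le_rfl

end Counting

/-- At most one of four propositions holds if they are pairwise exclusive. -/
theorem ite_add_ite_le_one {p q r s : Prop} [Decidable p] [Decidable q] [Decidable r]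
    [Decidable s] (hpr : p → r → False) (hqs : q → s → False) (hpq : p → q → False)
    (hrs : r → s → False) (hps : p → s → False) (hrq : r → q → False) :
    (if p then 1 else 0) + (if q then 1 else 0) +
      ((if r then 1 else 0) + (if s then 1 else 0)) ≤ 1 := by
  by_cases hp : p
  · rw [if_neg (hpr hp), if_neg (hpq hp), if_neg (hps hp), if_pos hp]
  by_cases hr : r
  · rw [if_neg hp, if_neg (hrs hr), if_neg (hrq hr), if_pos hr]
  by_cases hq : q
  · rw [if_neg hp, if_neg hr, if_neg (hqs hq), if_pos hq]
  · simp only [hp, hr, hq, if_false]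
    split_ifs <;> omega


/-! ### Free degrees at the two ends of an edge -/

section FreeEdges

variable {V : Type*}

open Classical in
/-- The neighbours of `u` in `W` along edges of `G` that are not edges of `H`. -/
noncomputable def freeNbrs (H G : SimpleGraph V) (W : Finset V) (u : V) : Finset V :=
  W.filter fun x => G.Adj u x ∧ ¬ H.Adj u x

theorem mem_freeNbrs {H G : SimpleGraph V} {W : Finset V} {u x : V} :
    x ∈ freeNbrs H G W u ↔ x ∈ W ∧ G.Adj u x ∧ ¬ H.Adj u x := by
  simp [freeNbrs]

/-- The ends of an edge of an elementary graph have few free neighbours altogether. -/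
theorem Elementary.two_mul_card_freeNbrs_add [DecidableEq V] {H G : SimpleGraph V}
    {W : Finset V} (hH : Elementary H W) (hHG : ∀ x y, H.Adj x y → G.Adj x y)
    (hfree : ∀ x ∈ W, ∀ y ∈ W, G.Adj x y → ¬ H.Adj x y → ¬ Matchable G (W \ {x, y}))
    {u v : V} (huv : H.Adj u v) :
    2 * ((freeNbrs H G W u).card + (freeNbrs H G W v).card) + 2 ≤ W.card := by
  classical
  obtain ⟨σ, hσ, hσu⟩ := hH.ext u v huv
  have hu := hH.mem _ _ huv
  have hv := hH.mem _ _ huv.symm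
  have hσT := hσ.sdiff_pair hu
  rw [hσu] at hσT
  set T := W \ {u, v} with hT
  have hTmem : ∀ x, x ∈ T ↔ x ∈ W ∧ x ≠ u ∧ x ≠ v := fun x => by simp [hT]
  have hnot : ∀ x y, G.Adj x y ∧ ¬ H.Adj x y → x ∈ W → y ∈ W → ¬ Matchable H (W \ {x, y}) :=
    fun x y h hx hy hM => hfree x hx y hy h.1 h.2 (hM.mono hHG)
  have hor : ∀ w x y, H.Adj x y → w ∈ W → w ≠ x → G.Adj w x ∧ ¬ H.Adj w x →
      G.Adj w y ∧ ¬ H.Adj w y → False := by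
    intro w x y hxy hw hwx h1 h2
    rcases hH.matchable_sdiff_or hxy hw hwx with h | h
    · exact hnot w x h1 hw (hH.mem _ _ hxy) h
    · exact hnot w y h2 hw (hH.mem _ _ hxy.symm) h
  have hsymm : ∀ x y, G.Adj x y ∧ ¬ H.Adj x y → G.Adj y x ∧ ¬ H.Adj y x :=
    fun x y h => ⟨h.1.symm, fun h' => h.2 h'.symm⟩
  -- Replacing the matching edges `uv` and `x σ(x)` by `ux` and `v σ(x)` would put the free edge
  -- `ux` into a perfect matching.
  have hcross : ∀ x ∈ T, G.Adj u x ∧ ¬ H.Adj u x → G.Adj v (σ x) ∧ ¬ H.Adj v (σ x) → False := by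
    intro x hx h1 h2
    obtain ⟨hxW, hxu, hxv⟩ := (hTmem x).1 hx
    obtain ⟨hσW, hσxu, hσxv⟩ := (hTmem _).1 (hσT x hx).1
    refine hfree u hu x hxW h1.1 h1.2 ?_
    have h3 : Matchable G (T \ {x, σ x}) := Matchable.mono ⟨σ, hσT.sdiff_pair hx⟩ hHG
    convert h3.union (Matchable.pair h2.1) ?_ using 1
    · ext y
      simp only [Finset.mem_sdiff, Finset.mem_insert, Finset.mem_singleton, Finset.mem_union,
        hTmem, not_or]
      constructor
      · rintro ⟨hy, hyu, hyx⟩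
        by_cases h4 : y = v
        · exact Or.inr (Or.inl h4)
        by_cases h5 : y = σ x
        · exact Or.inr (Or.inr h5)
        · exact Or.inl ⟨⟨hy, hyu, h4⟩, hyx, h5⟩
      · rintro (⟨⟨hy, hyu, -⟩, hyx, -⟩ | rfl | rfl)
        · exact ⟨hy, hyu, hyx⟩
        · exact ⟨hv, huv.ne.symm, hxv.symm⟩
        · exact ⟨hσW, hσxu, (hσ x hxW).2.2.ne.symm⟩
    · rw [Finset.disjoint_left]
      intro y hy hy'
      simp only [Finset.mem_sdiff, Finset.mem_insert, Finset.mem_singleton, hTmem, not_or] at hy hy'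
      tauto
  let φ : V → ℕ := fun x => (if G.Adj u x ∧ ¬ H.Adj u x then 1 else 0) +
    (if G.Adj v x ∧ ¬ H.Adj v x then 1 else 0)
  -- Of the four possible free edges between `{u, v}` and `{x, σ x}`, any two with a common end are
  -- excluded by `hor` and any two disjoint ones by `hcross`.
  have hφ : ∀ x ∈ T, φ x + φ (σ x) ≤ 1 := by
    intro x hx
    obtain ⟨hxW, hxu, hxv⟩ := (hTmem x).1 hx
    obtain ⟨hσx, hσσ, hadj⟩ := hσT x hx
    obtain ⟨hσW, hσxu, hσxv⟩ := (hTmem _).1 hσx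
    have a1 := hor u x (σ x) hadj hu hxu.symm
    have a2 := hor v x (σ x) hadj hv hxv.symm
    have a3 := fun h1 h2 => hor x u v huv hxW hxu (hsymm _ _ h1) (hsymm _ _ h2)
    have a4 := fun h1 h2 => hor (σ x) u v huv hσW hσxu (hsymm _ _ h1) (hsymm _ _ h2)
    have a5 := hcross x hx
    have a6 := hcross (σ x) hσx
    rw [hσσ] at a6
    exact ite_add_ite_le_one a1 a2 a3 a4 a5 a6
  have hsum : ∑ x ∈ T, φ (σ x) = ∑ x ∈ T, φ x :=
    Finset.sum_nbij' σ σ (fun x hx => (hσT x hx).1) (fun x hx => (hσT x hx).1)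
      (fun x hx => (hσT x hx).2.1) (fun x hx => (hσT x hx).2.1) (fun _ _ => rfl)
  have hle : ∑ x ∈ T, (φ x + φ (σ x)) ≤ T.card := by
    have := Finset.sum_le_sum hφ
    simpa using this
  rw [Finset.sum_add_distrib, hsum] at hle
  have hfd : ∑ x ∈ T, φ x = (freeNbrs H G W u).card + (freeNbrs H G W v).card := by
    simp only [φ]
    rw [Finset.sum_add_distrib, ← Finset.card_filter, ← Finset.card_filter]
    congr 2
    · ext x
      rw [Finset.mem_filter, hTmem, mem_freeNbrs]
      constructor
      · rintro ⟨⟨h1, -⟩, h2⟩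
        exact ⟨h1, h2⟩
      · rintro ⟨h1, h2⟩
        exact ⟨⟨h1, fun h => h2.1.ne h.symm, fun h => h2.2 (h ▸ huv)⟩, h2⟩
    · ext x
      rw [Finset.mem_filter, hTmem, mem_freeNbrs]
      constructor
      · rintro ⟨⟨h1, -⟩, h2⟩
        exact ⟨h1, h2⟩
      · rintro ⟨h1, h2⟩
        exact ⟨⟨h1, fun h => h2.2 (h ▸ huv.symm), fun h => h2.1.ne h.symm⟩, h2⟩
  have hTcard : T.card + 2 = W.card := by
    have huvW : ({u, v} : Finset V) ⊆ W := by
      intro x hx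
      rcases Finset.mem_insert.1 hx with rfl | hx
      · exact hu
      · exact Finset.mem_singleton.1 hx ▸ hv
    have := Finset.card_sdiff_add_card_eq_card huvW
    rwa [Finset.card_pair huv.ne] at this
  omega

/-- Summed over `R`, the hypothesis counts each value of `f` at the vertex and again at its partner.
-/
theorem PairsUp.sum_le [DecidableEq V] {H : SimpleGraph V} {R : Finset V} {τ : V → V}
    (hτ : PairsUp H R τ) {f : V → ℕ} {N : ℕ}
    (hf : ∀ u ∈ R, 2 * (f u + f (τ u)) + 2 ≤ N) :
    4 * ∑ u ∈ R, f u + 2 * R.card ≤ R.card * N := by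
  have hsum : ∑ u ∈ R, f (τ u) = ∑ u ∈ R, f u :=
    Finset.sum_nbij' τ τ (fun x hx => (hτ x hx).1) (fun x hx => (hτ x hx).1)
      (fun x hx => (hτ x hx).2.1) (fun x hx => (hτ x hx).2.1) (fun _ _ => rfl)
  have h1 := Finset.sum_le_sum hf
  simp only [Finset.sum_add_distrib, ← Finset.mul_sum, Finset.sum_const, smul_eq_mul, hsum] at h1
  linarith

end FreeEdges

/-! ### Supergraphs with the same perfect matchings, and the excess -/

section Excess

variable {U : Type*} [Finite U]

/-- The perfect matchings of `H` are among those of `G`, and equal finite numbers force equality of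
the two sets. -/
theorem IsPerfectMatchingOf.of_mem_elemSupergraphs {G H M : Gph U} (hG : G ∈ elemSupergraphs H)
    (hM : IsPerfectMatchingOf M G) : IsPerfectMatchingOf M H := by
  obtain ⟨hHG, hv, hΦ⟩ := hG
  have hsub : {M : Gph U | IsPerfectMatchingOf M H} ⊆ {M : Gph U | IsPerfectMatchingOf M G} :=
    fun M hM => hM.mono hHG hv.symm
  have heq := Set.eq_of_subset_of_ncard_le hsub hΦ.le (Set.toFinite _)
  have : M ∈ {M : Gph U | IsPerfectMatchingOf M G} := hM
  rwa [← heq] at this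

theorem vertFinset_eq {G H : Gph U} (h : G.verts = H.verts) : vertFinset G = vertFinset H := by
  ext x
  rw [mem_vertFinset, mem_vertFinset, h]

theorem adj_of_pairsUp {G H : Gph U} (hG : G ∈ elemSupergraphs H) {σ : U → U}
    (hσ : PairsUp G.spanningCoe (vertFinset H) σ) {x : U} (hx : x ∈ H.verts) :
    H.Adj x (σ x) := by
  rw [← vertFinset_eq hG.2.1] at hσ
  obtain ⟨M, hM, hMσ⟩ := hσ.exists_isPerfectMatchingOf
  exact (hM.of_mem_elemSupergraphs hG).1.2 ((hMσ x (σ x)).2 ⟨hG.2.1 ▸ hx, rfl⟩)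

/-- The graph `H` together with the edges of `G` inside `H` that are not edges of `H'`. -/
def restrictFree (H H' G : Gph U) (hH : H ≤ G) : Gph U where
  verts := H.verts
  Adj x y := H.Adj x y ∨ (x ∈ H.verts ∧ y ∈ H.verts ∧ G.Adj x y ∧ ¬ H'.Adj x y)
  adj_sub := by
    rintro x y (h | h)
    · exact (hH.2 h).adj_sub
    · exact h.2.2.1.adj_sub
  edge_vert := by
    rintro x y (h | h)
    · exact H.edge_vert h
    · exact h.1
  symm := ⟨by
    rintro x y (h | ⟨h1, h2, h3, h4⟩)
    · exact Or.inl h.symm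
    · exact Or.inr ⟨h2, h1, h3.symm, fun h => h4 h.symm⟩⟩

/-- A perfect matching of the restricted graph, glued to one of the added vertices in `H'`, is a
perfect matching of `G`. It therefore uses only edges of `H'`, and inside the restricted graph those
are edges of `H`. -/
theorem restrictFree_mem_elemSupergraphs [DecidableEq U] {H H' G : Gph U} (hH : H ≤ H')
    (hG : G ∈ elemSupergraphs H')
    (hR : Matchable H'.spanningCoe (vertFinset H' \ vertFinset H)) :
    restrictFree H H' G (hH.trans hG.1) ∈ elemSupergraphs H := by
  have hle : H ≤ restrictFree H H' G (hH.trans hG.1) := ⟨le_rfl, fun x y h => Or.inl h⟩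
  refine ⟨hle, rfl, ?_⟩
  unfold numPM
  congr 1
  ext M
  refine ⟨fun hM => ⟨⟨hM.2.1.le, fun x y hxy => ?_⟩, hM.2⟩, fun hM => hM.mono hle rfl⟩
  obtain ⟨σ, hσ, hσM⟩ := IsPerfectMatchingOf.exists_pairsUp hM
  obtain ⟨τ, hτ⟩ := hR
  obtain ⟨ρ, hρ⟩ := exists_glue
    (fun b : Bool => if b then vertFinset H else vertFinset H' \ vertFinset H)
    (fun b => if b then σ else τ) (by
      rintro (_ | _) (_ | _) x hx hx'
      · rfl
      · exact ((Finset.mem_sdiff.1 hx).2 hx').elim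
      · exact ((Finset.mem_sdiff.1 hx').2 hx).elim
      · rfl)
  have hρσ : ∀ x ∈ vertFinset H, ρ x = σ x := hρ true
  have hρτ : ∀ x ∈ vertFinset H' \ vertFinset H, ρ x = τ x := hρ false
  have h1 : PairsUp G.spanningCoe (vertFinset H) ρ := by
    refine PairsUp.congr (σ := σ) ?_ hρσ
    refine PairsUp.mono (L := M.spanningCoe) hσ fun x y h => ?_
    rcases hM.1.2 h with h | h
    · exact (hH.trans hG.1).2 h
    · exact h.2.2.1
  have h2 : PairsUp G.spanningCoe (vertFinset H' \ vertFinset H) ρ :=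
    (hτ.congr hρτ).mono fun x y h => hG.1.2 h
  have h3 : PairsUp G.spanningCoe (vertFinset H') ρ := by
    intro x hx
    by_cases hxH : x ∈ vertFinset H
    · obtain ⟨h4, h5⟩ := h1 x hxH
      exact ⟨vertFinset_mono hH h4, h5⟩
    · obtain ⟨h4, h5⟩ := h2 x (Finset.mem_sdiff.2 ⟨hx, hxH⟩)
      exact ⟨(Finset.mem_sdiff.1 h4).1, h5⟩
  have hx : x ∈ H.verts := hM.2.1 ▸ M.edge_vert hxy
  have h4 := adj_of_pairsUp hG h3 (hH.1 hx)
  rw [hρσ x (mem_vertFinset.2 hx), ((hσM x y).1 hxy).2] at h4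
  rcases hM.1.2 hxy with h | h
  · exact h
  · exact (h.2.2.2 h4).elim

/-- An edge of `G` is in the restricted graph, or in `H'` but not `H`, or free with an end among the
added vertices. Free edges with both ends there are counted twice, which is harmless for an upper
bound. -/
theorem numEdges_le_restrictFree [DecidableEq U] {H H' G : Gph U} (hH : H ≤ H')
    (hG : G ∈ elemSupergraphs H') :
    numEdges G + numEdges H ≤ numEdges (restrictFree H H' G (hH.trans hG.1)) + numEdges H' +
      ∑ u ∈ vertFinset H' \ vertFinset H,
        (freeNbrs H'.spanningCoe G.spanningCoe (vertFinset H') u).card := by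
  classical
  have hfin : ∀ s : Set (Sym2 U), s.Finite := fun s => Set.toFinite s
  set R := vertFinset H' \ vertFinset H with hR
  set 𝓔 : Finset (Sym2 U) := R.biUnion fun u =>
    (freeNbrs H'.spanningCoe G.spanningCoe (vertFinset H') u).image fun x => s(u, x) with h𝓔
  have h1 : 𝓔.card ≤ ∑ u ∈ R,
      (freeNbrs H'.spanningCoe G.spanningCoe (vertFinset H') u).card :=
    Finset.card_biUnion_le.trans (Finset.sum_le_sum fun u _ => Finset.card_image_le)
  have hGv : ∀ x y, G.Adj x y → x ∈ H'.verts := fun x y h => hG.2.1 ▸ G.edge_vert h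
  have hfree : ∀ x y, G.Adj x y → ¬ H'.Adj x y → x ∉ H.verts → s(x, y) ∈ 𝓔 := by
    intro x y hxy hxy' hx
    refine Finset.mem_biUnion.2 ⟨x, Finset.mem_sdiff.2 ⟨mem_vertFinset.2 (hGv x y hxy), ?_⟩,
      Finset.mem_image.2 ⟨y, mem_freeNbrs.2 ⟨mem_vertFinset.2 (hGv y x hxy.symm), hxy, hxy'⟩,
        rfl⟩⟩
    rwa [mem_vertFinset]
  have h2 : G.edgeSet ⊆ ((restrictFree H H' G (hH.trans hG.1)).edgeSet ∪
      (H'.edgeSet \ H.edgeSet)) ∪ (𝓔 : Set (Sym2 U)) := by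
    intro e he
    induction e with
    | h x y =>
      have hxy : G.Adj x y := he
      by_cases h3 : H.Adj x y
      · exact Or.inl (Or.inl (Or.inl h3))
      by_cases h4 : H'.Adj x y
      · exact Or.inl (Or.inr ⟨h4, h3⟩)
      by_cases hx : x ∈ H.verts
      · by_cases hy : y ∈ H.verts
        · exact Or.inl (Or.inl (Or.inr ⟨hx, hy, hxy, h4⟩))
        · refine Or.inr ?_
          rw [Sym2.eq_swap]
          exact hfree y x hxy.symm (fun h => h4 h.symm) hy
      · exact Or.inr (hfree x y hxy h4 hx)
  have h3 := Set.ncard_le_ncard h2 (hfin _)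
  have h4 := Set.ncard_union_le ((restrictFree H H' G (hH.trans hG.1)).edgeSet ∪
      (H'.edgeSet \ H.edgeSet)) (𝓔 : Set (Sym2 U))
  have h5 := Set.ncard_union_le (restrictFree H H' G (hH.trans hG.1)).edgeSet
      (H'.edgeSet \ H.edgeSet)
  have h6 : (H'.edgeSet \ H.edgeSet).ncard + H.edgeSet.ncard = H'.edgeSet.ncard :=
    Set.ncard_sdiff_add_ncard_of_subset (SimpleGraph.Subgraph.edgeSet_mono hH) (hfin _)
  rw [Set.ncard_coe_finset] at h4
  simp only [numEdges]
  omega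

/-- The added vertices are perfectly matched by edges of `H'`, and the free-degree bound applies to
each of these edges. -/
theorem OneExtendable.sum_freeNbrs_le [DecidableEq U] {H H' G : Gph U}
    (hH' : OneExtendable H') (hG : G ∈ elemSupergraphs H')
    (hR : Matchable H'.spanningCoe (vertFinset H' \ vertFinset H)) :
    4 * ∑ u ∈ vertFinset H' \ vertFinset H,
        (freeNbrs H'.spanningCoe G.spanningCoe (vertFinset H') u).card +
      2 * (vertFinset H' \ vertFinset H).card ≤
        (vertFinset H' \ vertFinset H).card * (vertFinset H').card := by
  obtain ⟨τ, hτ⟩ := hR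
  refine hτ.sum_le fun u hu => ?_
  have hadj : H'.Adj u (τ u) := (hτ u hu).2.2
  have hE := hH'.elementary (H'.edge_vert hadj) (H'.edge_vert hadj.symm) hadj.ne
  refine hE.two_mul_card_freeNbrs_add (fun x y h => hG.1.2 h) ?_ hadj
  intro x hx y hy hxy hxy' hM
  obtain ⟨σ, hσ, rfl⟩ := hM.exists_pairsUp hxy hx hy
  exact hxy' (adj_of_pairsUp hG hσ (mem_vertFinset.1 hx))

end Excess

end EarExcess

theorem mainTheorem2 {U : Type*} [Finite U] (H H' G G' : EarExcess.Gph U) (n N q p : ℕ)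
    (hH : EarExcess.OneExtendable H) (hn : EarExcess.numVerts H = n)
    (hq : EarExcess.numPM H = q)
    (hH' : EarExcess.OneExtendable H') (hbuilt : EarExcess.BuiltByGradedEars H H')
    (hN : EarExcess.numVerts H' = N) (hp : EarExcess.numPM H' = p) (hpq : q < p)
    (hG : EarExcess.IsEdgeMaximum G H) (hG' : EarExcess.IsEdgeMaximum G' H') :
    EarExcess.excess G' ≤
      EarExcess.excess G + 2 * ((p : ℝ) - (q : ℝ))
        - 1 / 4 * ((N : ℝ) - (n : ℝ)) * ((n : ℝ) - 2) := by
  classical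
  obtain ⟨hle, -, hcount, hR⟩ := hbuilt.bounds
  have h1 := EarExcess.numEdges_le_restrictFree hle hG'.1
  have h2 := hH'.sum_freeNbrs_le hG'.1 hR
  have h3 := hG.2 _ (EarExcess.restrictFree_mem_elemSupergraphs hle hG'.1 hR)
  have hvG : EarExcess.numVerts G = n := by rw [← hn, EarExcess.numVerts, hG.1.2.1]; rfl
  have hvG' : EarExcess.numVerts G' = N := by rw [← hN, EarExcess.numVerts, hG'.1.2.1]; rfl
  have hRcard : (EarExcess.vertFinset H' \ EarExcess.vertFinset H).card + n = N := by
    rw [← hn, ← hN, ← EarExcess.card_vertFinset, ← EarExcess.card_vertFinset]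
    exact Finset.card_sdiff_add_card_eq_card (EarExcess.vertFinset_mono hle)
  rw [EarExcess.card_vertFinset, hN] at h2
  rw [hn, hN, hq, hp] at hcount
  rw [EarExcess.excess, EarExcess.excess, hvG, hvG']
  generalize (∑ u ∈ EarExcess.vertFinset H' \ EarExcess.vertFinset H, _ : ℕ) = s at h1 h2
  generalize (EarExcess.vertFinset H' \ EarExcess.vertFinset H).card = k at h2 hRcard
  generalize EarExcess.numEdges (EarExcess.restrictFree H H' G' _) = e₀ at h1 h3
  have e1 : ((EarExcess.numEdges G' + EarExcess.numEdges H : ℕ) : ℝ) ≤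
    ((e₀ + EarExcess.numEdges H' + s : ℕ) : ℝ) := Nat.cast_le.2 h1
  have e2 : ((4 * s + 2 * k : ℕ) : ℝ) ≤ ((k * N : ℕ) : ℝ) := Nat.cast_le.2 h2
  have e3 : ((e₀ : ℕ) : ℝ) ≤ (EarExcess.numEdges G : ℝ) := Nat.cast_le.2 h3
  have e4 : ((EarExcess.numEdges H' + n + 2 * q : ℕ) : ℝ) ≤
    ((EarExcess.numEdges H + N + 2 * p : ℕ) : ℝ) := Nat.cast_le.2 hcount
  have e5 : (N : ℝ) = (k : ℝ) + (n : ℝ) := by rw [← hRcard]; push_cast; ring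
  push_cast at e1 e2 e4
  rw [e5] at e2 e4 ⊢
  -- With N = n + k, the terms in k combine as k + k(N - 2)/4 - (N² - n²)/4 = -k(n - 2)/4.
  nlinarith [e1, e2, e3, e4]
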